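/- Theorem 3.5. Let $c>0$, $m>0$, $e\in\mathbb R\setminus\{0\}$, and let $\rho\in L^2(\mathbb R^3)$ be a spherically symmetric probability density with bounded support; put $\rho_r(x)=r^{-3}\rho(x/r)$ for $r>0$. Let $L^2_*$ be the real Hilbert space of square integrable divergence-free vector fields on $\mathbb R^3$, $M$ the orthogonal projection of the square integrable vector fields onto $L^2_*$, and $H^s_*$ ($s=1,2$) the space of the fields in $L^2_*$ with components in the Sobolev space $H^s(\mathbb R^3)$. Put $\langle\rho_r,A\rangle=\int\rho_rA\,dx\in\mathbb R^3$, $$E(\rho_r)=\frac1{4\pi}\iint\frac{\rho_r(x)\rho_r(y)}{|x-y|}\,dx\,dy,\qquad m_r=m-\frac{8\pi e^2}{3c^2}E(\rho_r),$$ and let $H_r$ be the operator in $L^2_*$ with domain $H^2_*$ given by $$H_rA=-\Delta A+\frac{4\pi e^2}{m_rc^2}\,M\big(\rho_r\langle\rho_r,A\rangle\big).$$ Put $\lambda_0=\left(\frac{3mc^2}{2e^2}\right)^2$ and fix $\lambda>\lambda_0$. For $z\ge 0$ let $G_z(x)=\frac{e^{-\sqrt z|x|}}{4\pi|x|}$ and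 $\Gamma_m(z)=-\frac{mc^2}{4\pi e^2}+\frac{\sqrt z}{6\pi}$. For $Q\in\mathbb R^3$ let $MQG_0(x)=\frac1{8\pi|x|}\left(Q+\frac{x(x\cdot Q)}{|x|^2}\right)$. Let $H_m$ be the self-adjoint operator in $L^2_*$ whose domain consists of the $A\in L^2_*$ for which there is $Q_A\in\mathbb R^3$ with $A_\lambda:=A-\frac{4\pi e}{c}MQ_AG_\lambda\in H^2_*$ and $$\lim_{r\downarrow0}\frac1{4\pi r^2}\int_{S_r}\Big(A-\frac{4\pi e}{c}MQ_AG_0\Big)d\mu_r=-\frac{mc}{e}Q_A ,$$ with $(H_m+\lambda)A=(-\Delta+\lambda)A_\lambda$; here $\mu_r$ is the surface measure of the sphere $S_r$ of radius $r$ centred at the origin, and the limit is an essential limit in $r$, since the spherical means of an $L^2$ class are defined for almost every $r$. Let $D(F_m)$ be the set of the $A\in L^2_*$ for which there is a (necessarily unique) $Q_A\in\mathbb R^3$ with $A_\lambda:=A-\frac{4\pi e}{c}MQ_AG_\lambda\in H^1_*$, and let $$F_m(A,A)=\|(-\Delta+\lambda)^{1/2}A_\lambda\|_2^2+\Big(\frac{4\pi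 e}{c}\Big)^2\Gamma_m(\lambda)|Q_A|^2-\lambda\|A\|_2^2,\qquad A\in D(F_m),$$ where $\|(-\Delta+\lambda)^{1/2}u\|_2^2=\|\nabla u\|_2^2+\lambda\|u\|_2^2$. ($H_m$, $Q_A$, $D(F_m)$ and $F_m$ do not depend on the choice of $\lambda$.) Let $V:\mathbb R^3\to\mathbb R$, $E\in L^2_*$, $q,p\in\mathbb R^3$, and let $A_r\in H^1_*$ ($r>0$) and $A\in D(F_m)$ satisfy $$\lim_{r\downarrow0}\big\|(H_r+\lambda)^{1/2}A_r-(H_m+\lambda)^{1/2}A\big\|_2=0 .$$ (For all small $r>0$, $H_r+\lambda$ is a non-negative self-adjoint operator, so that its square root is defined.) Then $$\lim_{r\downarrow0}\Big(2\pi c^2\|E\|_2^2+\frac1{8\pi}\|\nabla A_r\|_2^2+\frac1{2m_r}\Big|p-\frac ec\langle\rho_r,A_r\rangle\Big|^2+V(q)\Big)=2\pi c^2\|E\|_2^2+\frac1{8\pi}F_m(A,A)+p\cdot Q_A+V(q).$$ -/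

import Mathlib

open MeasureTheory Filter Topology
open scoped ContDiff RealInnerProductSpace

noncomputable section

namespace PointMaxwell

/-- Physical space. -/
abbrev E3 : Type := EuclideanSpace ℝ (Fin 3)

/-- The real Hilbert space of square integrable vector fields on `ℝ³`. -/
abbrev Vec : Type := Lp E3 2 (volume : Measure E3)

/-- Real test functions on `ℝ³`. -/
def IsTest (φ : E3 → ℝ) : Prop := ContDiff ℝ ∞ φ ∧ HasCompactSupport φ

/-- The gradient of a test function is square integrable. -/
theorem IsTest.memLp_gradient {φ : E3 → ℝ} (hφ : IsTest φ) :
    MemLp (gradient φ) 2 (volume : Measure E3) := by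
  have hc : Continuous (fderiv ℝ φ) := hφ.1.continuous_fderiv (by simp)
  have hg : gradient φ = fun x => (InnerProductSpace.toDual ℝ E3).symm (fderiv ℝ φ x) := rfl
  have hs : HasCompactSupport (gradient φ) := by
    rw [hg]
    exact (hφ.2.fderiv (𝕜 := ℝ)).comp_left (g := (InnerProductSpace.toDual ℝ E3).symm) (by simp)
  have hgc : Continuous (gradient φ) := by
    rw [hg]
    exact (InnerProductSpace.toDual ℝ E3).symm.continuous.comp hc
  exact hgc.memLp_of_hasCompactSupport hs

/-- The pairing of an `L²` field with the gradient of a test function is an `L²` inner product. -/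
theorem integral_inner_gradient {φ : E3 → ℝ} (hφ : IsTest φ) (A : Vec) :
    ∫ x, ⟪gradient φ x, A x⟫ = ⟪hφ.memLp_gradient.toLp (gradient φ), A⟫ := by
  rw [L2.inner_def]
  apply integral_congr_ae
  filter_upwards [hφ.memLp_gradient.coeFn_toLp] with x hx
  rw [hx]

/-- The square integrable fields whose distributional divergence vanishes. -/
def solenoidal : Submodule ℝ Vec where
  carrier := {A | ∀ φ : E3 → ℝ, IsTest φ → ∫ x, ⟪gradient φ x, A x⟫ = 0}
  add_mem' := by
    intro A B hA hB φ hφ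
    have hA' := hA φ hφ
    have hB' := hB φ hφ
    rw [integral_inner_gradient hφ] at hA' hB' ⊢
    rw [inner_add_right, hA', hB', add_zero]
  zero_mem' := by
    intro φ hφ
    rw [integral_inner_gradient hφ, inner_zero_right]
  smul_mem' := by
    intro a A hA φ hφ
    have hA' := hA φ hφ
    rw [integral_inner_gradient hφ] at hA' ⊢
    rw [inner_smul_right, hA', mul_zero]

theorem isClosed_solenoidal : IsClosed (solenoidal : Set Vec) := by
  have h : (solenoidal : Set Vec) = ⋂ (φ : E3 → ℝ) (hφ : IsTest φ),
      {A : Vec | ⟪hφ.memLp_gradient.toLp (gradient φ), A⟫ = 0} := by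
    ext A
    simp only [Set.mem_iInter, Set.mem_ofPred_eq]
    exact forall₂_congr fun φ hφ => by rw [integral_inner_gradient hφ]
  rw [h]
  exact isClosed_iInter fun φ => isClosed_iInter fun hφ =>
    isClosed_eq (continuous_const.inner continuous_id) continuous_const

instance completeSpace_solenoidal : CompleteSpace solenoidal :=
  isClosed_solenoidal.completeSpace_coe

/-- The real Hilbert space `L²_*` of square integrable divergence-free vector fields. -/
abbrev L2s : Type := solenoidal

/-- The orthogonal projection `M` of `L²` onto `L²_*`. -/
def M : Vec →L[ℝ] L2s := solenoidal.orthogonalProjectionOnto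

open Classical in
/-- The class in `L²` of a square integrable field (and `0` for a field which is not square
integrable). -/
def toVec (f : E3 → E3) : Vec :=
  if h : MemLp f 2 (volume : Measure E3) then h.toLp f else 0

/-! ### Sobolev spaces of vector fields, by weak derivatives -/

/-- `B` is the weak derivative `∂ᵢ A`. -/
def IsWeakDeriv (i : Fin 3) (A B : Vec) : Prop :=
  ∀ φ : E3 → ℝ, IsTest φ →
    ∫ x, (fderiv ℝ φ x (EuclideanSpace.single i 1)) • A x = - ∫ x, φ x • B x

/-- Weak derivatives are unique. -/
theorem IsWeakDeriv.unique {i : Fin 3} {A B C : Vec} (hB : IsWeakDeriv i A B)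
    (hC : IsWeakDeriv i A C) : B = C := by
  have hi : ∀ D : Vec, LocallyIntegrable D (volume : Measure E3) := fun D =>
    (Lp.memLp D).locallyIntegrable (by norm_num)
  have h0 : ∀ᵐ x ∂(volume : Measure E3), (B x - C x) = 0 := by
    refine ae_eq_zero_of_integral_contDiff_smul_eq_zero ((hi B).sub (hi C)) ?_
    intro g hg hg'
    have h1 := hB g ⟨hg, hg'⟩
    have h2 := hC g ⟨hg, hg'⟩
    have h3 : ∫ x, g x • B x = ∫ x, g x • C x := neg_injective (h1.symm.trans h2)
    have hint : ∀ D : Vec, Integrable (fun x => g x • D x) (volume : Measure E3) := fun D =>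
      (hi D).integrable_smul_left_of_hasCompactSupport hg.continuous hg'
    have : ∫ x, g x • ((B : E3 → E3) - (C : E3 → E3)) x = 0 := by
      simp only [Pi.sub_apply, smul_sub]
      rw [integral_sub (hint B) (hint C), h3, sub_self]
    exact this
  apply Lp.ext
  filter_upwards [h0] with x hx
  exact sub_eq_zero.mp hx

open Classical in
/-- The weak derivative `∂ᵢ A` in `L²` (and `0` if there is none). -/
def weakDeriv (i : Fin 3) (A : Vec) : Vec :=
  if h : ∃ B, IsWeakDeriv i A B then h.choose else 0

/-- `A ∈ H¹`. -/
def IsH1 (A : Vec) : Prop := ∀ i : Fin 3, ∃ B, IsWeakDeriv i A B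

/-- `A ∈ H²`. -/
def IsH2 (A : Vec) : Prop := IsH1 A ∧ ∀ i : Fin 3, IsH1 (weakDeriv i A)

/-- `‖∇A‖²` for `A ∈ H¹`. -/
def gradSq (A : Vec) : ℝ := ∑ i : Fin 3, ‖weakDeriv i A‖ ^ 2

/-- The componentwise Laplacian `ΔA` for `A ∈ H²`. -/
def lap (A : Vec) : Vec := ∑ i : Fin 3, weakDeriv i (weakDeriv i A)

/-! ### Square roots of unbounded operators

An unbounded operator on a Hilbert space `H` is given by its graph `T ⊆ H × H`. -/

section Sqrt

variable {H : Type*} [NormedAddCommGroup H] [InnerProductSpace ℝ H] [CompleteSpace H]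

/-- The graph of `T + μ`. -/
def shift (T : Set (H × H)) (μ : ℝ) : Set (H × H) := {z | (z.1, z.2 - μ • z.1) ∈ T}

/-- `S` is a non-negative self-adjoint operator with `S² = T` (equality of graphs, so including
the domain of `S²`). -/
structure IsPosSqrt (T : Set (H × H)) (S : H →ₗ.[ℝ] H) : Prop where
  selfAdjoint : IsSelfAdjoint S
  nonneg : ∀ x : S.domain, 0 ≤ ⟪S x, (x : H)⟫
  sq_eq : ∀ x y : H, (x, y) ∈ T ↔ ∃ z : H, (x, z) ∈ S.graph ∧ (z, y) ∈ S.graph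

open Classical in
/-- The operator `T^{1/2}`: the non-negative self-adjoint operator whose square is `T`. It exists
and is unique if `T` is the graph of a non-negative self-adjoint operator; otherwise the value
is the operator with domain `{0}`. -/
def posSqrt (T : Set (H × H)) : H →ₗ.[ℝ] H :=
  if h : ∃ S, IsPosSqrt T S then h.choose else ⊥

open Classical in
/-- `T^{1/2} x` for `x` in the domain of `T^{1/2}` (and `0` otherwise). -/
def sqrtApply (T : Set (H × H)) (x : H) : H :=
  if h : x ∈ (posSqrt T).domain then posSqrt T ⟨x, h⟩ else 0

end Sqrt

/-! ### The regularized system -/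

/-- `ρ` is a square integrable, spherically symmetric probability density with bounded support. -/
structure IsDensity (ρ : E3 → ℝ) : Prop where
  measurable : Measurable ρ
  nonneg : ∀ x, 0 ≤ ρ x
  integral_eq_one : ∫ x, ρ x = 1
  memLp : MemLp ρ 2 (volume : Measure E3)
  symmetric : ∀ x y : E3, ‖x‖ = ‖y‖ → ρ x = ρ y
  bounded_support : Bornology.IsBounded (Function.support ρ)

/-- The rescaled density `ρ_r(x) = r⁻³ ρ(x / r)`. -/
def scaled (ρ : E3 → ℝ) (r : ℝ) : E3 → ℝ := fun x => (r ^ 3)⁻¹ * ρ (r⁻¹ • x)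

/-- The energy `E(ρ) = (1 / 4π) ∬ ρ(x) ρ(y) / |x - y| dx dy`. -/
def selfEnergy (ρ : E3 → ℝ) : ℝ :=
  1 / (4 * Real.pi) * ∫ x : E3, ∫ y : E3, ρ x * ρ y / ‖x - y‖

/-- The vector `⟨ρ, A⟩ ∈ ℝ³`. -/
def pair (ρ : E3 → ℝ) (A : Vec) : E3 := ∫ x, ρ x • A x

/-- The renormalized mass `m_r = m - (8πe² / 3c²) E(ρ_r)`. -/
def mass (c e m : ℝ) (ρ : E3 → ℝ) (r : ℝ) : ℝ :=
  m - 8 * Real.pi * e ^ 2 / (3 * c ^ 2) * selfEnergy (scaled ρ r)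

/-- The graph of `H_r = -Δ + (4πe² / m_r c²) M·ρ_r ⊗ ρ_r` in `L²_*`, with domain `H²_*`. -/
def Hreg (c e m : ℝ) (ρ : E3 → ℝ) (r : ℝ) : Set (L2s × L2s) :=
  {z | IsH2 z.1 ∧ (z.2 : Vec) = - lap z.1 + (4 * Real.pi * e ^ 2 / (mass c e m ρ r * c ^ 2)) •
    (M (toVec fun x => scaled ρ r x • pair (scaled ρ r) z.1) : Vec)}

/-- The Hamiltonian of the regularized system. -/
def regHamiltonian (c e m : ℝ) (ρ : E3 → ℝ) (V : E3 → ℝ) (r : ℝ) (A E : L2s) (q p : E3) : ℝ :=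
  2 * Real.pi * c ^ 2 * ‖E‖ ^ 2 + 1 / (8 * Real.pi) * gradSq A
    + 1 / (2 * mass c e m ρ r) * ‖p - (e / c) • pair (scaled ρ r) A‖ ^ 2 + V q

/-! ### The limit system -/

/-- `G_z(x) = e^{-√z |x|} / (4π|x|)`, for real `z ≥ 0`. -/
def green (z : ℝ) (x : E3) : ℝ := Real.exp (-(√z * ‖x‖)) / (4 * Real.pi * ‖x‖)

/-- For `z > 0` the field `G_z Q` is square integrable. -/
theorem memLp_green {z : ℝ} (hz : 0 < z) (Q : E3) :
    MemLp (fun x => green z x • Q) 2 (volume : Measure E3) := by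
  have hm : Measurable (green z) := by unfold green; fun_prop
  have hscal : MemLp (green z) 2 (volume : Measure E3) := by
    rw [memLp_two_iff_integrable_sq hm.aestronglyMeasurable]
    have := (integrable_fun_norm_addHaar (volume : Measure E3)
      (f := fun t : ℝ => (Real.exp (-(√z * t)) / (4 * Real.pi * t)) ^ 2)).2 ?_
    · exact this
    · have hs : 0 < 2 * √z := by positivity
      have h1 : IntegrableOn (fun t : ℝ => (1 / (4 * Real.pi)) ^ 2 * Real.exp (-(2 * √z) * t))
          (Set.Ioi 0) := (integrableOn_exp_mul_Ioi (neg_lt_zero.mpr hs) 0).const_mul _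
      refine h1.congr_fun ?_ measurableSet_Ioi
      intro t ht
      have ht' : (t : ℝ) ≠ 0 := ne_of_gt ht
      have he : Real.exp (-(2 * √z) * t) = Real.exp (-(√z * t)) ^ 2 := by
        rw [← Real.exp_nat_mul]; congr 1; push_cast; ring
      simp only [finrank_euclideanSpace, Fintype.card_fin, smul_eq_mul]
      rw [he]
      field_simp
  refine hscal.of_le_mul (c := ‖Q‖) (hm.smul_const Q).aestronglyMeasurable ?_
  filter_upwards with x
  rw [norm_smul, mul_comm]

/-- The field `M Q G_z ∈ L²_*`, for `z > 0`. -/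
def MG (z : ℝ) (Q : E3) : L2s := M (toVec fun x => green z x • Q)

/-- The field `M Q G_0`, which is not square integrable: its Fourier symbol is
`(Q - k (k·Q) / |k|²) / |k|²`, the transverse part of that of `Q G_0`, so that it is
`(8π|x|)⁻¹ (Q + x (x·Q) / |x|²)`. -/
def MG0 (Q x : E3) : E3 :=
  (1 / (8 * Real.pi * ‖x‖)) • (Q + (⟪x, Q⟫ / ‖x‖ ^ 2) • x)

/-- The mean `(1 / 4πr²) ∫_{S_r} f dμ_r` over the sphere of radius `r`. -/
def sphereMean (f : E3 → E3) (r : ℝ) : E3 :=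
  (1 / (4 * Real.pi)) • ∫ w : Metric.sphere (0 : E3) 1, f (r • (w : E3))
    ∂(volume : Measure E3).toSphere

/-- `Γ_m(z) = -mc² / (4πe²) + √z / (6π)`. -/
def Gam (c e m z : ℝ) : ℝ := -(m * c ^ 2) / (4 * Real.pi * e ^ 2) + √z / (6 * Real.pi)

/-- `λ₀ = (3mc² / 2e²)²`. -/
def lam0 (c e m : ℝ) : ℝ := (3 * m * c ^ 2 / (2 * e ^ 2)) ^ 2

/-- The regular part `A_λ = A - (4πe / c) M Q G_λ` of `A` for the charge vector `Q`. -/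
def regPart (c e lam : ℝ) (A : L2s) (Q : E3) : L2s :=
  A - (4 * Real.pi * e / c) • MG lam Q

/-- The boundary condition
`lim_{r ↓ 0} (1 / 4πr²) ∫_{S_r} (A - (4πe / c) M Q G_0) dμ_r = -(mc / e) Q`.
The spherical means of an `L²` class are defined for almost every `r`, so that the limit is an
essential limit. -/
def BoundaryCond (c e m : ℝ) (A : L2s) (Q : E3) : Prop :=
  Tendsto (sphereMean fun x => (A : Vec) x - (4 * Real.pi * e / c) • MG0 Q x)
    (𝓝[>] (0 : ℝ) ⊓ ae (volume : Measure ℝ)) (𝓝 (-(m * c / e) • Q))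

/-- The graph of the point interaction `H_m`: `A ∈ D(H_m)` if and only if there is `Q ∈ ℝ³` with
`A_λ ∈ H²_*` and the boundary condition, and then `(H_m + λ) A = (-Δ + λ) A_λ`. The operator
does not depend on the choice of `λ > 0`. -/
def Hlim (c e m lam : ℝ) : Set (L2s × L2s) :=
  {z | ∃ Q : E3, IsH2 (regPart c e lam z.1 Q) ∧ BoundaryCond c e m z.1 Q ∧
    (z.2 : Vec) + lam • (z.1 : Vec) =
      - lap (regPart c e lam z.1 Q) + lam • (regPart c e lam z.1 Q : Vec)}

/-- The form domain `D(F_m)`: there is `Q ∈ ℝ³` with `A_λ ∈ H¹_*`. It does not depend on the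
choice of `λ > 0`. -/
def formDomain (c e lam : ℝ) : Set L2s := {A | ∃ Q : E3, IsH1 (regPart c e lam A Q)}

open Classical in
/-- The vector `Q_A` of `A ∈ D(F_m)`; it is unique, and does not depend on the choice
of `λ > 0`. -/
def charge (c e lam : ℝ) (A : L2s) : E3 :=
  if h : ∃ Q : E3, IsH1 (regPart c e lam A Q) then h.choose else 0

/-- The quadratic form of `H_m`,
`F_m(A, A) = ‖(-Δ + λ)^{1/2} A_λ‖² + (4πe / c)² Γ_m(λ) |Q_A|² - λ ‖A‖²`, where
`‖(-Δ + λ)^{1/2} u‖² = ‖∇u‖² + λ ‖u‖²`. It does not depend on the choice of `λ > 0`. -/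
def Fm (c e m lam : ℝ) (A : L2s) : ℝ :=
  gradSq (regPart c e lam A (charge c e lam A))
    + lam * ‖regPart c e lam A (charge c e lam A)‖ ^ 2
    + (4 * Real.pi * e / c) ^ 2 * Gam c e m lam * ‖charge c e lam A‖ ^ 2
    - lam * ‖A‖ ^ 2

/-- The limit Hamiltonian. -/
def limHamiltonian (c e m lam : ℝ) (V : E3 → ℝ) (A E : L2s) (q p : E3) : ℝ :=
  2 * Real.pi * c ^ 2 * ‖E‖ ^ 2 + 1 / (8 * Real.pi) * Fm c e m lam A
    + ⟪p, charge c e lam A⟫ + V q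

/-- The convergence `‖(H_r + λ)^{1/2} A_r - (H_m + λ)^{1/2} A‖ → 0` as `r ↓ 0`. -/
def EnergyConv (c e m : ℝ) (ρ : E3 → ℝ) (lam : ℝ) (Ar : ℝ → L2s) (A : L2s) : Prop :=
  Tendsto (fun r => ‖sqrtApply (shift (Hreg c e m ρ r) lam) (Ar r)
    - sqrtApply (shift (Hlim c e m lam) lam) A‖) (𝓝[>] (0 : ℝ)) (𝓝 0)

end PointMaxwell

end

/-! Write λ for `lam`, R for (-Δ + λ)⁻¹ on L²_*, G for G_λ and ν_r = -m_r c² / (4πe²). Both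
operators have inverses of Krein type: (H_m + λ)⁻¹ = R + γ⁻¹ g g* with g Q = M Q G and γ = Γ_m(λ),
and (H_r + λ)⁻¹ = R + γ_r⁻¹ g_r g_r* with g_r Q = M Q (G * ρ_r) and γ_r = ν_r - (2/3) ∫ ρ_r (G *
ρ_r) (`shift_Hlim_eq`, `shift_Hreg_eq`). The factor 2/3 is the trace of the transverse projection of
ℝ³ divided by the dimension. The condition λ > λ₀ gives γ > 0. The divergence of ∫ ρ_r (G * ρ_r) is
cancelled by the self-energy in m_r, so that γ_r → γ (`tendsto_regGam`), and g_r → g in norm, so the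
inverses converge in norm. Since ‖K - L‖² ≤ ‖K² - L²‖ for non-negative K and L
(`IsPos.norm_sub_sq_le`), the inverse square roots K_r converge in norm to K = (H_m + λ)^{-1/2}.

Let x_r = (H_r + λ)^{1/2} A_r, which tends to x = (H_m + λ)^{1/2} A. Then A_r = K_r x_r → K x = A in
L². Moreover ‖x_r‖² = ‖∇A_r‖² + λ‖A_r‖² - ν_r⁻¹ |⟨ρ_r, A_r⟩|² and ‖x‖² = F_m(A, A) + λ‖A‖²; both
follow from an abstract description of the form of an operator whose inverse is i B i*
(`exists_sqrt_preimage`). When the square in the Hamiltonian is expanded, its part quadratic in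
⟨ρ_r, A_r⟩ is the last term of ‖x_r‖², up to the factor 1/8π (`regHamiltonian_eq`). So the field
energy and this part together tend to F_m(A, A)/8π. The part |p|²/2m_r vanishes because m_r → -∞.

There remains the mixed term, which is p · (c/4πe) ν_r⁻¹ ⟨ρ_r, A_r⟩. The map x ↦ ν_r⁻¹ ⟨ρ_r, K_r x⟩
is bounded uniformly in small r (`norm_pair_sqrt_le`), and at x = K_r f it equals γ_r⁻¹ ⟨G * ρ_r,
f⟩, which converges. As K has dense range, the limit (4πe/c) Q_A follows in general
(`tendsto_charge`).

The analysis behind this avoids the Fourier transform. The free resolvent is the continuous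
extension of the inverse of -Δ + μ on test fields; the range is dense because a square integrable
very weak solution of -Δf + μf = 0 vanishes. Rotation invariance and a trace computation give ⟨hQ,
M(kQ')⟩ = (2/3) ∫hk Q·Q' for radial h and k. Spherical means then turn the boundary condition into
A_λ(0) = (4πe/c) Γ_m(λ) Q. -/

open MeasureTheory Filter Topology
open scoped ContDiff RealInnerProductSpace

noncomputable section

namespace PointMaxwell

/-! ### Non-negative bounded operators on a real Hilbert space and their square roots -/

section PositiveRoots

variable {H : Type*} [NormedAddCommGroup H] [InnerProductSpace ℝ H]

/-- A bounded operator that is symmetric and non-negative. -/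
structure IsPos (T : H →L[ℝ] H) : Prop where
  symm : ∀ x y, ⟪T x, y⟫ = ⟪x, T y⟫
  nonneg : ∀ x, 0 ≤ ⟪T x, x⟫

/-- The norm of a symmetric operator is the supremum of its Rayleigh quotients. The quotient at the
zero vector is 0 by convention, which is where 0 ≤ c enters. -/
theorem norm_le_of_abs_inner_le {T : H →L[ℝ] H} (hT : ∀ x y, ⟪T x, y⟫ = ⟪x, T y⟫) {c : ℝ}
    (hc : 0 ≤ c) (h : ∀ x, |⟪T x, x⟫| ≤ c * ‖x‖ ^ 2) : ‖T‖ ≤ c := by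
  have hT' : (T : H →ₗ[ℝ] H).IsSymmetric := hT
  rw [ContinuousLinearMap.norm_eq_iSup_rayleighQuotient T hT']
  refine ciSup_le fun x => ?_
  simp only [ContinuousLinearMap.rayleighQuotient, ContinuousLinearMap.reApplyInnerSelf_apply,
    RCLike.re_to_real, abs_div, abs_pow, abs_norm]
  rcases eq_or_ne x 0 with rfl | hx
  · simpa using hc
  · rw [div_le_iff₀ (by positivity)]
    exact h x

/-- The coefficients of the power series of `(1 - √(1 - t)) / t`. -/
def rootCoeff (n : ℕ) : ℝ := (catalan n : ℝ) / 2 ^ (2 * n + 1)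

theorem rootCoeff_nonneg (n : ℕ) : 0 ≤ rootCoeff n := by unfold rootCoeff; positivity

/-- The Catalan recursion after rescaling. For the generating function f it says t f² = 2f - 1, the
equation solved by (1 - √(1 - t)) / t. -/
theorem sum_antidiagonal_rootCoeff (n : ℕ) :
    ∑ ij ∈ Finset.HasAntidiagonal.antidiagonal n, rootCoeff ij.1 * rootCoeff ij.2 = 2 * rootCoeff (n + 1) := by
  have h : ∀ ij ∈ Finset.HasAntidiagonal.antidiagonal n, rootCoeff ij.1 * rootCoeff ij.2
      = (catalan ij.1 * catalan ij.2 : ℕ) / 2 ^ (2 * n + 2) := by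
    intro ij hij
    rw [Finset.HasAntidiagonal.mem_antidiagonal] at hij
    subst hij
    unfold rootCoeff
    push_cast
    rw [div_mul_div_comm, ← pow_add]
    congr 2
    ring
  rw [Finset.sum_congr rfl h, ← Finset.sum_div, ← Nat.cast_sum, ← catalan_succ']
  unfold rootCoeff
  rw [show 2 * (n + 1) + 1 = (2 * n + 2) + 1 by ring, pow_succ (2 : ℝ) (2 * n + 2)]
  field_simp

/-- The antidiagonals below N are disjoint parts of an N × N square, so the partial sums satisfy
S_{N+1} ≤ 1/2 + S_N²/2, and this recursion does not leave [0, 1]. -/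
theorem sum_rootCoeff_le_one (N : ℕ) : ∑ n ∈ Finset.range N, rootCoeff n ≤ 1 := by
  induction N with
  | zero => simp
  | succ N ih =>
    have h0 : rootCoeff 0 = 1 / 2 := by simp [rootCoeff]
    have h1 : ∑ n ∈ Finset.range N, 2 * rootCoeff (n + 1)
        ≤ (∑ n ∈ Finset.range N, rootCoeff n) * ∑ n ∈ Finset.range N, rootCoeff n := by
      simp_rw [← sum_antidiagonal_rootCoeff]
      rw [Finset.sum_mul_sum, ← Finset.sum_product', ← Finset.sum_biUnion]
      · refine Finset.sum_le_sum_of_subset_of_nonneg (fun ij hij => ?_)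
          fun ij _ _ => mul_nonneg (rootCoeff_nonneg _) (rootCoeff_nonneg _)
        simp only [Finset.mem_biUnion, Finset.mem_range, Finset.HasAntidiagonal.mem_antidiagonal,
          Finset.mem_product] at hij ⊢
        omega
      · intro i _ j _ hij
        rw [Function.onFun, Finset.disjoint_left]
        intro p hp hp'
        rw [Finset.HasAntidiagonal.mem_antidiagonal] at hp hp'
        exact hij (hp.symm.trans hp')
    have h2 : 0 ≤ ∑ n ∈ Finset.range N, rootCoeff n :=
      Finset.sum_nonneg fun n _ => rootCoeff_nonneg n
    rw [Finset.sum_range_succ', h0]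
    rw [← Finset.mul_sum] at h1
    nlinarith

theorem summable_rootCoeff : Summable rootCoeff :=
  summable_of_sum_range_le rootCoeff_nonneg sum_rootCoeff_le_one

theorem tsum_rootCoeff_le_one : ∑' n, rootCoeff n ≤ 1 :=
  Real.tsum_le_of_sum_range_le rootCoeff_nonneg sum_rootCoeff_le_one

theorem one_sub_mul_self_of_mul_self {A : Type*} [Ring A] {Y B : A} (h : Y * Y = Y + Y - B) :
    (1 - Y) * (1 - Y) = 1 - B := by
  rw [sub_mul, one_mul, mul_sub, mul_one, h]
  abel

theorem isPos_one_sub {Y : H →L[ℝ] H} (hY : ∀ x y, ⟪Y x, y⟫ = ⟪x, Y y⟫) (h1 : ‖Y‖ ≤ 1) :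
    IsPos (1 - Y) where
  symm x y := by simp [inner_sub_left, inner_sub_right, hY]
  nonneg x := by
    rw [sub_apply, inner_sub_left, one_apply_eq_self, real_inner_self_eq_norm_sq]
    have h2 := Y.le_of_opNorm_le h1 x
    rw [one_mul] at h2
    have h3 := mul_le_mul_of_nonneg_right h2 (norm_nonneg x)
    rw [← sq] at h3
    linarith [real_inner_le_norm (Y x) x]

/-- Here x is an approximate eigenvector of D = K - L for the value d = ‖D‖. Testing K² - L² on x
gives nearly d⟨x, (K + L)x⟩, and K + L ≥ D because L ≥ 0, so the result is nearly d²‖x‖². -/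
theorem IsPos.le_norm_mul_self_sub {K L : H →L[ℝ] H} (hK : IsPos K) (hL : IsPos L) {x : H}
    (hx : x ≠ 0) {ε : ℝ} (hd : (‖K - L‖ - ε) * ‖x‖ ^ 2 ≤ ⟪(K - L) x, x⟫) :
    ‖K - L‖ * (‖K - L‖ - ε) ≤ ‖K * K - L * L‖ + √(2 * ‖K - L‖ * ε) * (‖K‖ + ‖L‖) := by
  set D := K - L with hD
  set d := ‖D‖ with hd'
  have hd0 : 0 ≤ d := norm_nonneg _
  have hx0 : 0 < ‖x‖ := norm_pos_iff.2 hx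
  have hDs : ∀ x y, ⟪D x, y⟫ = ⟪x, D y⟫ := fun x y => by
    simp [hD, inner_sub_left, inner_sub_right, hK.symm, hL.symm]
  have hy : ‖D x - d • x‖ ^ 2 ≤ (√(2 * d * ε) * ‖x‖) ^ 2 := by
    have h1 : ‖D x‖ ^ 2 ≤ (d * ‖x‖) ^ 2 := pow_le_pow_left₀ (norm_nonneg _) (D.le_opNorm x) 2
    have h2 : ‖D x - d • x‖ ^ 2 ≤ 2 * d * ε * ‖x‖ ^ 2 := by
      rw [norm_sub_sq_real, inner_smul_right, norm_smul, Real.norm_of_nonneg hd0]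
      nlinarith [mul_le_mul_of_nonneg_left hd hd0]
    have h3 : 0 ≤ 2 * d * ε := by
      by_contra h
      have : 2 * d * ε * ‖x‖ ^ 2 < 0 := mul_neg_of_neg_of_pos (not_le.1 h) (by positivity)
      linarith [sq_nonneg ‖D x - d • x‖]
    rwa [mul_pow, Real.sq_sqrt h3]
  have hy' : ‖D x - d • x‖ ≤ √(2 * d * ε) * ‖x‖ := (pow_le_pow_iff_left₀ (norm_nonneg _) (by positivity) two_ne_zero).1 hy
  -- K and L need not commute: the left side is ‖Kx‖² - ‖Lx‖², which is ⟨Dx, (K + L)x⟩ by symmetry.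
  have e1 : ⟪(K * K - L * L) x, x⟫ = d * ⟪x, K x + L x⟫ + ⟪D x - d • x, K x + L x⟫ := by
    rw [inner_sub_left, inner_smul_left, RCLike.conj_to_real, add_sub_cancel]
    simp only [hD, sub_apply, mul_apply_eq_comp, inner_sub_left, hK.symm, hL.symm,
      inner_add_right]
    rw [← hL.symm x (K x), real_inner_comm (K x) (L x), hK.symm]
    ring
  have e2 : ⟪(K * K - L * L) x, x⟫ ≤ ‖K * K - L * L‖ * ‖x‖ ^ 2 := by
    have := (real_inner_le_norm ((K * K - L * L) x) x).trans
      (mul_le_mul_of_nonneg_right ((K * K - L * L).le_opNorm x) hx0.le)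
    linarith
  have e3 : (d - ε) * ‖x‖ ^ 2 ≤ ⟪x, K x + L x⟫ := by
    have h1 := hL.nonneg x
    have h2 : ⟪x, K x + L x⟫ = ⟪D x, x⟫ + 2 * ⟪L x, x⟫ := by
      rw [inner_add_right, hD, sub_apply, inner_sub_left, real_inner_comm (K x),
        real_inner_comm (L x)]
      ring
    linarith
  have e4 : -(√(2 * d * ε) * ‖x‖ * ((‖K‖ + ‖L‖) * ‖x‖)) ≤ ⟪D x - d • x, K x + L x⟫ := by
    have h1 := abs_le.1 (abs_real_inner_le_norm (D x - d • x) (K x + L x)) |>.1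
    have h2 : ‖K x + L x‖ ≤ (‖K‖ + ‖L‖) * ‖x‖ := by
      rw [add_mul]
      exact (norm_add_le _ _).trans (add_le_add (K.le_opNorm x) (L.le_opNorm x))
    have h3 := mul_le_mul hy' h2 (norm_nonneg _) (by positivity)
    linarith
  have e5 := mul_le_mul_of_nonneg_left e3 hd0
  have e6 : d * (d - ε) * ‖x‖ ^ 2
      ≤ (‖K * K - L * L‖ + √(2 * d * ε) * (‖K‖ + ‖L‖)) * ‖x‖ ^ 2 := by
    nlinarith
  exact le_of_mul_le_mul_right e6 (by positivity)

/-- Hölder continuity of the square root, which turns norm convergence of inverses into norm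
convergence of their roots. The sign of ⟨(K - L)x, x⟩ at a nearly maximizing x decides which
operator plays the larger one; then ε ↓ 0. -/
theorem IsPos.norm_sub_sq_le {K L : H →L[ℝ] H} (hK : IsPos K) (hL : IsPos L) :
    ‖K - L‖ ^ 2 ≤ ‖K * K - L * L‖ := by
  rcases eq_or_lt_of_le (norm_nonneg (K - L)) with h0 | h0
  · rw [← h0]; simp
  set d := ‖K - L‖ with hd
  have key : ∀ ε ∈ Set.Ioo 0 d, d * (d - ε) ≤ ‖K * K - L * L‖ + √(2 * d * ε) * (‖K‖ + ‖L‖) := by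
    intro ε hε
    obtain ⟨x, hx⟩ : ∃ x, (d - ε) * ‖x‖ ^ 2 < |⟪(K - L) x, x⟫| := by
      by_contra! h
      have := norm_le_of_abs_inner_le (T := K - L) (fun x y => by
        simp [inner_sub_left, inner_sub_right, hK.symm, hL.symm]) (sub_nonneg.2 hε.2.le) h
      rw [← hd] at this
      linarith [hε.1]
    have hx0 : x ≠ 0 := by rintro rfl; simp at hx
    rcases lt_abs.1 hx with h | h
    · exact hK.le_norm_mul_self_sub hL hx0 h.le
    · have := hL.le_norm_mul_self_sub hK hx0 (ε := ε) (by
        rw [norm_sub_rev, ← hd]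
        refine h.le.trans_eq ?_
        rw [← inner_neg_left, ← neg_apply, neg_sub])
      rwa [norm_sub_rev L K, norm_sub_rev (L * L), add_comm ‖L‖, ← hd] at this
  have hl : Tendsto (fun ε : ℝ => d * (d - ε)) (𝓝[>] 0) (𝓝 (d * (d - 0))) :=
    (Continuous.tendsto (by fun_prop) 0).mono_left nhdsWithin_le_nhds
  have hr : Tendsto (fun ε : ℝ => ‖K * K - L * L‖ + √(2 * d * ε) * (‖K‖ + ‖L‖)) (𝓝[>] 0)
      (𝓝 (‖K * K - L * L‖ + √(2 * d * 0) * (‖K‖ + ‖L‖))) :=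
    (Continuous.tendsto (by fun_prop) 0).mono_left nhdsWithin_le_nhds
  have := le_of_tendsto_of_tendsto hl hr
    (by filter_upwards [Ioo_mem_nhdsGT h0] with ε hε using key ε hε)
  simp only [sub_zero, mul_zero, Real.sqrt_zero, zero_mul, add_zero] at this
  rwa [sq]

/-! ### The power series of the square root -/

section RootSeries

variable {A : Type*} [NormedRing A] [NormedAlgebra ℝ A] {B : A}

/-- The power series of `(1 - √(1 - B)) / B`. -/
def rootSeries (B : A) : A := ∑' n, rootCoeff n • B ^ n

/-- The bound `‖1‖ ≤ 1`, in place of equality, admits operators on the zero space. -/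
theorem norm_rootSeries_term_le (h1 : ‖B‖ ≤ 1) (h : ‖(1 : A)‖ ≤ 1) (n : ℕ) :
    ‖rootCoeff n • B ^ n‖ ≤ rootCoeff n := by
  rw [norm_smul, Real.norm_of_nonneg (rootCoeff_nonneg n)]
  refine mul_le_of_le_one_right (rootCoeff_nonneg n) ?_
  rcases n with _ | n
  · simpa using h
  · exact (norm_pow_le' B n.succ_pos).trans (pow_le_one₀ (norm_nonneg _) h1)

theorem summable_norm_rootSeries (h1 : ‖B‖ ≤ 1) (h : ‖(1 : A)‖ ≤ 1) :
    Summable fun n => ‖rootCoeff n • B ^ n‖ :=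
  Summable.of_nonneg_of_le (fun _ => norm_nonneg _) (norm_rootSeries_term_le h1 h)
    summable_rootCoeff

theorem isSelfAdjoint_rootSeries [StarRing A] [ContinuousStar A] [StarModule ℝ A]
    (hB : IsSelfAdjoint B) : IsSelfAdjoint (rootSeries B) := by
  rw [isSelfAdjoint_iff, rootSeries, tsum_star]
  refine tsum_congr fun n => ?_
  rw [star_smul, star_pow, hB.star_eq, star_trivial]

theorem norm_rootSeries_le (h1 : ‖B‖ ≤ 1) (h : ‖(1 : A)‖ ≤ 1) : ‖rootSeries B‖ ≤ 1 :=
  have hs := summable_norm_rootSeries h1 h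
  (norm_tsum_le_tsum_norm hs).trans
    ((hs.tsum_le_tsum (norm_rootSeries_term_le h1 h) summable_rootCoeff).trans
      tsum_rootCoeff_le_one)

variable [CompleteSpace A]

theorem mul_rootSeries_comm (h1 : ‖B‖ ≤ 1) (h : ‖(1 : A)‖ ≤ 1) :
    B * rootSeries B = rootSeries B * B := by
  have hs := (summable_norm_rootSeries h1 h).of_norm
  rw [rootSeries, ← hs.tsum_mul_left, ← hs.tsum_mul_right]
  refine tsum_congr fun n => ?_
  rw [mul_smul_comm, smul_mul_assoc, ← pow_succ, ← pow_succ']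

/-- The identity t f² = 2f - 1 for the generating function, at t = B, by the Cauchy product of
absolutely convergent series. -/
theorem mul_rootSeries_mul_self (h1 : ‖B‖ ≤ 1) (h : ‖(1 : A)‖ ≤ 1) :
    B * (rootSeries B * rootSeries B) = (2 : ℝ) • rootSeries B - 1 := by
  have hsn := summable_norm_rootSeries h1 h
  have hs : Summable fun n => rootCoeff n • B ^ n := hsn.of_norm
  have hterm : ∀ n, ∑ ij ∈ Finset.HasAntidiagonal.antidiagonal n,
      (rootCoeff ij.1 • B ^ ij.1) * (rootCoeff ij.2 • B ^ ij.2)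
        = (2 * rootCoeff (n + 1)) • B ^ n := by
    intro n
    rw [← sum_antidiagonal_rootCoeff, Finset.sum_smul]
    refine Finset.sum_congr rfl fun ij hij => ?_
    rw [Finset.HasAntidiagonal.mem_antidiagonal] at hij
    rw [smul_mul_smul_comm, ← pow_add, hij]
  have hZZ : rootSeries B * rootSeries B = ∑' n, (2 * rootCoeff (n + 1)) • B ^ n := by
    rw [rootSeries, tsum_mul_tsum_eq_tsum_sum_antidiagonal_of_summable_norm hsn hsn]
    exact tsum_congr hterm
  have hsn2 : Summable fun n => (2 * rootCoeff (n + 1)) • B ^ n :=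
    (summable_norm_sum_mul_antidiagonal_of_summable_norm hsn hsn).of_norm.congr hterm
  have h0 : rootCoeff 0 = 1 / 2 := by simp [rootCoeff]
  have hs' : Summable fun n => rootCoeff (n + 1) • B ^ (n + 1) := (summable_nat_add_iff 1).2 hs
  rw [hZZ, ← hsn2.tsum_mul_left, rootSeries, hs.tsum_eq_zero_add, h0, pow_zero, smul_add,
    smul_smul, ← hs'.tsum_const_smul, show (2 : ℝ) * (1 / 2) = 1 by norm_num, one_smul,
    add_sub_cancel_left]
  refine tsum_congr fun n => ?_
  rw [mul_smul_comm, smul_smul, ← pow_succ']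

end RootSeries

variable [CompleteSpace H]

/-- With Z the series at B, the root is 1 - BZ: since B and Z commute and BZ² = 2Z - 1, one has
(BZ)² = 2BZ - B. It is non-negative because ‖BZ‖ ≤ 1. -/
theorem exists_sqrt_one_sub {B : H →L[ℝ] H} (hB : ∀ x y, ⟪B x, y⟫ = ⟪x, B y⟫) (h1 : ‖B‖ ≤ 1) :
    ∃ K : H →L[ℝ] H, IsPos K ∧ K * K = 1 - B := by
  have h : ‖(1 : H →L[ℝ] H)‖ ≤ 1 := ContinuousLinearMap.norm_id_le
  have hBs : IsSelfAdjoint B := ContinuousLinearMap.isSelfAdjoint_iff_isSymmetric.2 hB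
  have hZs := isSelfAdjoint_rootSeries (A := H →L[ℝ] H) hBs
  have hZ1 := norm_rootSeries_le h1 h
  have hcomm := mul_rootSeries_comm h1 h
  have hBZZ := mul_rootSeries_mul_self h1 h
  generalize rootSeries B = Z at *
  have hBZs : IsSelfAdjoint (B * Z) := by
    rw [isSelfAdjoint_iff, star_mul, hBs.star_eq, hZs.star_eq, hcomm]
  have hBZ1 : ‖B * Z‖ ≤ 1 := (norm_mul_le _ _).trans (mul_le_one₀ h1 (norm_nonneg _) hZ1)
  refine ⟨1 - B * Z, isPos_one_sub (ContinuousLinearMap.isSelfAdjoint_iff_isSymmetric.1 hBZs) hBZ1,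
    one_sub_mul_self_of_mul_self ?_⟩
  rw [mul_assoc, ← mul_assoc Z B Z, ← hcomm, mul_assoc B Z Z, hBZZ, mul_sub, mul_smul_comm,
    mul_one, two_smul]

/-- A non-negative bounded operator on a real Hilbert space has a non-negative square root. -/
theorem IsPos.exists_sqrt {R : H →L[ℝ] H} (hR : IsPos R) :
    ∃ K : H →L[ℝ] H, IsPos K ∧ K * K = R := by
  -- The summand 1 keeps c positive even for R = 0; from 0 ≤ R ≤ c it follows that 1 - c⁻¹R is a
  -- contraction.
  set c := ‖R‖ + 1 with hc
  have hc0 : 0 < c := by positivity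
  have hsymm : ∀ x y, ⟪(1 - c⁻¹ • R) x, y⟫ = ⟪x, (1 - c⁻¹ • R) y⟫ := by
    intro x y
    simp [inner_sub_left, inner_sub_right, inner_smul_left, inner_smul_right, hR.symm]
  obtain ⟨K, hK, hKK⟩ := exists_sqrt_one_sub hsymm (norm_le_of_abs_inner_le hsymm zero_le_one (by
    intro x
    have h1 := hR.nonneg x
    have h2 := real_inner_le_norm (R x) x
    have h3 := R.le_opNorm x
    have h4 : ⟪R x, x⟫ ≤ c * ‖x‖ ^ 2 := by nlinarith [norm_nonneg x]
    have h5 : c⁻¹ * ⟪R x, x⟫ ≤ ‖x‖ ^ 2 := by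
      rw [inv_mul_le_iff₀ hc0]; exact h4
    have h6 : 0 ≤ c⁻¹ * ⟪R x, x⟫ := by positivity
    simp only [sub_apply, one_apply_eq_self,
      smul_apply, inner_sub_left, inner_smul_left,
      real_inner_self_eq_norm_sq, RCLike.conj_to_real]
    rw [abs_le]; constructor <;> linarith))
  refine ⟨√c • K, ⟨fun x y => ?_, fun x => ?_⟩, ?_⟩
  · simp [inner_smul_left, inner_smul_right, hK.symm]
  · have := hK.nonneg x
    simp only [smul_apply, inner_smul_left, RCLike.conj_to_real]
    positivity
  · rw [smul_mul_smul_comm, hKK, Real.mul_self_sqrt hc0.le, sub_sub_cancel, smul_smul,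
      mul_inv_cancel₀ hc0.ne', one_smul]

/-! ### Inverse graphs and their square roots -/

/-- The graph of the inverse of a bounded operator. -/
def invGraph (R : H →L[ℝ] H) : Set (H × H) := {z | z.1 = R z.2}

/-- The root is K⁻¹. Injectivity of K makes its graph single valued and, as K is symmetric, its
domain dense; the adjoint of the graph is computed by testing on pairs (Kx, x). -/
theorem exists_isPosSqrt_invGraph {R K : H →L[ℝ] H} (hK : IsPos K) (hKK : K * K = R)
    (hR : ∀ x, R x = 0 → x = 0) : ∃ S, IsPosSqrt (invGraph R) S := by
  have hKinj : ∀ x, K x = 0 → x = 0 := fun x hx => hR x (by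
    rw [← hKK, mul_apply_eq_comp, hx, map_zero])
  set g : Submodule ℝ (H × H) := LinearMap.range ((K : H →ₗ[ℝ] H).prod LinearMap.id) with hg
  have hmem : ∀ z : H × H, z ∈ g ↔ z.1 = K z.2 := by
    intro z
    rw [hg, LinearMap.mem_range]
    constructor
    · rintro ⟨y, rfl⟩; rfl
    · intro h; exact ⟨z.2, Prod.ext h.symm rfl⟩
  have hg0 : ∀ z ∈ g, z.1 = 0 → z.2 = 0 := fun z hz h => hKinj _ (by rw [← (hmem z).1 hz, h])
  set S := g.toLinearPMap with hS
  have hSg : S.graph = g := g.toLinearPMap_graph_eq hg0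
  have hdom : ∀ x, K x ∈ S.domain := fun x => ⟨(K x, x), (hmem _).2 rfl, rfl⟩
  have hdense : Dense (S.domain : Set H) := by
    rw [Submodule.dense_iff_topologicalClosure_eq_top, Submodule.topologicalClosure_eq_top_iff,
      Submodule.eq_bot_iff]
    intro x hx
    refine hKinj x ?_
    have := Submodule.inner_right_of_mem_orthogonal (hdom (K x)) hx
    rw [hK.symm] at this
    exact inner_self_eq_zero.1 this
  refine ⟨S, ?_, ?_, ?_⟩
  · rw [LinearPMap.isSelfAdjoint_def]
    apply LinearPMap.eq_of_eq_graph
    rw [LinearPMap.adjoint_graph_eq_graph_adjoint hdense, hSg]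
    ext ⟨a, b⟩
    rw [Submodule.mem_adjoint_iff, hmem]
    constructor
    · intro h
      refine ext_inner_left ℝ fun x => ?_
      have := h (K x) x ((hmem _).2 rfl)
      rw [hK.symm] at this
      exact sub_eq_zero.1 this
    · rintro h p q hpq
      have hp : p = K q := (hmem _).1 hpq
      change a = K b at h
      subst hp h
      rw [hK.symm, sub_self]
  · intro x
    have : ((x : H), S x) ∈ g := by rw [← hSg]; exact S.mem_graph x
    have h : (x : H) = K (S x) := (hmem _).1 this
    rw [real_inner_comm]
    nth_rewrite 1 [h]
    exact hK.nonneg _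
  · intro x y
    rw [hSg]
    simp only [hmem, invGraph, Set.mem_ofPred_eq]
    constructor
    · intro h; exact ⟨K y, by rw [h, ← hKK, mul_apply_eq_comp], rfl⟩
    · rintro ⟨z, h1, h2⟩; rw [h1, h2, ← hKK, mul_apply_eq_comp]

/-- A square root of the inverse of a bounded operator is the inverse of a bounded operator. -/
theorem IsPosSqrt.exists_inverse {R : H →L[ℝ] H} (hR : ∀ x, R x = 0 → x = 0)
    {S : H →ₗ.[ℝ] H} (hS : IsPosSqrt (invGraph R) S) :
    ∃ K : H →L[ℝ] H, IsPos K ∧ K * K = R ∧ ∀ x, (K x, x) ∈ S.graph := by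
  have hsymm : ∀ x y : S.domain, ⟪S x, (y : H)⟫ = ⟪(x : H), S y⟫ := by
    have := LinearPMap.adjoint_isFormalAdjoint hS.selfAdjoint.dense_domain
    rw [LinearPMap.isSelfAdjoint_def.1 hS.selfAdjoint] at this
    exact this
  have hR' : ∀ x y, R x = R y → x = y := fun x y h =>
    sub_eq_zero.1 (hR _ (by rw [map_sub, h, sub_self]))
  -- S is onto because R x lies in the domain of S² and is mapped to x.
  have hex : ∀ x, ∃ y : S.domain, S y = x := by
    intro x
    obtain ⟨z, -, hz⟩ := (hS.sq_eq (R x) x).1 rfl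
    obtain ⟨y, -, hy⟩ := (LinearPMap.mem_graph_iff _).1 hz
    exact ⟨y, hy⟩
  have hinj : ∀ y : S.domain, S y = 0 → (y : H) = 0 := by
    intro y hy
    have : ((y : H), (0 : H)) ∈ invGraph R := (hS.sq_eq _ _).2
      ⟨0, by rw [← hy]; exact S.mem_graph y, S.graph.zero_mem⟩
    rw [show (y : H) = R 0 from this, map_zero]
  have hinj' : ∀ y z : S.domain, S y = S z → y = z := fun y z h => by
    have := hinj (y - z) (by rw [LinearPMap.map_sub, h, sub_self])
    rw [Submodule.coe_sub, sub_eq_zero] at this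
    exact Subtype.ext this
  choose f hf using hex
  let K₀ : H →ₗ[ℝ] H :=
    { toFun := fun x => (f x : H)
      map_add' := fun x y => by
        rw [← Submodule.coe_add]
        exact congrArg _ (hinj' _ _ (by rw [LinearPMap.map_add, hf, hf, hf]))
      map_smul' := fun a x => by
        rw [RingHom.id_apply, ← Submodule.coe_smul]
        exact congrArg _ (hinj' _ _ (by rw [LinearPMap.map_smul, hf, hf])) }
  have hK₀ : K₀.IsSymmetric := fun x y => by
    have := hsymm (f x) (f y)
    rw [hf, hf] at this
    exact this.symm
  -- Boundedness is the Hellinger–Toeplitz theorem: a symmetric operator defined everywhere is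
  -- continuous.
  let K : H →L[ℝ] H := ⟨K₀, hK₀.continuous⟩
  have hKS : ∀ x, (K x, x) ∈ S.graph := fun x => by
    have := S.mem_graph (f x)
    rw [hf] at this
    exact this
  refine ⟨K, ⟨hK₀, fun x => ?_⟩, ?_, hKS⟩
  · have := hS.nonneg (f x)
    rw [hf, real_inner_comm] at this
    exact this
  · ext x
    exact (hS.sq_eq (K (K x)) x).2 ⟨K x, hKS _, hKS _⟩

/-- `posSqrt` is a choice among possible roots. Uniqueness of the root is not needed, since every
root is the inverse of some non-negative K with K² = R. -/
theorem exists_sqrtApply_eq {R : H →L[ℝ] H} (hRp : IsPos R) (hR : ∀ x, R x = 0 → x = 0) :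
    ∃ K : H →L[ℝ] H, IsPos K ∧ K * K = R ∧ ∀ x, sqrtApply (invGraph R) (K x) = x := by
  obtain ⟨K', hK', hKK'⟩ := hRp.exists_sqrt
  have hex := exists_isPosSqrt_invGraph hK' hKK' hR
  have hS : IsPosSqrt (invGraph R) (posSqrt (invGraph R)) := by
    unfold posSqrt
    rw [dif_pos hex]
    exact hex.choose_spec
  obtain ⟨K, hK, hKK, hKS⟩ := hS.exists_inverse hR
  refine ⟨K, hK, hKK, fun x => ?_⟩
  obtain ⟨y, hy1, hy2⟩ := (LinearPMap.mem_graph_iff _).1 (hKS x)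
  simp only at hy1 hy2
  unfold sqrtApply
  rw [← hy1, dif_pos y.2]
  exact hy2

/-- The form of the inverse of `i B i†`, where `B` has the bounded inverse `C`. -/
theorem exists_sqrt_preimage {𝓗 : Type*} [NormedAddCommGroup 𝓗] [InnerProductSpace ℝ 𝓗]
    [CompleteSpace 𝓗] (i : 𝓗 →L[ℝ] H) (hi : ∀ x, i x = 0 → x = 0) {B C : 𝓗 →L[ℝ] 𝓗}
    (hBC : ∀ x, B (C x) = x) {K : H →L[ℝ] H} (hK : IsPos K)
    (hKK : ∀ f, K (K f) = i (B (i.adjoint f))) (x : 𝓗) :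
    ∃ z : H, K z = i x ∧ ‖z‖ ^ 2 = ⟪C x, x⟫ := by
  -- Injectivity of i is density of the range of i*.
  have hdense : DenseRange i.adjoint := by
    have h : (LinearMap.range (i.adjoint : H →ₗ[ℝ] 𝓗)).topologicalClosure = ⊤ := by
      rw [Submodule.topologicalClosure_eq_top_iff, Submodule.eq_bot_iff]
      intro y hy
      refine hi y (inner_self_eq_zero.1 (?_ : ⟪i y, i y⟫ = 0))
      rw [← ContinuousLinearMap.adjoint_inner_left i y (i y)]
      exact (Submodule.mem_orthogonal _ _).1 hy _ (LinearMap.mem_range_self _ (i y))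
    exact Submodule.dense_iff_topologicalClosure_eq_top.2 h
  have hnorm : ∀ f, ‖K f‖ ^ 2 = ⟪B (i.adjoint f), i.adjoint f⟫ := fun f => by
    rw [← real_inner_self_eq_norm_sq, ← hK.symm, hKK, ContinuousLinearMap.adjoint_inner_right]
  have hbd : ∀ f, ‖K f‖ ≤ √‖B‖ * ‖i.adjoint f‖ := fun f => by
    refine (pow_le_pow_iff_left₀ (norm_nonneg _) (by positivity) two_ne_zero).1 ?_
    rw [hnorm, mul_pow, Real.sq_sqrt (norm_nonneg _)]
    have h1 := real_inner_le_norm (B (i.adjoint f)) (i.adjoint f)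
    have h2 := mul_le_mul_of_nonneg_right (B.le_opNorm (i.adjoint f)) (norm_nonneg (i.adjoint f))
    nlinarith
  -- Approximate C x by i* f_n. By ‖K f‖² = ⟨B i*f, i*f⟩ the vectors K f_n form a Cauchy sequence;
  -- their limit z has K z = i B C x = i x and ‖z‖² = ⟨B C x, C x⟩.
  obtain ⟨w, hw, hlim⟩ := mem_closure_iff_seq_limit.1 (hdense (C x))
  choose f hf using hw
  obtain rfl : (fun n => i.adjoint (f n)) = w := funext hf
  have hcau : CauchySeq fun n => K (f n) := by
    rw [cauchySeq_iff_tendsto_dist_atTop_0]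
    have h0 := (cauchySeq_iff_tendsto_dist_atTop_0.1 hlim.cauchySeq).const_mul (√‖B‖)
    rw [mul_zero] at h0
    refine squeeze_zero (fun _ => dist_nonneg) (fun n => ?_) h0
    rw [dist_eq_norm, dist_eq_norm, ← map_sub, ← map_sub]
    exact hbd _
  obtain ⟨z, hz⟩ := cauchySeq_tendsto_of_complete hcau
  refine ⟨z, ?_, ?_⟩
  · have h1 := (K.continuous.tendsto z).comp hz
    have h2 := ((i.comp B).continuous.tendsto (C x)).comp hlim
    refine (tendsto_nhds_unique h1 (h2.congr fun n => ?_)).trans (congrArg i (hBC x))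
    exact (hKK (f n)).symm
  · have h1 := (hz.norm.pow 2).congr fun n => hnorm (f n)
    have h2 := Filter.Tendsto.inner (𝕜 := ℝ) ((B.continuous.tendsto (C x)).comp hlim) hlim
    rw [tendsto_nhds_unique h1 h2, hBC, real_inner_comm]

end PositiveRoots

/-! ### Classes of square integrable fields -/

theorem toVec_of_memLp {F : E3 → E3} (hF : MemLp F 2 (volume : Measure E3)) :
    toVec F = hF.toLp F := by
  unfold toVec
  rw [dif_pos hF]

theorem coeFn_toVec {F : E3 → E3} (hF : MemLp F 2 (volume : Measure E3)) :
    toVec F =ᵐ[volume] F := by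
  rw [toVec_of_memLp hF]
  exact hF.coeFn_toLp

theorem toVec_coeFn (A : Vec) : toVec A = A := by
  rw [toVec_of_memLp (Lp.memLp A), Lp.toLp_coeFn]

theorem toVec_congr {F G : E3 → E3} (h : F =ᵐ[volume] G) : toVec F = toVec G := by
  by_cases hF : MemLp F 2 (volume : Measure E3)
  · have hG := hF.ae_eq h
    rw [toVec_of_memLp hF, toVec_of_memLp hG]
    exact MemLp.toLp_congr hF hG h
  · have hG : ¬ MemLp G 2 (volume : Measure E3) := fun hG => hF (hG.ae_eq h.symm)
    unfold toVec
    rw [dif_neg hF, dif_neg hG]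

theorem toVec_add {F G : E3 → E3} (hF : MemLp F 2 (volume : Measure E3))
    (hG : MemLp G 2 (volume : Measure E3)) : toVec (fun x => F x + G x) = toVec F + toVec G := by
  rw [toVec_of_memLp hF, toVec_of_memLp hG, ← MemLp.toLp_add, ← toVec_of_memLp]
  rfl

theorem toVec_smul (a : ℝ) {F : E3 → E3} (hF : MemLp F 2 (volume : Measure E3)) :
    toVec (fun x => a • F x) = a • toVec F := by
  rw [toVec_of_memLp hF, ← MemLp.toLp_const_smul, ← toVec_of_memLp]
  rfl

theorem inner_toVec {F : E3 → E3} (hF : MemLp F 2 (volume : Measure E3)) (A : Vec) :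
    ⟪toVec F, A⟫ = ∫ x, ⟪F x, A x⟫ := by
  rw [L2.inner_def]
  refine integral_congr_ae ?_
  filter_upwards [coeFn_toVec hF] with x hx
  rw [hx]

theorem inner_toVec_toVec {F G : E3 → E3} (hF : MemLp F 2 (volume : Measure E3))
    (hG : MemLp G 2 (volume : Measure E3)) : ⟪toVec F, toVec G⟫ = ∫ x, ⟪F x, G x⟫ := by
  rw [inner_toVec hF]
  refine integral_congr_ae ?_
  filter_upwards [coeFn_toVec hG] with x hx
  rw [hx]

theorem MemLp.smul_vec {f : E3 → ℝ} (hf : MemLp f 2 (volume : Measure E3)) (Q : E3) :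
    MemLp (fun x => f x • Q) 2 (volume : Measure E3) := by
  refine hf.of_le_mul (c := ‖Q‖) (hf.1.smul_const Q) ?_
  filter_upwards with x
  rw [norm_smul, mul_comm]

theorem integrable_smul_vec {f : E3 → ℝ} (hf : MemLp f 2 (volume : Measure E3)) (A : Vec) :
    Integrable (fun x => f x • A x) :=
  memLp_one_iff_integrable.1 ((Lp.memLp A).smul hf)

theorem inner_toVec_smul {f : E3 → ℝ} (hf : MemLp f 2 (volume : Measure E3)) (Q : E3) (A : Vec) :
    ⟪toVec fun x => f x • Q, A⟫ = ⟪Q, ∫ x, f x • A x⟫ := by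
  rw [inner_toVec (MemLp.smul_vec hf Q), ← integral_inner (integrable_smul_vec hf A)]
  simp only [real_inner_smul_left, real_inner_smul_right]

/-! ### Test functions -/

theorem IsTest.memLp {φ : E3 → ℝ} (hφ : IsTest φ) : MemLp φ 2 (volume : Measure E3) :=
  hφ.1.continuous.memLp_of_hasCompactSupport hφ.2

theorem IsTest.fderiv_apply {φ : E3 → ℝ} (hφ : IsTest φ) (v : E3) :
    IsTest fun x => fderiv ℝ φ x v :=
  ⟨(hφ.1.fderiv_right (m := ∞) (by simp)).clm_apply contDiff_const, hφ.2.fderiv_apply ℝ v⟩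

/-- As a family of identities between L² inner products, the definition is visibly linear and stable
under L² limits. -/
theorem isWeakDeriv_iff {i : Fin 3} {A B : Vec} :
    IsWeakDeriv i A B ↔ ∀ φ : E3 → ℝ, IsTest φ → ∀ Q : E3,
      ⟪toVec fun x => (fderiv ℝ φ x (EuclideanSpace.single i 1)) • Q, A⟫
        = - ⟪toVec fun x => φ x • Q, B⟫ := by
  refine forall₂_congr fun φ hφ => ?_
  have h : ∀ Q : E3, (⟪toVec fun x => (fderiv ℝ φ x (EuclideanSpace.single i 1)) • Q, A⟫
        = - ⟪toVec fun x => φ x • Q, B⟫) ↔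
      ⟪Q, ∫ x, (fderiv ℝ φ x (EuclideanSpace.single i 1)) • A x⟫ = ⟪Q, - ∫ x, φ x • B x⟫ := by
    intro Q
    rw [inner_toVec_smul (hφ.fderiv_apply _).memLp, inner_toVec_smul hφ.memLp, inner_neg_right]
  simp_rw [h]
  exact ⟨fun h Q => by rw [h], fun h => ext_inner_left ℝ h⟩

theorem IsWeakDeriv.add {i : Fin 3} {A B A' B' : Vec} (h : IsWeakDeriv i A B)
    (h' : IsWeakDeriv i A' B') : IsWeakDeriv i (A + A') (B + B') := by
  rw [isWeakDeriv_iff] at *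
  intro φ hφ Q
  rw [inner_add_right, inner_add_right, h φ hφ, h' φ hφ, neg_add]

theorem IsWeakDeriv.smul {i : Fin 3} {A B : Vec} (h : IsWeakDeriv i A B) (a : ℝ) :
    IsWeakDeriv i (a • A) (a • B) := by
  rw [isWeakDeriv_iff] at *
  intro φ hφ Q
  rw [inner_smul_right, inner_smul_right, h φ hφ, mul_neg]

theorem isWeakDeriv_zero (i : Fin 3) : IsWeakDeriv i 0 0 := by
  rw [isWeakDeriv_iff]
  intro φ hφ Q
  simp

theorem isClosed_isWeakDeriv {X : Type*} [TopologicalSpace X] (i : Fin 3) {A B : X → Vec}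
    (hA : Continuous A) (hB : Continuous B) : IsClosed {x | IsWeakDeriv i (A x) (B x)} := by
  simp only [isWeakDeriv_iff, Set.ofPred_forall]
  exact isClosed_iInter fun φ => isClosed_iInter fun _ => isClosed_iInter fun Q =>
    isClosed_eq (by fun_prop) (by fun_prop)

theorem IsWeakDeriv.weakDeriv_eq {i : Fin 3} {A B : Vec} (h : IsWeakDeriv i A B) :
    weakDeriv i A = B := by
  have hex : ∃ B, IsWeakDeriv i A B := ⟨B, h⟩
  unfold weakDeriv
  rw [dif_pos hex]
  exact hex.choose_spec.unique h

theorem IsH1.isWeakDeriv {A : Vec} (h : IsH1 A) (i : Fin 3) : IsWeakDeriv i A (weakDeriv i A) := by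
  obtain ⟨B, hB⟩ := h i
  rwa [hB.weakDeriv_eq]

theorem IsH1.add {A B : Vec} (hA : IsH1 A) (hB : IsH1 B) : IsH1 (A + B) := fun i =>
  ⟨_, (hA.isWeakDeriv i).add (hB.isWeakDeriv i)⟩

theorem IsH1.smul {A : Vec} (hA : IsH1 A) (a : ℝ) : IsH1 (a • A) := fun i =>
  ⟨_, (hA.isWeakDeriv i).smul a⟩

theorem IsH1.sub {A B : Vec} (hA : IsH1 A) (hB : IsH1 B) : IsH1 (A - B) := by
  rw [sub_eq_add_neg, ← neg_one_smul ℝ B]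
  exact hA.add (hB.smul _)

theorem weakDeriv_smul {A : Vec} (hA : IsH1 A) (a : ℝ) (i : Fin 3) :
    weakDeriv i (a • A) = a • weakDeriv i A :=
  ((hA.isWeakDeriv i).smul a).weakDeriv_eq

theorem lap_smul {A : Vec} (hA : IsH2 A) (a : ℝ) : lap (a • A) = a • lap A := by
  unfold lap
  rw [Finset.smul_sum]
  refine Finset.sum_congr rfl fun i _ => ?_
  rw [weakDeriv_smul hA.1, weakDeriv_smul (hA.2 i)]

/-! ### Test fields -/

/-- Smooth vector fields with compact support. -/
def testField : Submodule ℝ (E3 → E3) where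
  carrier := {Φ | ContDiff ℝ ∞ Φ ∧ HasCompactSupport Φ}
  add_mem' h h' := ⟨h.1.add h'.1, h.2.add h'.2⟩
  zero_mem' := ⟨contDiff_const, HasCompactSupport.zero⟩
  smul_mem' a _ h := ⟨contDiff_const.smul h.1, h.2.smul_left (f := fun _ => a)⟩

namespace testField

theorem memLp (Φ : testField) : MemLp (Φ : E3 → E3) 2 (volume : Measure E3) :=
  Φ.2.1.continuous.memLp_of_hasCompactSupport Φ.2.2

theorem differentiable (Φ : testField) : Differentiable ℝ (Φ : E3 → E3) :=
  Φ.2.1.differentiable (by simp)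

/-- The class of a test field. -/
def toL2 : testField →ₗ[ℝ] Vec where
  toFun Φ := toVec Φ
  map_add' Φ Ψ := toVec_add (memLp Φ) (memLp Ψ)
  map_smul' a Φ := toVec_smul a (memLp Φ)

/-- The partial derivatives of a test field. -/
def partialD (i : Fin 3) : testField →ₗ[ℝ] testField where
  toFun Φ := ⟨fun x => fderiv ℝ Φ x (EuclideanSpace.single i 1),
    (Φ.2.1.fderiv_right (m := ∞) (by simp)).clm_apply contDiff_const,
    (Φ.2.2.fderiv (𝕜 := ℝ)).comp_left (g := fun L : E3 →L[ℝ] E3 => L (EuclideanSpace.single i 1))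
      rfl⟩
  map_add' Φ Ψ := by
    ext1
    funext x
    change fderiv ℝ ((Φ : E3 → E3) + (Ψ : E3 → E3)) x _
      = fderiv ℝ (Φ : E3 → E3) x _ + fderiv ℝ (Ψ : E3 → E3) x _
    rw [fderiv_add (differentiable Φ x) (differentiable Ψ x)]
    rfl
  map_smul' a Φ := by
    ext1
    funext x
    change fderiv ℝ (a • (Φ : E3 → E3)) x _ = a • fderiv ℝ (Φ : E3 → E3) x _
    rw [fderiv_const_smul (differentiable Φ x)]
    rfl

theorem partialD_comm (i j : Fin 3) (Φ : testField) :
    partialD i (partialD j Φ) = partialD j (partialD i Φ) := by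
  ext1
  funext x
  have hd : ∀ y, DifferentiableAt ℝ (fderiv ℝ (Φ : E3 → E3)) y := fun y =>
    ((Φ.2.1.fderiv_right (m := ∞) (by simp)).differentiable (by simp)) y
  have h : ∀ u v : E3, fderiv ℝ (fun y => fderiv ℝ (Φ : E3 → E3) y u) x v
      = fderiv ℝ (fderiv ℝ (Φ : E3 → E3)) x v u := fun u v => by
    rw [fderiv_clm_apply (hd x) (differentiableAt_const u)]
    simp
  change fderiv ℝ (fun y => fderiv ℝ (Φ : E3 → E3) y _) x _
    = fderiv ℝ (fun y => fderiv ℝ (Φ : E3 → E3) y _) x _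
  rw [h, h]
  exact (Φ.2.1.contDiffAt.isSymmSndFDerivAt (by
    rw [minSmoothness_of_isRCLikeNormedField]; exact WithTop.coe_le_coe.2 le_top)).eq _ _

theorem isWeakDeriv (i : Fin 3) (Φ : testField) :
    IsWeakDeriv i (toL2 Φ) (toL2 (partialD i Φ)) := by
  intro φ hφ
  have h1 : ∀ (ψ : E3 → ℝ) (Ψ : testField), ∫ x, ψ x • (toL2 Ψ : Vec) x = ∫ x, ψ x • (Ψ : E3 → E3) x :=
    fun ψ Ψ => by
      refine integral_congr_ae ?_
      filter_upwards [coeFn_toVec (memLp Ψ)] with x hx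
      change _ • (toVec (Ψ : E3 → E3) : Vec) x = _
      rw [hx]
  have hi : ∀ {ψ : E3 → ℝ} (hψ : IsTest ψ) (Ψ : testField),
      Integrable fun x => ψ x • (Ψ : E3 → E3) x := fun hψ Ψ =>
    (hψ.1.continuous.smul Ψ.2.1.continuous).integrable_of_hasCompactSupport hψ.2.smul_right
  rw [h1, h1]
  have := integral_smul_fderiv_eq_neg_fderiv_smul_of_integrable
    (v := EuclideanSpace.single i 1) (hi (hφ.fderiv_apply _) Φ) (hi hφ (partialD i Φ)) (hi hφ Φ)
    (fun x _ => (hφ.1.differentiable (by simp)) x) (fun x _ => differentiable Φ x)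
  rw [show (∫ x, φ x • (partialD i Φ : E3 → E3) x)
    = ∫ x, φ x • fderiv ℝ (Φ : E3 → E3) x (EuclideanSpace.single i 1) from rfl, this, neg_neg]

theorem weakDeriv_toL2 (i : Fin 3) (Φ : testField) :
    weakDeriv i (toL2 Φ) = toL2 (partialD i Φ) := (isWeakDeriv i Φ).weakDeriv_eq

/-- A test function times a constant vector. -/
def ofTest {φ : E3 → ℝ} (hφ : IsTest φ) (Q : E3) : testField :=
  ⟨fun x => φ x • Q, hφ.1.smul contDiff_const, hφ.2.smul_right⟩

theorem partialD_ofTest {φ : E3 → ℝ} (hφ : IsTest φ) (Q : E3) (i : Fin 3) :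
    partialD i (ofTest hφ Q) = ofTest (hφ.fderiv_apply (EuclideanSpace.single i 1)) Q := by
  ext1
  funext x
  change fderiv ℝ (fun x => φ x • Q) x _ = _ • Q
  rw [((hφ.1.differentiable (by simp)) x).hasFDerivAt.smul_const Q |>.fderiv]
  rfl

theorem isTest_coord (Φ : testField) (j : Fin 3) : IsTest fun x => (Φ : E3 → E3) x j :=
  ⟨contDiff_euclidean.1 Φ.2.1 j, Φ.2.2.comp_left (g := fun v : E3 => v j) rfl⟩

theorem sum_ofTest (Φ : testField) :
    ∑ j, ofTest (isTest_coord Φ j) (EuclideanSpace.single j 1) = Φ := by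
  ext1
  funext x
  rw [Submodule.coe_sum, Finset.sum_apply]
  ext k
  simp [ofTest, Pi.single_apply, Finset.sum_ite_eq]

theorem inner_partialD (i : Fin 3) (Φ : testField) {A B : Vec} (h : IsWeakDeriv i A B) :
    ⟪toL2 (partialD i Φ), A⟫ = - ⟪toL2 Φ, B⟫ := by
  rw [isWeakDeriv_iff] at h
  rw [← sum_ofTest Φ]
  simp only [map_sum, sum_inner, ← Finset.sum_neg_distrib]
  refine Finset.sum_congr rfl fun j _ => ?_
  rw [partialD_ofTest]
  exact h _ (isTest_coord Φ j) _

/-- The Laplacian of a test field. -/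
def laplace : testField →ₗ[ℝ] testField := ∑ i, partialD i ∘ₗ partialD i

theorem laplace_apply (Φ : testField) : laplace Φ = ∑ i, partialD i (partialD i Φ) := by
  simp [laplace]

/-- `-Δ + μ` on test fields. -/
def helm (μ : ℝ) : testField →ₗ[ℝ] Vec := toL2 ∘ₗ (μ • LinearMap.id - laplace)

theorem helm_apply (μ : ℝ) (Φ : testField) :
    helm μ Φ = μ • toL2 Φ - ∑ i, toL2 (partialD i (partialD i Φ)) := by
  simp [helm, laplace_apply]

/-- Integrating by parts twice gives ‖ΔΦ‖² = Σ‖∂ᵢ∂ⱼΦ‖². For μ > 0 all terms are non-negative, so -Δ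
+ μ controls the field and its derivatives up to order two. -/
theorem norm_helm_sq (μ : ℝ) (Φ : testField) :
    ‖helm μ Φ‖ ^ 2 = μ ^ 2 * ‖toL2 Φ‖ ^ 2 + 2 * μ * ∑ i, ‖toL2 (partialD i Φ)‖ ^ 2
      + ∑ i, ∑ j, ‖toL2 (partialD i (partialD j Φ))‖ ^ 2 := by
  have h1 : ⟪toL2 Φ, ∑ i, toL2 (partialD i (partialD i Φ))⟫
      = - ∑ i, ‖toL2 (partialD i Φ)‖ ^ 2 := by
    rw [inner_sum, ← Finset.sum_neg_distrib]
    refine Finset.sum_congr rfl fun i _ => ?_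
    rw [← real_inner_self_eq_norm_sq, inner_partialD i Φ (isWeakDeriv i _), neg_neg]
  have h2 : ‖∑ i, toL2 (partialD i (partialD i Φ))‖ ^ 2
      = ∑ i, ∑ j, ‖toL2 (partialD i (partialD j Φ))‖ ^ 2 := by
    rw [← real_inner_self_eq_norm_sq, sum_inner]
    refine Finset.sum_congr rfl fun i _ => ?_
    rw [inner_sum]
    refine Finset.sum_congr rfl fun j _ => ?_
    rw [inner_partialD i _ (isWeakDeriv i _), partialD_comm i j (partialD j Φ),
      ← inner_partialD j _ (isWeakDeriv j _), partialD_comm j i, real_inner_self_eq_norm_sq]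
  rw [helm_apply, norm_sub_sq_real, inner_smul_left, h1, h2, norm_smul, mul_pow]
  simp
  ring

end testField

/-! ### Cauchy–Schwarz for integrals -/

section CauchySchwarz

variable {α : Type*} [MeasurableSpace α] {μ : Measure α}

theorem inner_toLp_toLp {f g : α → ℝ} (hf : MemLp f 2 μ) (hg : MemLp g 2 μ) :
    ⟪hf.toLp f, hg.toLp g⟫ = ∫ x, f x * g x ∂μ := by
  rw [L2.inner_def]
  refine integral_congr_ae ?_
  filter_upwards [hf.coeFn_toLp, hg.coeFn_toLp] with x h1 h2
  rw [h1, h2, real_inner_eq_re_inner, RCLike.inner_apply]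
  simp [mul_comm]

theorem integral_mul_sq_le {f g : α → ℝ} (hf : MemLp f 2 μ) (hg : MemLp g 2 μ) :
    (∫ x, f x * g x ∂μ) ^ 2 ≤ (∫ x, f x ^ 2 ∂μ) * ∫ x, g x ^ 2 ∂μ := by
  have h := real_inner_mul_inner_self_le (hf.toLp f) (hg.toLp g)
  rw [inner_toLp_toLp, inner_toLp_toLp, inner_toLp_toLp] at h
  simpa only [sq] using h

theorem integrable_mul_of_memLp {f g : α → ℝ} (hf : MemLp f 2 μ) (hg : MemLp g 2 μ) :
    Integrable (fun x => f x * g x) μ :=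
  hf.integrable_mul hg

end CauchySchwarz

/-! ### Very weak solutions -/

/-- The Laplacian of a function. -/
def lapl (φ : E3 → ℝ) (x : E3) : ℝ :=
  ∑ i : Fin 3, fderiv ℝ (fun y => fderiv ℝ φ y (EuclideanSpace.single i 1)) x
    (EuclideanSpace.single i 1)

theorem IsTest.comp_sub {η : E3 → ℝ} (hη : IsTest η) (x : E3) : IsTest fun y => η (x - y) :=
  ⟨hη.1.comp (contDiff_const.sub contDiff_id),
    hη.2.comp_homeomorph (Homeomorph.subLeft x)⟩

theorem IsTest.fderiv_comp_sub {η : E3 → ℝ} (hη : IsTest η) (x y v : E3) :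
    fderiv ℝ (fun y => η (x - y)) y v = - fderiv ℝ η (x - y) v := by
  have h1 := ((hη.1.differentiable (by simp)) (x - y)).hasFDerivAt
  have h2 : HasFDerivAt (fun y => η (x - y)) _ y := h1.comp y ((hasFDerivAt_id y).const_sub x)
  rw [h2.fderiv]
  simp

theorem IsTest.lapl_comp_sub {η : E3 → ℝ} (hη : IsTest η) (x y : E3) :
    lapl (fun y => η (x - y)) y = lapl η (x - y) := by
  unfold lapl
  refine Finset.sum_congr rfl fun i _ => ?_
  simp_rw [hη.fderiv_comp_sub x]
  rw [fderiv_fun_neg, neg_apply, (hη.fderiv_apply _).fderiv_comp_sub x, neg_neg]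

/-- The regularization of a function. -/
def mollify (f η : E3 → ℝ) (x : E3) : ℝ := ∫ y, f y * η (x - y)

theorem mollify_eq (f η : E3 → ℝ) :
    mollify f η = convolution f η (ContinuousLinearMap.mul ℝ ℝ) volume := rfl

theorem hasFDerivAt_mollify {f : E3 → ℝ} (hf : MemLp f 2 (volume : Measure E3)) {η : E3 → ℝ}
    (hη : IsTest η) (x : E3) :
    DifferentiableAt ℝ (mollify f η) x ∧
      ∀ v, fderiv ℝ (mollify f η) x v = mollify f (fun y => fderiv ℝ η y v) x := by
  have hl : LocallyIntegrable f (volume : Measure E3) := hf.locallyIntegrable (by norm_num)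
  have h := hη.2.hasFDerivAt_convolution_right (ContinuousLinearMap.mul ℝ ℝ) hl
    (hη.1.of_le (by simp)) x
  refine ⟨h.differentiableAt, fun v => ?_⟩
  rw [mollify_eq, h.fderiv]
  exact convolution_precompR_apply _ hl (hη.2.fderiv ℝ) (hη.1.continuous_fderiv (by simp)) _ _

/-- Cauchy–Schwarz gives |f * η|² ≤ ‖η‖₂² (f² * 1_{supp η}) almost everywhere, and the right side is
a convolution of integrable functions. -/
theorem memLp_mollify {f : E3 → ℝ} (hf : MemLp f 2 (volume : Measure E3)) {η : E3 → ℝ}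
    (hη : IsTest η) :
    MemLp (mollify f η) 2 (volume : Measure E3) := by
  have hl : LocallyIntegrable f (volume : Measure E3) := hf.locallyIntegrable (by norm_num)
  have hcont : Continuous (mollify f η) := hη.2.continuous_convolution_right (ContinuousLinearMap.mul ℝ ℝ) hl hη.1.continuous
  rw [memLp_two_iff_integrable_sq hcont.aestronglyMeasurable]
  set K : E3 → ℝ := (tsupport η).indicator 1 with hK
  have hKm : MeasurableSet (tsupport η) := hη.2.isCompact.measurableSet
  have hKi : Integrable K :=
    (integrableOn_const hη.2.isCompact.measure_lt_top.ne).integrable_indicator hKm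
  have hK2 : MemLp K 2 (volume : Measure E3) :=
    memLp_indicator_const 2 hKm (1 : ℝ) (Or.inr hη.2.isCompact.measure_lt_top.ne)
  have hint : Integrable (convolution (fun y => f y ^ 2) K (ContinuousLinearMap.mul ℝ ℝ) volume) :=
    hf.integrable_sq.integrable_convolution _ hKi
  refine (hint.const_mul (∫ y, η y ^ 2)).mono' (hcont.pow 2).aestronglyMeasurable ?_
  filter_upwards [(hf.integrable_sq.ae_convolution_exists (ContinuousLinearMap.mul ℝ ℝ) hKi)] with x hx
  have hηx : MemLp (fun y => η (x - y)) 2 (volume : Measure E3) := (hη.comp_sub x).memLp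
  have hfK : MemLp (fun y => f y * K (x - y)) 2 (volume : Measure E3) := by
    refine hf.mono (hf.1.mul ?_) (Eventually.of_forall fun y => ?_)
    · exact ((measurable_const.indicator hKm).comp (measurable_const.sub measurable_id)).aestronglyMeasurable
    · rw [norm_mul]
      refine mul_le_of_le_one_right (norm_nonneg _) ?_
      rw [hK]
      by_cases h : x - y ∈ tsupport η <;> simp [h]
  have e1 : mollify f η x = ∫ y, (f y * K (x - y)) * η (x - y) := by
    refine integral_congr_ae (Eventually.of_forall fun y => ?_)
    by_cases h : x - y ∈ tsupport η
    · simp [hK, h]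
    · simp [image_eq_zero_of_notMem_tsupport h]
  have e2 : ∫ y, (f y * K (x - y)) ^ 2
      = convolution (fun y => f y ^ 2) K (ContinuousLinearMap.mul ℝ ℝ) volume x := by
    refine integral_congr_ae (Eventually.of_forall fun y => ?_)
    by_cases h : x - y ∈ tsupport η <;> simp [hK, h]
  have e3 : ∫ y, η (x - y) ^ 2 = ∫ y, η y ^ 2 :=
    integral_sub_left_eq_self (fun y => η y ^ 2) volume x
  rw [Real.norm_of_nonneg (sq_nonneg _), e1, ← e3, ← e2, mul_comm]
  exact integral_mul_sq_le hfK hηx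

theorem lapl_mollify {f : E3 → ℝ} (hf : MemLp f 2 (volume : Measure E3)) {η : E3 → ℝ}
    (hη : IsTest η) (x : E3) :
    lapl (mollify f η) x = mollify f (lapl η) x := by
  have h1 : ∀ v, (fun y => fderiv ℝ (mollify f η) y v) = mollify f fun y => fderiv ℝ η y v :=
    fun v => funext fun y => (hasFDerivAt_mollify hf hη y).2 v
  have h2 : ∀ i : Fin 3, Integrable fun y => f y * fderiv ℝ
      (fun y => fderiv ℝ η y (EuclideanSpace.single i 1)) (x - y) (EuclideanSpace.single i 1) :=
    fun i => integrable_mul_of_memLp hf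
      ((((hη.fderiv_apply _).fderiv_apply _).comp_sub x).memLp)
  unfold lapl
  simp_rw [h1]
  unfold mollify
  simp_rw [Finset.mul_sum]
  rw [integral_finsetSum _ fun i _ => h2 i]
  exact Finset.sum_congr rfl fun i _ => (hasFDerivAt_mollify hf (hη.fderiv_apply _) x).2 _

/-- F = f * η is a classical solution of ΔF = μF whose derivatives are square integrable.
Integration by parts gives Σ‖∂ᵢF‖² = -μ‖F‖² ≤ 0, so F is constant, and a constant in L²(ℝ³) is 0.
The argument includes μ = 0. -/
theorem mollify_eq_zero {f : E3 → ℝ} (hf : MemLp f 2 (volume : Measure E3)) {η : E3 → ℝ}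
    (hη : IsTest η) {μ : ℝ} (hμ : 0 ≤ μ)
    (h : ∀ φ : E3 → ℝ, IsTest φ → ∫ x, f x * (μ * φ x - lapl φ x) = 0) (x : E3) :
    mollify f η x = 0 := by
  set F := mollify f η with hF
  have hF2 : MemLp F 2 (volume : Measure E3) := memLp_mollify hf hη
  have hF1 : ∀ v, (fun y => fderiv ℝ F y v) = mollify f fun y => fderiv ℝ η y v :=
    fun v => funext fun y => (hasFDerivAt_mollify hf hη y).2 v
  have hFd : ∀ v, MemLp (fun y => fderiv ℝ F y v) 2 (volume : Measure E3) := fun v => by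
    rw [hF1]; exact memLp_mollify hf (hη.fderiv_apply v)
  have hFdd : ∀ v, MemLp (fun y => fderiv ℝ (fun y => fderiv ℝ F y v) y v) 2
      (volume : Measure E3) := fun v => by
    rw [hF1]
    have : (fun y => fderiv ℝ (mollify f fun y => fderiv ℝ η y v) y v)
        = mollify f fun y => fderiv ℝ (fun y => fderiv ℝ η y v) y v :=
      funext fun y => (hasFDerivAt_mollify hf (hη.fderiv_apply v) y).2 v
    rw [this]
    exact memLp_mollify hf ((hη.fderiv_apply v).fderiv_apply v)
  have hdd : ∀ v, Differentiable ℝ fun y => fderiv ℝ F y v := fun v y => by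
    rw [hF1]; exact (hasFDerivAt_mollify hf (hη.fderiv_apply v) y).1
  have hlap : ∀ y, lapl F y = μ * F y := fun y => by
    rw [hF, lapl_mollify hf hη]
    -- The weak equation is tested on z ↦ η(y - z).
    have h1 := h _ (hη.comp_sub y)
    have i1 : Integrable fun z => f z * η (y - z) :=
      integrable_mul_of_memLp hf (hη.comp_sub y).memLp
    have i2 : Integrable fun z => f z * lapl η (y - z) := by
      unfold lapl
      simp_rw [Finset.mul_sum]
      exact integrable_finsetSum _ fun i _ => integrable_mul_of_memLp hf
        ((((hη.fderiv_apply _).fderiv_apply _).comp_sub y).memLp)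
    simp_rw [hη.lapl_comp_sub, mul_sub, mul_left_comm (f _) μ] at h1
    rw [integral_sub (i1.const_mul μ) i2, integral_const_mul] at h1
    exact (sub_eq_zero.1 h1).symm
  have hibp : ∀ v, ∫ y, F y * fderiv ℝ (fun y => fderiv ℝ F y v) y v
      = - ∫ y, fderiv ℝ F y v * fderiv ℝ F y v := fun v =>
    integral_mul_fderiv_eq_neg_fderiv_mul_of_integrable
      (integrable_mul_of_memLp (hFd v) (hFd v)) (integrable_mul_of_memLp hF2 (hFdd v))
      (integrable_mul_of_memLp hF2 (hFd v))
      (fun y _ => (hasFDerivAt_mollify hf hη y).1) (fun y _ => hdd v y)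
  have hsum : ∑ i : Fin 3, ∫ y, fderiv ℝ F y (EuclideanSpace.single i 1)
      * fderiv ℝ F y (EuclideanSpace.single i 1) = - (μ * ∫ y, F y ^ 2) := by
    rw [← neg_eq_iff_eq_neg, ← Finset.sum_neg_distrib]
    simp_rw [← hibp]
    rw [← integral_finsetSum _ fun i _ => integrable_mul_of_memLp hF2 (hFdd _),
      ← integral_const_mul]
    refine integral_congr_ae (Eventually.of_forall fun y => ?_)
    simp only [← Finset.mul_sum]
    change F y * lapl F y = _
    rw [hlap]
    ring
  have hzero : ∀ i : Fin 3, ∀ y, fderiv ℝ F y (EuclideanSpace.single i 1) = 0 := by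
    intro i
    have hnn : ∀ j : Fin 3, 0 ≤ ∫ y, fderiv ℝ F y (EuclideanSpace.single j 1)
      * fderiv ℝ F y (EuclideanSpace.single j 1) := fun j =>
      integral_nonneg fun y => mul_self_nonneg _
    have h0 : ∫ y, fderiv ℝ F y (EuclideanSpace.single i 1)
      * fderiv ℝ F y (EuclideanSpace.single i 1) = 0 := by
      refine le_antisymm ?_ (hnn i)
      refine (Finset.single_le_sum (fun j _ => hnn j) (Finset.mem_univ i)).trans ?_
      rw [hsum, neg_nonpos]
      exact mul_nonneg hμ (integral_nonneg fun y => sq_nonneg _)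
    have h1 := (integral_eq_zero_iff_of_nonneg (fun y => mul_self_nonneg _)
      (integrable_mul_of_memLp (hFd _) (hFd _))).1 h0
    have hc : Continuous fun y => fderiv ℝ F y (EuclideanSpace.single i 1) := (hdd _).continuous
    have h2 := (Continuous.ae_eq_iff_eq volume (hc.mul hc) continuous_const).1 h1
    intro y
    exact mul_self_eq_zero.1 (congrFun h2 y)
  have hconst : ∀ y, F y = F x := by
    intro y
    refine is_const_of_fderiv_eq_zero (𝕜 := ℝ) (fun y => (hasFDerivAt_mollify hf hη y).1)
      (fun y => ?_) y x
    refine ContinuousLinearMap.coe_injective ?_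
    refine (EuclideanSpace.basisFun (Fin 3) ℝ).toBasis.ext fun i => ?_
    simpa using hzero i y
  have hF' : F = fun _ => F x := funext hconst
  rw [hF', memLp_const_iff (by norm_num) (by norm_num)] at hF2
  rcases hF2 with h0 | h0
  · exact h0
  · simp at h0

/-- A square integrable function that is a very weak solution of `-Δf + μf = 0`, with `μ ≥ 0`,
vanishes. -/
theorem ae_eq_zero_of_veryWeak {f : E3 → ℝ} (hf : MemLp f 2 (volume : Measure E3)) {μ : ℝ}
    (hμ : 0 ≤ μ) (h : ∀ φ : E3 → ℝ, IsTest φ → ∫ x, f x * (μ * φ x - lapl φ x) = 0) :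
    ∀ᵐ x, f x = 0 := by
  refine ae_eq_zero_of_integral_contDiff_smul_eq_zero (hf.locallyIntegrable (by norm_num)) ?_
  intro g hg hg'
  have hη : IsTest fun y => g (0 - y) := IsTest.comp_sub ⟨hg, hg'⟩ 0
  have := mollify_eq_zero hf hη hμ h 0
  unfold mollify at this
  simp only [zero_sub, neg_neg] at this
  simpa only [smul_eq_mul, mul_comm] using this

/-! ### The fundamental solution -/

/-- A smooth substitute for `|x|`. -/
def softNorm (ε : ℝ) (x : E3) : ℝ := √(‖x‖ ^ 2 + ε ^ 2)

theorem softNorm_pos {ε : ℝ} (hε : 0 < ε) (x : E3) : 0 < softNorm ε x :=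
  Real.sqrt_pos.2 (by positivity)

theorem softNorm_sq (ε : ℝ) (x : E3) : softNorm ε x ^ 2 = ‖x‖ ^ 2 + ε ^ 2 :=
  Real.sq_sqrt (by positivity)

theorem continuous_softNorm (ε : ℝ) : Continuous (softNorm ε) := by
  unfold softNorm; fun_prop

theorem norm_le_softNorm (ε : ℝ) (x : E3) : ‖x‖ ≤ softNorm ε x :=
  Real.le_sqrt_of_sq_le (by nlinarith [sq_nonneg ε])

theorem hasFDerivAt_softNorm {ε : ℝ} (hε : 0 < ε) (x : E3) :
    HasFDerivAt (softNorm ε) ((softNorm ε x)⁻¹ • innerSL ℝ x) x := by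
  have h := ((hasStrictFDerivAt_norm_sq x).hasFDerivAt.add_const (ε ^ 2)).sqrt (by positivity)
  refine h.congr_fderiv ?_
  ext v
  simp only [smul_apply, smul_eq_mul, softNorm, coe_innerSL_apply, two_smul, _root_.add_apply]
  field_simp
  ring

/-- Composition of the soft norm with a function of one variable. -/
theorem hasFDerivAt_comp_softNorm {ε : ℝ} (hε : 0 < ε) (x : E3) {g : ℝ → ℝ} {g' : ℝ}
    (hg : HasDerivAt g g' (softNorm ε x)) :
    HasFDerivAt (fun y => g (softNorm ε y)) ((g' * (softNorm ε x)⁻¹) • innerSL ℝ x) x := by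
  have h := hg.comp_hasFDerivAt x (hasFDerivAt_softNorm hε x)
  rw [smul_smul] at h
  exact h

/-- The regularization of the Green function. -/
def softGreen (κ ε : ℝ) (x : E3) : ℝ :=
  Real.exp (-(κ * softNorm ε x)) / (4 * Real.pi * softNorm ε x)

/-- The radial derivative of the regularized Green function, divided by `-|x|`. -/
def softSlope (κ ε : ℝ) (x : E3) : ℝ :=
  (κ * softNorm ε x + 1) * Real.exp (-(κ * softNorm ε x)) / (4 * Real.pi * softNorm ε x ^ 3)

/-- The regularization of the Dirac measure. -/
def softDirac (κ ε : ℝ) (x : E3) : ℝ :=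
  ε ^ 2 * ((κ ^ 2 * softNorm ε x ^ 2 + 3 * (κ * softNorm ε x) + 3)
    * Real.exp (-(κ * softNorm ε x)) / (4 * Real.pi * softNorm ε x ^ 5))

theorem hasFDerivAt_softGreen (κ : ℝ) {ε : ℝ} (hε : 0 < ε) (x : E3) :
    HasFDerivAt (softGreen κ ε) ((-softSlope κ ε x) • innerSL ℝ x) x := by
  have hs := softNorm_pos hε x
  have hg : HasDerivAt (fun t : ℝ => Real.exp (-(κ * t)) / (4 * Real.pi * t))
      ((Real.exp (-(κ * softNorm ε x)) * (-(κ * 1)) * (4 * Real.pi * softNorm ε x)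
        - Real.exp (-(κ * softNorm ε x)) * (4 * Real.pi * 1)) / (4 * Real.pi * softNorm ε x) ^ 2)
      (softNorm ε x) :=
    ((((hasDerivAt_id _).const_mul κ).fun_neg).exp).div ((hasDerivAt_id _).const_mul _)
      (by positivity)
  refine (hasFDerivAt_comp_softNorm hε x hg).congr_fderiv ?_
  congr 1
  unfold softSlope
  field_simp
  ring

theorem hasFDerivAt_softSlope (κ : ℝ) {ε : ℝ} (hε : 0 < ε) (x : E3) :
    HasFDerivAt (softSlope κ ε) ((-((κ ^ 2 * softNorm ε x ^ 2 + 3 * (κ * softNorm ε x) + 3)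
      * Real.exp (-(κ * softNorm ε x)) / (4 * Real.pi * softNorm ε x ^ 5))) • innerSL ℝ x) x := by
  have hs := softNorm_pos hε x
  have hg : HasDerivAt (fun t : ℝ => (κ * t + 1) * Real.exp (-(κ * t)) / (4 * Real.pi * t ^ 3))
      ((((κ * 1) * Real.exp (-(κ * softNorm ε x)) + (κ * softNorm ε x + 1)
        * (Real.exp (-(κ * softNorm ε x)) * (-(κ * 1)))) * (4 * Real.pi * softNorm ε x ^ 3)
        - (κ * softNorm ε x + 1) * Real.exp (-(κ * softNorm ε x))
          * (4 * Real.pi * (3 * softNorm ε x ^ 2 * 1))) / (4 * Real.pi * softNorm ε x ^ 3) ^ 2)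
      (softNorm ε x) :=
    ((((hasDerivAt_id _).const_mul κ).add_const 1).fun_mul
      ((((hasDerivAt_id _).const_mul κ).fun_neg).exp)).div
      (((hasDerivAt_id _).fun_pow 3).const_mul _) (by positivity)
  refine (hasFDerivAt_comp_softNorm hε x hg).congr_fderiv ?_
  congr 1
  field_simp
  ring

theorem fderiv_softGreen (κ : ℝ) {ε : ℝ} (hε : 0 < ε) (x v : E3) :
    fderiv ℝ (softGreen κ ε) x v = - softSlope κ ε x * ⟪x, v⟫ := by
  rw [(hasFDerivAt_softGreen κ hε x).fderiv]
  rfl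

/-- For s = √(|x|² + ε²) the Laplacian of a function of s is its radial Laplacian at s, up to a term
with factor ε² = s² - |x|². The radial part of e^{-κs}/4πs gives κ², and the ε² term is `softDirac`.
-/
theorem lapl_softGreen (κ : ℝ) {ε : ℝ} (hε : 0 < ε) (x : E3) :
    lapl (softGreen κ ε) x = κ ^ 2 * softGreen κ ε x - softDirac κ ε x := by
  have hs := softNorm_pos hε x
  have h : ∀ v : E3, fderiv ℝ (fun y => fderiv ℝ (softGreen κ ε) y v) x v
      = (κ ^ 2 * softNorm ε x ^ 2 + 3 * (κ * softNorm ε x) + 3)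
      * Real.exp (-(κ * softNorm ε x)) / (4 * Real.pi * softNorm ε x ^ 5) * ⟪x, v⟫ ^ 2
        - softSlope κ ε x * ⟪v, v⟫ := by
    intro v
    simp_rw [fderiv_softGreen κ hε]
    have h1 : HasFDerivAt (fun y : E3 => ⟪y, v⟫) ((innerSL ℝ).flip v) x :=
      ((innerSL ℝ).flip v).hasFDerivAt
    have h2 := (hasFDerivAt_softSlope κ hε x).fun_neg.fun_mul h1
    rw [h2.fderiv]
    simp only [_root_.add_apply, smul_apply, neg_apply, smul_eq_mul, coe_innerSL_apply,
      ContinuousLinearMap.flip_apply]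
    ring
  unfold lapl
  simp_rw [h]
  rw [Finset.sum_sub_distrib, ← Finset.mul_sum, ← Finset.mul_sum]
  have h3 : ∑ i : Fin 3, ⟪x, (EuclideanSpace.single i 1 : E3)⟫ ^ 2 = softNorm ε x ^ 2 - ε ^ 2 := by
    rw [softNorm_sq, EuclideanSpace.norm_sq_eq]
    simp [EuclideanSpace.inner_single_right]
  have h4 : ∑ i : Fin 3, ⟪(EuclideanSpace.single i 1 : E3), (EuclideanSpace.single i 1 : E3)⟫ = 3 := by
    simp
  rw [h3, h4]
  unfold softGreen softDirac softSlope
  field_simp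
  ring

theorem continuous_softGreen (κ : ℝ) {ε : ℝ} (hε : 0 < ε) : Continuous (softGreen κ ε) :=
  continuous_iff_continuousAt.2 fun x => (hasFDerivAt_softGreen κ hε x).continuousAt

theorem continuous_softSlope (κ : ℝ) {ε : ℝ} (hε : 0 < ε) : Continuous (softSlope κ ε) :=
  continuous_iff_continuousAt.2 fun x => (hasFDerivAt_softSlope κ hε x).continuousAt

theorem continuous_softDirac (κ : ℝ) {ε : ℝ} (hε : 0 < ε) : Continuous (softDirac κ ε) := by
  have := continuous_softNorm ε
  unfold softDirac
  refine continuous_const.mul (Continuous.div (by fun_prop) (by fun_prop) fun x => ?_)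
  have := softNorm_pos hε x
  positivity

theorem IsTest.integrable_mul {φ : E3 → ℝ} (hφ : IsTest φ) {f : E3 → ℝ} (hf : Continuous f) :
    Integrable fun x => f x * φ x :=
  (hf.mul hφ.1.continuous).integrable_of_hasCompactSupport hφ.2.mul_left

theorem IsTest.lapl_integrable_mul {φ : E3 → ℝ} (hφ : IsTest φ) {f : E3 → ℝ} (hf : Continuous f) :
    Integrable fun x => f x * lapl φ x := by
  unfold lapl
  simp_rw [Finset.mul_sum]
  exact integrable_finsetSum _ fun i _ => ((hφ.fderiv_apply _).fderiv_apply _).integrable_mul hf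

/-- Green's second identity for a test function. -/
theorem integral_mul_lapl {f : E3 → ℝ} {φ : E3 → ℝ} (hφ : IsTest φ)
    (hf : ∀ x, DifferentiableAt ℝ f x) (hf' : ∀ v, Continuous fun x => fderiv ℝ f x v)
    (hf1 : ∀ v x, DifferentiableAt ℝ (fun x => fderiv ℝ f x v) x)
    (hf2 : ∀ v, Continuous fun x => fderiv ℝ (fun x => fderiv ℝ f x v) x v) :
    ∫ x, f x * lapl φ x = ∫ x, lapl f x * φ x := by
  have hfc : Continuous f := (show Differentiable ℝ f from hf).continuous
  unfold lapl
  simp_rw [Finset.mul_sum, Finset.sum_mul]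
  rw [integral_finsetSum _ fun i _ => ((hφ.fderiv_apply _).fderiv_apply _).integrable_mul hfc,
    integral_finsetSum _ fun i _ => hφ.integrable_mul (hf2 _)]
  refine Finset.sum_congr rfl fun i _ => ?_
  rw [integral_mul_fderiv_eq_neg_fderiv_mul_of_integrable
    ((hφ.fderiv_apply _).integrable_mul (hf' _))
    (((hφ.fderiv_apply _).fderiv_apply _).integrable_mul hfc)
    ((hφ.fderiv_apply _).integrable_mul hfc) (fun x _ => hf x)
    (fun x _ => ((hφ.fderiv_apply _).1.differentiable (by simp)) x),
    integral_mul_fderiv_eq_neg_fderiv_mul_of_integrable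
    (hφ.integrable_mul (hf2 _)) ((hφ.fderiv_apply _).integrable_mul (hf' _))
    (hφ.integrable_mul (hf' _)) (fun x _ => hf1 _ x)
    (fun x _ => (hφ.1.differentiable (by simp)) x), neg_neg]

theorem integral_softGreen_mul (κ : ℝ) {ε : ℝ} (hε : 0 < ε) {φ : E3 → ℝ} (hφ : IsTest φ) :
    ∫ x, softGreen κ ε x * (κ ^ 2 * φ x - lapl φ x) = ∫ x, softDirac κ ε x * φ x := by
  have hd1 : ∀ v, (fun x => fderiv ℝ (softGreen κ ε) x v) = fun x => - softSlope κ ε x * ⟪x, v⟫ :=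
    fun v => funext fun x => fderiv_softGreen κ hε x v
  have hd2 : ∀ v x, HasFDerivAt (fun x => fderiv ℝ (softGreen κ ε) x v) _ x := fun v x => by
    rw [hd1]
    exact (hasFDerivAt_softSlope κ hε x).fun_neg.fun_mul ((innerSL ℝ).flip v).hasFDerivAt
  have hN := continuous_softNorm ε
  have hS := continuous_softSlope κ hε
  have h1 := integral_mul_lapl (f := softGreen κ ε) hφ
    (fun x => (hasFDerivAt_softGreen κ hε x).differentiableAt)
    (fun v => by rw [hd1]; fun_prop)
    (fun v x => (hd2 v x).differentiableAt) (fun v => by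
      have : (fun x => fderiv ℝ (fun x => fderiv ℝ (softGreen κ ε) x v) x v) = _ :=
        funext fun x => congrArg (fun L : E3 →L[ℝ] ℝ => L v) (hd2 v x).fderiv
      rw [this]
      simp only [_root_.add_apply, smul_apply, neg_apply, smul_eq_mul, coe_innerSL_apply,
        ContinuousLinearMap.flip_apply]
      have h0 : ∀ x : E3, 4 * Real.pi * softNorm ε x ^ 5 ≠ 0 := fun x => by
        have := softNorm_pos hε x
        positivity
      have h5 : Continuous fun x : E3 => (κ ^ 2 * softNorm ε x ^ 2 + 3 * (κ * softNorm ε x) + 3)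
          * Real.exp (-(κ * softNorm ε x)) / (4 * Real.pi * softNorm ε x ^ 5) :=
        Continuous.div (by fun_prop) (by fun_prop) h0
      fun_prop)
  have hG := continuous_softGreen κ hε
  simp_rw [lapl_softGreen κ hε, sub_mul] at h1
  rw [integral_sub (hφ.integrable_mul (by fun_prop))
    (hφ.integrable_mul (continuous_softDirac κ hε))] at h1
  simp_rw [mul_sub]
  rw [integral_sub _ (hφ.lapl_integrable_mul hG), h1]
  · have : ∫ x, softGreen κ ε x * (κ ^ 2 * φ x) = ∫ x, κ ^ 2 * softGreen κ ε x * φ x :=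
      integral_congr_ae (Eventually.of_forall fun x => by ring)
    rw [this, sub_sub_cancel]
  · exact (hφ.integrable_mul (hG.const_mul (κ ^ 2))).congr
      (Eventually.of_forall fun x => by ring)

theorem memLp_green_scalar {z : ℝ} (hz : 0 < z) : MemLp (green z) 2 (volume : Measure E3) := by
  have hm : Measurable (green z) := by unfold green; fun_prop
  refine (memLp_green hz (EuclideanSpace.single 0 1)).mono hm.aestronglyMeasurable
    (Eventually.of_forall fun x => ?_)
  rw [norm_smul]
  simp

theorem green_nonneg (z : ℝ) (x : E3) : 0 ≤ green z x := by unfold green; positivity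

/-- As s ≥ |x| and the Green function decreases with the distance, `green z` itself dominates. -/
theorem tendsto_integral_softGreen_mul {z : ℝ} (hz : 0 < z) {ψ : E3 → ℝ}
    (hψ : MemLp ψ 2 (volume : Measure E3)) :
    Tendsto (fun ε => ∫ x, softGreen (√z) ε x * ψ x) (𝓝[>] 0) (𝓝 (∫ x, green z x * ψ x)) := by
  have hint : Integrable fun x => green z x * ψ x :=
    integrable_mul_of_memLp (memLp_green_scalar hz) hψ
  have hne : ∀ᵐ x : E3, x ≠ 0 := by simp [ae_iff]
  refine tendsto_integral_filter_of_dominated_convergence (fun x => ‖green z x * ψ x‖) ?_ ?_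
    hint.norm ?_
  · filter_upwards [self_mem_nhdsWithin] with ε hε
    exact (continuous_softGreen _ hε).aestronglyMeasurable.mul hψ.1
  · filter_upwards [self_mem_nhdsWithin] with ε hε
    filter_upwards [hne] with x hx
    rw [norm_mul, norm_mul]
    refine mul_le_mul_of_nonneg_right ?_ (norm_nonneg _)
    have h1 := norm_le_softNorm ε x
    have h2 : 0 < ‖x‖ := norm_pos_iff.2 hx
    have h3 := softNorm_pos hε x
    rw [Real.norm_of_nonneg (green_nonneg z x), Real.norm_of_nonneg
      (by unfold softGreen; positivity)]
    unfold softGreen green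
    gcongr
  · filter_upwards [hne] with x hx
    have h2 : 0 < ‖x‖ := norm_pos_iff.2 hx
    have hs : Tendsto (fun ε => softNorm ε x) (𝓝[>] 0) (𝓝 ‖x‖) := by
      have hc : Continuous fun ε => softNorm ε x := by unfold softNorm; fun_prop
      have := (hc.tendsto 0).mono_left (nhdsWithin_le_nhds (s := Set.Ioi 0))
      simpa [softNorm] using this
    refine Tendsto.mul_const _ ?_
    unfold softGreen green
    exact (((hs.const_mul _).neg).rexp).div (hs.const_mul _) (by positivity)

theorem softNorm_smul {ε : ℝ} (hε : 0 < ε) (y : E3) : softNorm ε (ε • y) = ε * softNorm 1 y := by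
  unfold softNorm
  rw [norm_smul, Real.norm_of_nonneg hε.le, show (ε * ‖y‖) ^ 2 + ε ^ 2 = ε ^ 2 * (‖y‖ ^ 2 + 1 ^ 2) by
    ring, Real.sqrt_mul (by positivity), Real.sqrt_sq hε.le]

/-- The factor ε³ is the Jacobian of x = εy. In these coordinates `softDirac` tends to 3 / (4π (1 +
|y|²)^{5/2}) as ε ↓ 0. -/
theorem softDirac_smul (κ : ℝ) {ε : ℝ} (hε : 0 < ε) (y : E3) :
    ε ^ 3 * softDirac κ ε (ε • y) = ((κ * (ε * softNorm 1 y)) ^ 2 + 3 * (κ * (ε * softNorm 1 y)) + 3)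
      * Real.exp (-(κ * (ε * softNorm 1 y))) / (4 * Real.pi * softNorm 1 y ^ 5) := by
  have := softNorm_pos one_pos y
  unfold softDirac
  rw [softNorm_smul hε]
  field_simp

theorem integrable_softNorm_rpow : Integrable fun y : E3 => (softNorm 1 y ^ 5)⁻¹ := by
  have h := integrable_rpow_neg_one_add_norm_sq (E := E3) (μ := volume) (r := 5) (by simp; norm_num)
  refine h.congr (Eventually.of_forall fun y => ?_)
  have h1 : (0 : ℝ) ≤ 1 + ‖y‖ ^ 2 := by positivity
  simp only
  rw [show softNorm 1 y = (1 + ‖y‖ ^ 2) ^ (1 / 2 : ℝ) by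
    rw [← Real.sqrt_eq_rpow, softNorm, add_comm]; simp, ← Real.rpow_mul_natCast h1, ← Real.rpow_neg h1]
  norm_num

/-- In polar coordinates the integrand has the primitive t³ / (1 + t²)^{3/2}. -/
theorem integral_softNorm : ∫ y : E3, 3 / (4 * Real.pi * softNorm 1 y ^ 5) = 1 := by
  have h := integral_fun_norm_addHaar (volume : Measure E3)
    (fun t => 3 / (4 * Real.pi * √(t ^ 2 + 1 ^ 2) ^ 5))
  have hvol : (volume : Measure E3).real (Metric.ball 0 1) = 4 / 3 * Real.pi := by
    rw [Measure.real, EuclideanSpace.volume_ball_fin_three]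
    rw [ENNReal.ofReal_one, one_pow, one_mul, ENNReal.toReal_ofReal (by positivity)]
    ring
  have hd : ∀ t : ℝ, HasDerivAt (fun t : ℝ => t ^ 3 / √(t ^ 2 + 1 ^ 2) ^ 3)
      (3 * t ^ 2 / √(t ^ 2 + 1 ^ 2) ^ 5) t := by
    intro t
    have hpos : 0 < t ^ 2 + 1 ^ 2 := by positivity
    have hs : 0 < √(t ^ 2 + 1 ^ 2) := Real.sqrt_pos.2 hpos
    have h1 := (((hasDerivAt_id' t).fun_pow 2).add_const ((1 : ℝ) ^ 2)).sqrt hpos.ne'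
    have h2 := ((hasDerivAt_id' t).fun_pow 3).fun_div (h1.fun_pow 3) (by positivity)
    refine h2.congr_deriv ?_
    have h3 : √(t ^ 2 + 1 ^ 2) ^ 2 = t ^ 2 + 1 ^ 2 := Real.sq_sqrt hpos.le
    generalize √(t ^ 2 + 1 ^ 2) = s at *
    field_simp
    push_cast
    linear_combination 6 * t ^ 2 * s ^ 2 * h3
  have hlim : Tendsto (fun t : ℝ => t ^ 3 / √(t ^ 2 + 1 ^ 2) ^ 3) atTop (𝓝 1) := by
    have h1 : Tendsto (fun t : ℝ => (√(1 + (t⁻¹) ^ 2) ^ 3)⁻¹) atTop (𝓝 ((√(1 + 0 ^ 2) ^ 3)⁻¹)) := by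
      have hc : Continuous fun u : ℝ => (√(1 + u ^ 2) ^ 3)⁻¹ :=
        Continuous.inv₀ (by fun_prop) fun u => by positivity
      exact (hc.tendsto 0).comp tendsto_inv_atTop_zero
    simp only [ne_eq, OfNat.ofNat_ne_zero, not_false_eq_true, zero_pow, add_zero, Real.sqrt_one,
      one_pow, inv_one] at h1
    refine h1.congr' ?_
    filter_upwards [eventually_gt_atTop 0] with t ht
    rw [show 1 + (t⁻¹) ^ 2 = (t ^ 2 + 1) / t ^ 2 by field_simp, Real.sqrt_div (by positivity),
      Real.sqrt_sq ht.le, div_pow, inv_div]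
    simp
  have hval : ∫ t in Set.Ioi (0 : ℝ), 3 * t ^ 2 / √(t ^ 2 + 1 ^ 2) ^ 5 = 1 := by
    rw [integral_Ioi_of_hasDerivAt_of_nonneg' (fun t _ => hd t) (fun t _ => by positivity) hlim]
    simp
  have hrw : ∀ y : E3, 3 / (4 * Real.pi * softNorm 1 y ^ 5)
      = (fun t : ℝ => 3 / (4 * Real.pi * √(t ^ 2 + 1 ^ 2) ^ 5)) ‖y‖ := fun y => rfl
  simp_rw [hrw]
  rw [h, hvol]
  simp only [finrank_euclideanSpace, Fintype.card_fin, smul_eq_mul, nsmul_eq_mul]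
  have hcg : ∀ t : ℝ, t ^ (3 - 1) * (3 / (4 * Real.pi * √(t ^ 2 + 1 ^ 2) ^ 5))
      = (4 * Real.pi)⁻¹ * (3 * t ^ 2 / √(t ^ 2 + 1 ^ 2) ^ 5) := fun t => by
    norm_num
    field_simp
  simp_rw [hcg]
  rw [integral_const_mul, hval]
  push_cast
  field_simp

/-- After x = εy convergence is dominated, because (t² + 3t + 3) e^{-t} ≤ 3 for t ≥ 0, which is the
quadratic lower bound for the exponential. -/
theorem tendsto_integral_softDirac_mul {κ : ℝ} (hκ : 0 ≤ κ) {φ : E3 → ℝ} (hφ : IsTest φ) :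
    Tendsto (fun ε => ∫ x, softDirac κ ε x * φ x) (𝓝[>] 0) (𝓝 (φ 0)) := by
  obtain ⟨C, hC⟩ := hφ.1.continuous.bounded_above_of_compact_support hφ.2
  have hC0 : 0 ≤ C := (norm_nonneg _).trans (hC 0)
  have hchange : ∀ ε ∈ Set.Ioi (0 : ℝ), ∫ x, softDirac κ ε x * φ x
      = ∫ y, (((κ * (ε * softNorm 1 y)) ^ 2 + 3 * (κ * (ε * softNorm 1 y)) + 3)
      * Real.exp (-(κ * (ε * softNorm 1 y))) / (4 * Real.pi * softNorm 1 y ^ 5)) * φ (ε • y) := by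
    intro ε hε
    have hε' : (0 : ℝ) < ε := hε
    have h := Measure.integral_comp_smul (volume : Measure E3) (fun x => softDirac κ ε x * φ x) ε
    simp_rw [← softDirac_smul κ hε', mul_assoc]
    rw [integral_const_mul, h]
    simp only [finrank_euclideanSpace, Fintype.card_fin, smul_eq_mul]
    rw [abs_of_pos (by positivity), ← mul_assoc, mul_inv_cancel₀ (by positivity), one_mul]
  have hlim : Tendsto (fun ε => ∫ y, (((κ * (ε * softNorm 1 y)) ^ 2 + 3 * (κ * (ε * softNorm 1 y)) + 3)
      * Real.exp (-(κ * (ε * softNorm 1 y))) / (4 * Real.pi * softNorm 1 y ^ 5)) * φ (ε • y))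
      (𝓝[>] 0) (𝓝 (∫ y, 3 / (4 * Real.pi * softNorm 1 y ^ 5) * φ 0)) := by
    have hN := continuous_softNorm 1
    have hN0 : ∀ y, 4 * Real.pi * softNorm 1 y ^ 5 ≠ 0 := fun y => by
      have := softNorm_pos one_pos y
      positivity
    have hφc := hφ.1.continuous
    refine tendsto_integral_filter_of_dominated_convergence
      (fun y => 3 * (4 * Real.pi)⁻¹ * C * (softNorm 1 y ^ 5)⁻¹) ?_ ?_
      (integrable_softNorm_rpow.const_mul _) ?_
    · refine Eventually.of_forall fun ε => Continuous.aestronglyMeasurable ?_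
      exact (Continuous.div (by fun_prop) (by fun_prop) hN0).mul (by fun_prop)
    · filter_upwards [self_mem_nhdsWithin] with ε hε
      refine Eventually.of_forall fun y => ?_
      have hs := softNorm_pos one_pos y
      set t := κ * (ε * softNorm 1 y) with ht
      have hε' : (0 : ℝ) < ε := hε
      have ht0 : 0 ≤ t := by positivity
      have h1 : (t ^ 2 + 3 * t + 3) * Real.exp (-t) ≤ 3 := by
        rw [Real.exp_neg, ← div_eq_mul_inv, div_le_iff₀ (Real.exp_pos t)]
        nlinarith [Real.quadratic_le_exp_of_nonneg ht0, sq_nonneg t]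
      rw [norm_mul, Real.norm_of_nonneg (by positivity)]
      calc (t ^ 2 + 3 * t + 3) * Real.exp (-t) / (4 * Real.pi * softNorm 1 y ^ 5) * ‖φ (ε • y)‖
          ≤ 3 / (4 * Real.pi * softNorm 1 y ^ 5) * C := by
            gcongr
            exact hC _
        _ = _ := by field_simp
    · refine Eventually.of_forall fun y => ?_
      have hc : Continuous fun ε : ℝ => (((κ * (ε * softNorm 1 y)) ^ 2
          + 3 * (κ * (ε * softNorm 1 y)) + 3) * Real.exp (-(κ * (ε * softNorm 1 y)))
          / (4 * Real.pi * softNorm 1 y ^ 5)) * φ (ε • y) := by fun_prop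
      have := (hc.tendsto 0).mono_left (nhdsWithin_le_nhds (s := Set.Ioi 0))
      simpa using this
  rw [integral_mul_const, integral_softNorm, one_mul] at hlim
  refine hlim.congr' ?_
  filter_upwards [self_mem_nhdsWithin] with ε hε using (hchange ε hε).symm

theorem IsTest.memLp_helm {φ : E3 → ℝ} (hφ : IsTest φ) (μ : ℝ) :
    MemLp (fun x => μ * φ x - lapl φ x) 2 (volume : Measure E3) := by
  refine (hφ.memLp.const_mul μ).sub ?_
  unfold lapl
  exact memLp_finsetSum _ fun i _ => ((hφ.fderiv_apply _).fderiv_apply _).memLp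

/-- `G_z` is the fundamental solution of `-Δ + z`. -/
theorem integral_green_mul {z : ℝ} (hz : 0 < z) {φ : E3 → ℝ} (hφ : IsTest φ) :
    ∫ x, green z x * (z * φ x - lapl φ x) = φ 0 := by
  refine tendsto_nhds_unique (tendsto_integral_softGreen_mul hz (hφ.memLp_helm z)) ?_
  refine (tendsto_integral_softDirac_mul (Real.sqrt_nonneg z) hφ).congr' ?_
  filter_upwards [self_mem_nhdsWithin] with ε hε
  rw [← integral_softGreen_mul _ hε hφ, Real.sq_sqrt hz.le]

/-! ### The free resolvent -/

theorem memLp_coord (A : Vec) (j : Fin 3) : MemLp (fun x => A x j) 2 (volume : Measure E3) := by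
  refine (Lp.memLp A).mono ?_ (Eventually.of_forall fun x => PiLp.norm_apply_le (A x) j)
  exact (EuclideanSpace.proj (𝕜 := ℝ) j).continuous.comp_aestronglyMeasurable (Lp.memLp A).1

theorem norm_toVec_smul_sq {f : E3 → ℝ} (hf : MemLp f 2 (volume : Measure E3)) (Q : E3) :
    ‖toVec fun x => f x • Q‖ ^ 2 = (∫ x, f x ^ 2) * ‖Q‖ ^ 2 := by
  rw [← real_inner_self_eq_norm_sq, inner_toVec_toVec (MemLp.smul_vec hf Q) (MemLp.smul_vec hf Q),
    ← integral_mul_const]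
  refine integral_congr_ae (Eventually.of_forall fun x => ?_)
  simp only [real_inner_self_eq_norm_sq, norm_smul, mul_pow, Real.norm_eq_abs, sq_abs]

namespace testField

theorem laplace_ofTest {φ : E3 → ℝ} (hφ : IsTest φ) (Q : E3) (x : E3) :
    (laplace (ofTest hφ Q) : E3 → E3) x = lapl φ x • Q := by
  rw [laplace_apply, Submodule.coe_sum, Finset.sum_apply, lapl, Finset.sum_smul]
  refine Finset.sum_congr rfl fun i _ => ?_
  rw [partialD_ofTest, partialD_ofTest]
  rfl

theorem helm_ofTest (μ : ℝ) {φ : E3 → ℝ} (hφ : IsTest φ) (Q : E3) :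
    helm μ (ofTest hφ Q) = toVec fun x => (μ * φ x - lapl φ x) • Q := by
  change toVec ((μ • ofTest hφ Q - laplace (ofTest hφ Q) : testField) : E3 → E3) = _
  congr 1
  funext x
  change μ • (φ x • Q) - (laplace (ofTest hφ Q) : E3 → E3) x = _
  rw [laplace_ofTest, smul_smul, sub_smul]

theorem eq_zero_of_inner_helm {μ : ℝ} (hμ : 0 ≤ μ) {A : Vec} (h : ∀ Φ, ⟪helm μ Φ, A⟫ = 0) :
    A = 0 := by
  have hj : ∀ j : Fin 3, ∀ᵐ x, A x j = 0 := by
    intro j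
    refine ae_eq_zero_of_veryWeak (memLp_coord A j) hμ fun φ hφ => ?_
    have h1 := h (ofTest hφ (EuclideanSpace.single j 1))
    rw [helm_ofTest, inner_toVec (MemLp.smul_vec (hφ.memLp_helm μ) _)] at h1
    rw [← h1]
    refine integral_congr_ae (Eventually.of_forall fun x => ?_)
    simp only [real_inner_smul_left, EuclideanSpace.inner_single_left, map_one, one_mul]
    ring
  apply Lp.ext
  filter_upwards [ae_all_iff.2 hj, Lp.coeFn_zero E3 2 (volume : Measure E3)] with x hx h0
  rw [h0]
  ext j
  exact hx j

/-- A field orthogonal to the range has components that are very weak solutions of -Δf + μf = 0,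
hence it is 0. -/
theorem denseRange_helm {μ : ℝ} (hμ : 0 ≤ μ) : DenseRange (helm μ) := by
  have h : (LinearMap.range (helm μ)).topologicalClosure = ⊤ := by
    rw [Submodule.topologicalClosure_eq_top_iff, Submodule.eq_bot_iff]
    intro A hA
    exact eq_zero_of_inner_helm hμ fun Φ =>
      (Submodule.mem_orthogonal _ _).1 hA _ (LinearMap.mem_range_self _ Φ)
  exact Submodule.dense_iff_topologicalClosure_eq_top.2 h

variable {μ : ℝ}

theorem norm_toL2_le (hμ : 0 < μ) (Φ : testField) : ‖toL2 Φ‖ ≤ μ⁻¹ * ‖helm μ Φ‖ := by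
  have h := norm_helm_sq μ Φ
  have h1 : 0 ≤ ∑ i : Fin 3, ‖toL2 (partialD i Φ)‖ ^ 2 :=
    Finset.sum_nonneg fun i _ => sq_nonneg _
  have h2 : 0 ≤ ∑ i : Fin 3, ∑ j : Fin 3, ‖toL2 (partialD i (partialD j Φ))‖ ^ 2 :=
    Finset.sum_nonneg fun i _ => Finset.sum_nonneg fun j _ => sq_nonneg _
  have h3 : (μ * ‖toL2 Φ‖) ^ 2 ≤ ‖helm μ Φ‖ ^ 2 := by nlinarith [mul_nonneg hμ.le h1]
  rw [le_inv_mul_iff₀ hμ]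
  exact (pow_le_pow_iff_left₀ (by positivity) (norm_nonneg _) two_ne_zero).1 h3

theorem norm_partialD_le (hμ : 0 < μ) (Φ : testField) (i : Fin 3) :
    ‖toL2 (partialD i Φ)‖ ≤ (√(2 * μ))⁻¹ * ‖helm μ Φ‖ := by
  have h := norm_helm_sq μ Φ
  have h1 : ‖toL2 (partialD i Φ)‖ ^ 2 ≤ ∑ i : Fin 3, ‖toL2 (partialD i Φ)‖ ^ 2 :=
    Finset.single_le_sum (f := fun i => ‖toL2 (partialD i Φ)‖ ^ 2)
      (fun j _ => sq_nonneg _) (Finset.mem_univ i)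
  have h2 : 0 ≤ ∑ i : Fin 3, ∑ j : Fin 3, ‖toL2 (partialD i (partialD j Φ))‖ ^ 2 :=
    Finset.sum_nonneg fun i _ => Finset.sum_nonneg fun j _ => sq_nonneg _
  rw [le_inv_mul_iff₀ (by positivity)]
  refine (pow_le_pow_iff_left₀ (by positivity) (norm_nonneg _) two_ne_zero).1 ?_
  rw [mul_pow, Real.sq_sqrt (by positivity)]
  nlinarith [sq_nonneg (μ * ‖toL2 Φ‖)]

theorem norm_partialD_partialD_le (hμ : 0 < μ) (Φ : testField) (i j : Fin 3) :
    ‖toL2 (partialD i (partialD j Φ))‖ ≤ 1 * ‖helm μ Φ‖ := by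
  have h := norm_helm_sq μ Φ
  have h1 : 0 ≤ ∑ i : Fin 3, ‖toL2 (partialD i Φ)‖ ^ 2 :=
    Finset.sum_nonneg fun i _ => sq_nonneg _
  have h2 : ‖toL2 (partialD i (partialD j Φ))‖ ^ 2
      ≤ ∑ i : Fin 3, ∑ j : Fin 3, ‖toL2 (partialD i (partialD j Φ))‖ ^ 2 :=
    (Finset.single_le_sum (f := fun j => ‖toL2 (partialD i (partialD j Φ))‖ ^ 2)
      (fun j _ => sq_nonneg _) (Finset.mem_univ j)).trans
    (Finset.single_le_sum (f := fun i => ∑ j : Fin 3, ‖toL2 (partialD i (partialD j Φ))‖ ^ 2)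
      (fun i _ => Finset.sum_nonneg fun j _ => sq_nonneg _) (Finset.mem_univ i))
  rw [one_mul]
  refine (pow_le_pow_iff_left₀ (by positivity) (norm_nonneg _) two_ne_zero).1 ?_
  nlinarith [sq_nonneg (μ * ‖toL2 Φ‖), mul_nonneg hμ.le h1]

end testField

open testField

/-- The free resolvent `(-Δ + μ)⁻¹`. -/
def resolvent (μ : ℝ) : Vec →L[ℝ] Vec := toL2.extendOfNorm (helm μ)

/-- The first derivatives of the free resolvent. -/
def resolventD (μ : ℝ) (i : Fin 3) : Vec →L[ℝ] Vec := (toL2 ∘ₗ partialD i).extendOfNorm (helm μ)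

/-- The second derivatives of the free resolvent. -/
def resolventDD (μ : ℝ) (i j : Fin 3) : Vec →L[ℝ] Vec :=
  (toL2 ∘ₗ partialD i ∘ₗ partialD j).extendOfNorm (helm μ)

section Resolvent

variable {μ : ℝ}

theorem resolvent_helm (hμ : 0 < μ) (Φ : testField) : resolvent μ (helm μ Φ) = toL2 Φ :=
  LinearMap.extendOfNorm_eq (denseRange_helm hμ.le) ⟨_, norm_toL2_le hμ⟩ Φ

theorem resolventD_helm (hμ : 0 < μ) (i : Fin 3) (Φ : testField) :
    resolventD μ i (helm μ Φ) = toL2 (partialD i Φ) :=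
  LinearMap.extendOfNorm_eq (denseRange_helm hμ.le) ⟨_, fun Φ => norm_partialD_le hμ Φ i⟩ Φ

theorem resolventDD_helm (hμ : 0 < μ) (i j : Fin 3) (Φ : testField) :
    resolventDD μ i j (helm μ Φ) = toL2 (partialD i (partialD j Φ)) :=
  LinearMap.extendOfNorm_eq (denseRange_helm hμ.le)
    ⟨_, fun Φ => norm_partialD_partialD_le hμ Φ i j⟩ Φ

/-- The identity holds on the dense range of `helm μ` by the classical derivative of a test field,
and being a weak derivative is a closed condition. -/
theorem isWeakDeriv_resolvent (hμ : 0 < μ) (i : Fin 3) (f : Vec) :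
    IsWeakDeriv i (resolvent μ f) (resolventD μ i f) := by
  refine (denseRange_helm hμ.le).induction_on f (isClosed_isWeakDeriv i
    (resolvent μ).continuous (resolventD μ i).continuous) fun Φ => ?_
  rw [resolvent_helm hμ, resolventD_helm hμ]
  exact testField.isWeakDeriv i Φ

theorem isWeakDeriv_resolventD (hμ : 0 < μ) (i j : Fin 3) (f : Vec) :
    IsWeakDeriv i (resolventD μ j f) (resolventDD μ i j f) := by
  refine (denseRange_helm hμ.le).induction_on f (isClosed_isWeakDeriv i
    (resolventD μ j).continuous (resolventDD μ i j).continuous) fun Φ => ?_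
  rw [resolventD_helm hμ, resolventDD_helm hμ]
  exact testField.isWeakDeriv i _

theorem isH1_resolvent (hμ : 0 < μ) (f : Vec) : IsH1 (resolvent μ f) := fun i =>
  ⟨_, isWeakDeriv_resolvent hμ i f⟩

theorem isH2_resolvent (hμ : 0 < μ) (f : Vec) : IsH2 (resolvent μ f) :=
  ⟨isH1_resolvent hμ f, fun j i => by
    rw [(isWeakDeriv_resolvent hμ j f).weakDeriv_eq]
    exact ⟨_, isWeakDeriv_resolventD hμ i j f⟩⟩

theorem neg_lap_resolvent_add (hμ : 0 < μ) (f : Vec) :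
    - lap (resolvent μ f) + μ • resolvent μ f = f := by
  have h : lap (resolvent μ f) = ∑ i, resolventDD μ i i f := by
    unfold lap
    refine Finset.sum_congr rfl fun i _ => ?_
    rw [(isWeakDeriv_resolvent hμ i f).weakDeriv_eq, (isWeakDeriv_resolventD hμ i i f).weakDeriv_eq]
  rw [h]
  refine (denseRange_helm hμ.le).induction_on f (isClosed_eq (by fun_prop) continuous_id)
    fun Φ => ?_
  simp_rw [resolventDD_helm hμ]
  rw [resolvent_helm hμ, helm_apply]
  abel

theorem inner_helm_of_isH1 (μ : ℝ) (Φ : testField) {A : Vec} (hA : IsH1 A) :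
    ⟪helm μ Φ, A⟫ = μ * ⟪toL2 Φ, A⟫ + ∑ i, ⟪toL2 (partialD i Φ), weakDeriv i A⟫ := by
  rw [helm_apply, inner_sub_left, inner_smul_left, RCLike.conj_to_real, sum_inner, sub_eq_add_neg,
    ← Finset.sum_neg_distrib]
  congr 1
  refine Finset.sum_congr rfl fun i _ => ?_
  rw [inner_partialD i _ (hA.isWeakDeriv i), neg_neg]

theorem inner_helm_of_isH2 (μ : ℝ) (Φ : testField) {A : Vec} (hA : IsH2 A) :
    ⟪helm μ Φ, A⟫ = ⟪toL2 Φ, - lap A + μ • A⟫ := by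
  rw [inner_helm_of_isH1 μ Φ hA.1, inner_add_right, inner_smul_right, inner_neg_right, lap,
    inner_sum, add_comm, ← Finset.sum_neg_distrib]
  congr 1
  refine Finset.sum_congr rfl fun i _ => ?_
  rw [inner_partialD i _ ((hA.2 i).isWeakDeriv i)]

/-- Uniqueness comes from testing the difference of two solutions against the dense range of `helm
μ`. -/
theorem eq_resolvent (hμ : 0 < μ) {u f : Vec} (hu : IsH2 u) (h : - lap u + μ • u = f) :
    u = resolvent μ f := by
  rw [← sub_eq_zero]
  refine eq_zero_of_inner_helm hμ.le fun Φ => ?_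
  rw [inner_sub_right, inner_helm_of_isH2 μ Φ hu, inner_helm_of_isH2 μ Φ (isH2_resolvent hμ f), h,
    neg_lap_resolvent_add hμ, sub_self]

theorem resolvent_symm (hμ : 0 < μ) (f g : Vec) : ⟪resolvent μ f, g⟫ = ⟪f, resolvent μ g⟫ := by
  refine (denseRange_helm hμ.le).induction_on f (isClosed_eq (by fun_prop) (by fun_prop))
    fun Φ => ?_
  rw [resolvent_helm hμ, inner_helm_of_isH2 μ Φ (isH2_resolvent hμ g), neg_lap_resolvent_add hμ]

/-- The variational equation of the resolvent. It later identifies the resolvent as i i*, with i the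
embedding of the energy space in L²_*. -/
theorem inner_eq_form_resolvent (hμ : 0 < μ) (f : Vec) {A : Vec} (hA : IsH1 A) :
    ⟪f, A⟫ = μ * ⟪resolvent μ f, A⟫ + ∑ i, ⟪weakDeriv i (resolvent μ f), weakDeriv i A⟫ := by
  simp_rw [(isWeakDeriv_resolvent hμ _ f).weakDeriv_eq]
  refine (denseRange_helm hμ.le).induction_on f (isClosed_eq (by fun_prop) (by fun_prop))
    fun Φ => ?_
  simp_rw [resolventD_helm hμ]
  rw [resolvent_helm hμ, inner_helm_of_isH1 μ Φ hA]

end Resolvent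

/-! ### The resolvent preserves solenoidal fields -/

/-- The gradient of a test function. -/
def gradF {φ : E3 → ℝ} (hφ : IsTest φ) : testField :=
  ∑ i, partialD i (ofTest hφ (EuclideanSpace.single i 1))

theorem gradF_apply {φ : E3 → ℝ} (hφ : IsTest φ) (x : E3) (j : Fin 3) :
    (gradF hφ : E3 → E3) x j = fderiv ℝ φ x (EuclideanSpace.single j 1) := by
  rw [gradF, Submodule.coe_sum, Finset.sum_apply]
  simp_rw [partialD_ofTest]
  simp [ofTest, Pi.single_apply, Finset.sum_ite_eq]

theorem coe_gradF {φ : E3 → ℝ} (hφ : IsTest φ) : (gradF hφ : E3 → E3) = gradient φ := by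
  funext x
  ext j
  rw [gradF_apply, ← inner_gradient_left, EuclideanSpace.inner_single_right]
  simp

theorem mem_solenoidal_iff {A : Vec} :
    A ∈ solenoidal ↔ ∀ (φ : E3 → ℝ) (hφ : IsTest φ), ⟪toL2 (gradF hφ), A⟫ = 0 := by
  change (∀ φ : E3 → ℝ, IsTest φ → ∫ x, ⟪gradient φ x, A x⟫ = 0) ↔ _
  refine forall₂_congr fun φ hφ => ?_
  change _ ↔ ⟪toVec (gradF hφ : E3 → E3), A⟫ = 0
  rw [coe_gradF, inner_toVec hφ.memLp_gradient]

theorem IsTest.helm {φ : E3 → ℝ} (hφ : IsTest φ) (μ : ℝ) : IsTest fun x => μ * φ x - lapl φ x := by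
  have h := isTest_coord (μ • ofTest hφ (EuclideanSpace.single 0 1)
    - laplace (ofTest hφ (EuclideanSpace.single 0 1))) 0
  have e : (fun x => ((μ • ofTest hφ (EuclideanSpace.single 0 1)
    - laplace (ofTest hφ (EuclideanSpace.single 0 1)) : testField) : E3 → E3) x 0)
      = fun x => μ * φ x - lapl φ x := by
    funext x
    change (μ • (φ x • (EuclideanSpace.single 0 1 : E3))
      - (laplace (ofTest hφ (EuclideanSpace.single 0 1)) : E3 → E3) x) 0 = _
    rw [laplace_ofTest]
    simp
  rwa [e] at h

theorem laplace_partialD (i : Fin 3) (Φ : testField) :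
    laplace (partialD i Φ) = partialD i (laplace Φ) := by
  rw [laplace_apply, laplace_apply, map_sum]
  refine Finset.sum_congr rfl fun j _ => ?_
  rw [partialD_comm j i Φ, partialD_comm j i]

theorem helm_gradF (μ : ℝ) {φ : E3 → ℝ} (hφ : IsTest φ) :
    helm μ (gradF hφ) = toL2 (gradF (hφ.helm μ)) := by
  change toL2 (μ • gradF hφ - laplace (gradF hφ)) = _
  congr 1
  unfold gradF
  rw [Finset.smul_sum, map_sum, ← Finset.sum_sub_distrib]
  refine Finset.sum_congr rfl fun i _ => ?_
  rw [laplace_partialD, ← map_smul, ← map_sub]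
  congr 1
  ext1
  funext x
  change μ • (φ x • _) - (laplace (ofTest hφ _) : E3 → E3) x = (μ * φ x - lapl φ x) • _
  rw [laplace_ofTest, smul_smul, sub_smul]

/-- The divergence of a field in `H¹`. -/
def divergence (A : Vec) (x : E3) : ℝ := ∑ i, weakDeriv i A x i

theorem memLp_divergence (A : Vec) : MemLp (divergence A) 2 (volume : Measure E3) :=
  memLp_finsetSum _ fun i _ => memLp_coord (weakDeriv i A) i

theorem inner_gradF {φ : E3 → ℝ} (hφ : IsTest φ) {A : Vec} (hA : IsH1 A) :
    ⟪toL2 (gradF hφ), A⟫ = - ∫ x, divergence A x * φ x := by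
  unfold gradF
  rw [map_sum, sum_inner]
  have h : ∀ i : Fin 3, ⟪toL2 (partialD i (ofTest hφ (EuclideanSpace.single i 1))), A⟫
      = - ∫ x, weakDeriv i A x i * φ x := by
    intro i
    rw [inner_partialD i _ (hA.isWeakDeriv i)]
    change - ⟪toVec fun x => φ x • EuclideanSpace.single i 1, _⟫ = _
    rw [inner_toVec (MemLp.smul_vec hφ.memLp _)]
    congr 1
    refine integral_congr_ae (Eventually.of_forall fun x => ?_)
    simp only [real_inner_smul_left, EuclideanSpace.inner_single_left, map_one, one_mul]
    ring
  simp_rw [h]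
  rw [Finset.sum_neg_distrib, ← integral_finsetSum _ fun i _ =>
    integrable_mul_of_memLp (memLp_coord (weakDeriv i A) i) hφ.memLp]
  congr 1
  refine integral_congr_ae (Eventually.of_forall fun x => ?_)
  simp only [divergence, Finset.sum_mul]

/-- Since -Δ + μ commutes with the gradient on test functions, the divergence of the resolvent is a
square integrable very weak solution of the homogeneous equation and vanishes. -/
theorem resolvent_mem_solenoidal {μ : ℝ} (hμ : 0 < μ) {f : Vec} (hf : f ∈ solenoidal) :
    resolvent μ f ∈ solenoidal := by
  rw [mem_solenoidal_iff] at *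
  have hu := isH2_resolvent hμ f
  have h0 : ∀ᵐ x, divergence (resolvent μ f) x = 0 := by
    refine ae_eq_zero_of_veryWeak (memLp_divergence _) hμ.le fun φ hφ => ?_
    have h1 := inner_gradF (hφ.helm μ) hu.1
    rw [← helm_gradF μ hφ, inner_helm_of_isH2 μ _ hu, neg_lap_resolvent_add hμ, hf φ hφ] at h1
    linarith
  intro φ hφ
  rw [inner_gradF hφ hu.1, neg_eq_zero]
  refine integral_eq_zero_of_ae ?_
  filter_upwards [h0] with x hx
  rw [hx, zero_mul, Pi.zero_apply]

/-- The free resolvent on `L²_*`. -/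
def resolventS {μ : ℝ} (hμ : 0 < μ) : L2s →L[ℝ] L2s :=
  ((resolvent μ).comp solenoidal.subtypeL).codRestrict solenoidal fun f =>
    resolvent_mem_solenoidal hμ f.2

theorem coe_resolventS {μ : ℝ} (hμ : 0 < μ) (f : L2s) :
    (resolventS hμ f : Vec) = resolvent μ f := rfl

theorem inner_M (f : Vec) (g : L2s) : ⟪M f, g⟫ = ⟪f, (g : Vec)⟫ := by
  have := Submodule.inner_orthogonalProjectionOnto_eq_of_mem_right (K := solenoidal) g f
  exact this

theorem inner_M_right (f : L2s) (g : Vec) : ⟪f, M g⟫ = ⟪(f : Vec), g⟫ := by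
  rw [real_inner_comm, inner_M, real_inner_comm]

theorem M_resolvent {μ : ℝ} (hμ : 0 < μ) (f : Vec) : M (resolvent μ f) = resolventS hμ (M f) := by
  refine ext_inner_right ℝ fun g => ?_
  rw [inner_M, resolvent_symm hμ, ← coe_resolventS hμ g, ← inner_M]
  change ⟪(M f : Vec), resolvent μ g⟫ = ⟪resolvent μ (M f), (g : Vec)⟫
  rw [resolvent_symm hμ]

/-! ### The continuous representative -/

/-- The `L²` norm of the Green function. -/
def greenNorm (μ : ℝ) : ℝ := √(∫ x, green μ x ^ 2)

/-- The convolution with the Green function. -/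
def potential (μ : ℝ) (f : Vec) (x : E3) : E3 := ∫ y, green μ (x - y) • f y

section Potential

variable {μ : ℝ}

theorem memLp_green_sub (hμ : 0 < μ) (x : E3) :
    MemLp (fun y => green μ (x - y)) 2 (volume : Measure E3) :=
  (memLp_green_scalar hμ).comp_measurePreserving (Measure.measurePreserving_sub_left volume x)

theorem inner_potential (hμ : 0 < μ) (f : Vec) (x Q : E3) :
    ⟪Q, potential μ f x⟫ = ⟪toVec fun y => green μ (x - y) • Q, f⟫ :=
  (inner_toVec_smul (memLp_green_sub hμ x) Q f).symm

theorem potential_sub (hμ : 0 < μ) (f g : Vec) (x : E3) :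
    potential μ (f - g) x = potential μ f x - potential μ g x := by
  refine ext_inner_left ℝ fun Q => ?_
  rw [inner_sub_right, inner_potential hμ, inner_potential hμ, inner_potential hμ, inner_sub_right]

/-- Point evaluation of the convolution is bounded on L², because `green μ` is square integrable in
three dimensions. -/
theorem norm_potential_le (hμ : 0 < μ) (f : Vec) (x : E3) :
    ‖potential μ f x‖ ≤ greenNorm μ * ‖f‖ := by
  set P := potential μ f x with hP
  have h1 : ‖P‖ ^ 2 ≤ ‖toVec fun y => green μ (x - y) • P‖ * ‖f‖ := by
    rw [← real_inner_self_eq_norm_sq, hP, inner_potential hμ, ← hP]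
    exact real_inner_le_norm _ _
  have h2 : ‖toVec fun y => green μ (x - y) • P‖ = greenNorm μ * ‖P‖ := by
    refine (pow_left_inj₀ (norm_nonneg _) (by unfold greenNorm; positivity) two_ne_zero).1 ?_
    rw [norm_toVec_smul_sq (memLp_green_sub hμ x), mul_pow, greenNorm,
      Real.sq_sqrt (integral_nonneg fun y => sq_nonneg _)]
    rw [integral_sub_left_eq_self (fun y => green μ y ^ 2) volume x]
  rw [h2] at h1
  rcases eq_or_lt_of_le (norm_nonneg P) with h0 | h0
  · rw [← h0]; unfold greenNorm; positivity
  · have : ‖P‖ * ‖P‖ ≤ greenNorm μ * ‖f‖ * ‖P‖ := by nlinarith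
    exact le_of_mul_le_mul_right this h0

theorem IsTest.integral_green_sub_mul (hμ : 0 < μ) {φ : E3 → ℝ} (hφ : IsTest φ) (x : E3) :
    ∫ y, green μ (x - y) * (μ * φ y - lapl φ y) = φ x := by
  have h := integral_green_mul hμ (hφ.comp_sub x)
  simp_rw [hφ.lapl_comp_sub, sub_zero] at h
  rw [← h, ← integral_sub_left_eq_self _ volume x]
  simp_rw [sub_sub_cancel]

theorem potential_helm (hμ : 0 < μ) (Φ : testField) (x : E3) :
    potential μ (helm μ Φ) x = (Φ : E3 → E3) x := by
  refine ext_inner_left ℝ fun Q => ?_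
  rw [inner_potential hμ, ← sum_ofTest Φ, map_sum, inner_sum, Submodule.coe_sum, Finset.sum_apply,
    inner_sum]
  refine Finset.sum_congr rfl fun j _ => ?_
  have hφ := isTest_coord Φ j
  rw [helm_ofTest, inner_toVec_toVec (MemLp.smul_vec (memLp_green_sub hμ x) Q)
    (MemLp.smul_vec (hφ.memLp_helm μ) _)]
  change _ = ⟪Q, (Φ : E3 → E3) x j • _⟫
  rw [real_inner_smul_right, ← hφ.integral_green_sub_mul hμ x, ← integral_mul_const]
  refine integral_congr_ae (Eventually.of_forall fun y => ?_)
  simp only [real_inner_smul_left, real_inner_smul_right]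
  ring

/-- By `potential_helm` the potential is a uniform limit of test fields. -/
theorem continuous_potential (hμ : 0 < μ) (f : Vec) : Continuous (potential μ f) := by
  refine continuous_of_uniform_approx_of_continuous fun u hu => ?_
  obtain ⟨ε, hε, hu⟩ := Metric.mem_uniformity_dist.1 hu
  have hpos : 0 < greenNorm μ + 1 := by unfold greenNorm; positivity
  obtain ⟨Φ, hΦ⟩ := (denseRange_helm hμ.le).exists_dist_lt f (div_pos hε hpos)
  refine ⟨Φ, Φ.2.1.continuous, fun y => hu ?_⟩
  rw [← potential_helm hμ Φ y, dist_eq_norm, ← potential_sub hμ]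
  rw [dist_eq_norm, lt_div_iff₀ hpos] at hΦ
  refine (norm_potential_le hμ _ y).trans_lt ?_
  nlinarith [norm_nonneg (f - helm μ Φ)]

/-- Along fields `helm μ Φ` approximating f, the test fields Φ converge everywhere to the potential,
and a subsequence converges almost everywhere to the resolvent. -/
theorem coeFn_resolvent (hμ : 0 < μ) (f : Vec) : resolvent μ f =ᵐ[volume] potential μ f := by
  obtain ⟨w, hw, hlim⟩ := mem_closure_iff_seq_limit.1 (denseRange_helm hμ.le f)
  choose Φ hΦ using hw
  obtain rfl : (fun n => helm μ (Φ n)) = w := funext hΦ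
  have h1 : Tendsto (fun n => resolvent μ (helm μ (Φ n))) atTop (𝓝 (resolvent μ f)) :=
    ((resolvent μ).continuous.tendsto f).comp hlim
  obtain ⟨ns, hns, hae⟩ := (tendstoInMeasure_of_tendsto_Lp h1).exists_seq_tendsto_ae
  have h2 : ∀ x, Tendsto (fun n => (Φ n : E3 → E3) x) atTop (𝓝 (potential μ f x)) := by
    intro x
    rw [tendsto_iff_norm_sub_tendsto_zero]
    have h3 := (tendsto_iff_norm_sub_tendsto_zero.1 hlim).const_mul (greenNorm μ)
    rw [mul_zero] at h3
    refine squeeze_zero (fun _ => norm_nonneg _) (fun n => ?_) h3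
    rw [← potential_helm hμ, ← potential_sub hμ]
    exact norm_potential_le hμ _ x
  have h4 : ∀ᵐ x, ∀ n, (resolvent μ (helm μ (Φ n)) : Vec) x = (Φ n : E3 → E3) x :=
    ae_all_iff.2 fun n => by
      rw [resolvent_helm hμ]
      exact coeFn_toVec (memLp (Φ n))
  filter_upwards [hae, h4] with x hx hx4
  refine tendsto_nhds_unique hx (((h2 x).comp hns.tendsto_atTop).congr fun n => ?_)
  rw [Function.comp_apply, hx4]

end Potential

/-! ### Rotations -/

open testField

/-- The field `f Q`, as a linear function of the vector `Q`. -/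
def vecOf {f : E3 → ℝ} (hf : MemLp f 2 (volume : Measure E3)) : E3 →ₗ[ℝ] Vec where
  toFun Q := toVec fun x => f x • Q
  map_add' Q Q' := by
    rw [← toVec_add (MemLp.smul_vec hf Q) (MemLp.smul_vec hf Q')]
    simp_rw [smul_add]
  map_smul' a Q := by
    rw [RingHom.id_apply, ← toVec_smul a (MemLp.smul_vec hf Q)]
    simp_rw [smul_comm a]

theorem vecOf_apply {f : E3 → ℝ} (hf : MemLp f 2 (volume : Measure E3)) (Q : E3) :
    vecOf hf Q = toVec fun x => f x • Q := rfl

theorem memLp_rotate (O : E3 ≃ₗᵢ[ℝ] E3) (A : Vec) :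
    MemLp (fun x => O (A (O.symm x))) 2 (volume : Measure E3) := by
  have h := (Lp.memLp A).comp_measurePreserving O.symm.measurePreserving
  exact h.of_le (O.continuous.comp_aestronglyMeasurable h.1)
    (Eventually.of_forall fun x => (O.norm_map _).le)

/-- The rotation of a field. -/
def rotate (O : E3 ≃ₗᵢ[ℝ] E3) (A : Vec) : Vec := toVec fun x => O (A (O.symm x))

theorem inner_rotate (O : E3 ≃ₗᵢ[ℝ] E3) (A B : Vec) :
    ⟪rotate O A, B⟫ = ⟪A, rotate O.symm B⟫ := by
  rw [rotate, inner_toVec (memLp_rotate O A), real_inner_comm, rotate,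
    inner_toVec (memLp_rotate O.symm B),
    ← O.measurePreserving.integral_comp O.toHomeomorph.measurableEmbedding]
  refine integral_congr_ae (Eventually.of_forall fun x => ?_)
  simp only [LinearIsometryEquiv.symm_symm, LinearIsometryEquiv.symm_apply_apply]
  rw [← O.symm.inner_map_map, LinearIsometryEquiv.symm_apply_apply, real_inner_comm]

theorem IsTest.comp_isometry {φ : E3 → ℝ} (hφ : IsTest φ) (O : E3 ≃ₗᵢ[ℝ] E3) :
    IsTest fun x => φ (O x) :=
  ⟨hφ.1.comp O.contDiff, hφ.2.comp_homeomorph O.toHomeomorph⟩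

theorem IsTest.gradient_comp_isometry {φ : E3 → ℝ} (hφ : IsTest φ) (O : E3 ≃ₗᵢ[ℝ] E3) (x : E3) :
    gradient (fun x => φ (O x)) x = O.symm (gradient φ (O x)) := by
  refine ext_inner_right ℝ fun v => ?_
  have h : HasFDerivAt (fun x => φ (O x)) ((fderiv ℝ φ (O x)).comp (O : E3 →L[ℝ] E3)) x :=
    ((hφ.1.differentiable (by simp)) (O x)).hasFDerivAt.comp x O.toContinuousLinearEquiv.hasFDerivAt
  rw [inner_gradient_left, h.fderiv, ← O.inner_map_map, LinearIsometryEquiv.apply_symm_apply,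
    inner_gradient_left]
  rfl

theorem rotate_mem_solenoidal (O : E3 ≃ₗᵢ[ℝ] E3) {A : Vec} (hA : A ∈ solenoidal) :
    rotate O A ∈ solenoidal := by
  intro φ hφ
  rw [integral_inner_gradient hφ, real_inner_comm, inner_rotate, real_inner_comm, rotate,
    inner_toVec (memLp_rotate _ _), ← hA _ (hφ.comp_isometry O)]
  refine integral_congr_ae ?_
  have h := O.measurePreserving.quasiMeasurePreserving.ae hφ.memLp_gradient.coeFn_toLp
  filter_upwards [h] with x hx
  simp only [LinearIsometryEquiv.symm_symm]
  rw [hx, hφ.gradient_comp_isometry]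

/-- A rotation and its inverse preserve the solenoidal fields, so the orthogonal projection commutes
with it. -/
theorem M_rotate (O : E3 ≃ₗᵢ[ℝ] E3) (A : Vec) : (M (rotate O A) : Vec) = rotate O (M A) := by
  have h : M (rotate O A) = ⟨rotate O (M A), rotate_mem_solenoidal O (M A).2⟩ := by
    refine ext_inner_right ℝ fun g => ?_
    rw [inner_M, inner_rotate]
    change _ = ⟪rotate O (M A), (g : Vec)⟫
    rw [inner_rotate]
    exact (inner_M A ⟨_, rotate_mem_solenoidal O.symm g.2⟩).symm
  rw [h]

/-- Radial functions. -/
def IsRadial (f : E3 → ℝ) : Prop := ∀ x y : E3, ‖x‖ = ‖y‖ → f x = f y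

theorem IsRadial.rotate_vecOf {f : E3 → ℝ} (hr : IsRadial f) (hf : MemLp f 2 (volume : Measure E3))
    (O : E3 ≃ₗᵢ[ℝ] E3) (Q : E3) : rotate O (vecOf hf Q) = vecOf hf (O Q) := by
  rw [rotate, vecOf_apply, vecOf_apply]
  refine toVec_congr ?_
  have h := O.symm.measurePreserving.quasiMeasurePreserving.ae (coeFn_toVec (MemLp.smul_vec hf Q))
  filter_upwards [h] with x hx
  rw [hx, map_smul, hr _ x (O.symm.norm_map x)]

theorem inner_vecOf_M_vecOf_rotate {h k : E3 → ℝ} (hr : IsRadial h) (kr : IsRadial k)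
    (h2 : MemLp h 2 (volume : Measure E3)) (k2 : MemLp k 2 (volume : Measure E3))
    (O : E3 ≃ₗᵢ[ℝ] E3) (Q Q' : E3) :
    ⟪vecOf h2 (O Q), (M (vecOf k2 (O Q')) : Vec)⟫ = ⟪vecOf h2 Q, (M (vecOf k2 Q') : Vec)⟫ := by
  rw [← hr.rotate_vecOf h2 O, ← kr.rotate_vecOf k2 O, M_rotate, inner_rotate, rotate]
  congr 1
  rw [← toVec_coeFn (M (vecOf k2 Q') : Vec)]
  refine toVec_congr ?_
  have h1 := O.measurePreserving.quasiMeasurePreserving.ae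
    (coeFn_toVec (memLp_rotate O (M (vecOf k2 Q'))))
  rw [toVec_coeFn]
  filter_upwards [h1] with x hx
  simp only [LinearIsometryEquiv.symm_symm]
  change O.symm ((toVec fun x => O ((M (vecOf k2 Q') : Vec) (O.symm x)) : Vec) (O x)) = _
  rw [hx, LinearIsometryEquiv.symm_apply_apply, LinearIsometryEquiv.symm_apply_apply]

/-! ### The trace of the projection -/

theorem IsTest.isTest_lapl {φ : E3 → ℝ} (hφ : IsTest φ) : IsTest (lapl φ) := by
  have h0 : lapl φ = fun x => -(0 * φ x - lapl φ x) := by funext x; simp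
  rw [h0]
  exact ⟨(hφ.helm 0).1.neg, (hφ.helm 0).2.comp_left (g := fun t : ℝ => -t) neg_zero⟩

theorem lapl_fderiv {φ : E3 → ℝ} (hφ : IsTest φ) (i : Fin 3) (x : E3) :
    lapl (fun y => fderiv ℝ φ y (EuclideanSpace.single i 1)) x
      = fderiv ℝ (lapl φ) x (EuclideanSpace.single i 1) := by
  have h := congrArg (fun Φ : testField => (Φ : E3 → E3) x 0)
    (laplace_partialD i (ofTest hφ (EuclideanSpace.single 0 1)))
  have hl := hφ.isTest_lapl
  have h1 : laplace (ofTest hφ (EuclideanSpace.single 0 1))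
      = ofTest hl (EuclideanSpace.single 0 1) := Subtype.ext (funext fun y => laplace_ofTest hφ _ y)
  simp only [h1, partialD_ofTest, laplace_ofTest] at h
  simpa [ofTest] using h

theorem partialD_coord (Φ : testField) (i j : Fin 3) (x : E3) :
    (partialD i Φ : E3 → E3) x j
      = fderiv ℝ (fun y => (Φ : E3 → E3) y j) x (EuclideanSpace.single i 1) := by
  have h := (EuclideanSpace.proj (𝕜 := ℝ) j).hasFDerivAt.comp x (differentiable Φ x).hasFDerivAt
  exact (congrArg (fun L : E3 →L[ℝ] ℝ => L (EuclideanSpace.single i 1)) h.fderiv).symm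

/-- The divergence of Δ(φ eᵢ) - ∇∂ᵢφ is ∂ᵢΔφ - Δ∂ᵢφ = 0. These fields give access to M without its
Fourier symbol. -/
theorem laplace_sub_gradF_mem_solenoidal {φ : E3 → ℝ} (hφ : IsTest φ) (i : Fin 3) :
    toL2 (laplace (ofTest hφ (EuclideanSpace.single i 1))
      - gradF (hφ.fderiv_apply (EuclideanSpace.single i 1))) ∈ solenoidal := by
  set X := laplace (ofTest hφ (EuclideanSpace.single i 1))
      - gradF (hφ.fderiv_apply (EuclideanSpace.single i 1)) with hX
  rw [mem_solenoidal_iff]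
  intro ψ hψ
  rw [inner_gradF hψ fun j => ⟨_, testField.isWeakDeriv j X⟩, neg_eq_zero]
  refine integral_eq_zero_of_ae ?_
  have h : ∀ᵐ x, ∀ j, weakDeriv j (toL2 X) x = (partialD j X : E3 → E3) x :=
    ae_all_iff.2 fun j => by
      rw [weakDeriv_toL2]
      exact coeFn_toVec (memLp _)
  filter_upwards [h] with x hx
  simp only [divergence, hx]
  have e : ∀ j : Fin 3, (partialD j X : E3 → E3) x j
      = (if j = i then fderiv ℝ (lapl φ) x (EuclideanSpace.single j 1) else 0)
        - fderiv ℝ (fun y => fderiv ℝ (fun y => fderiv ℝ φ y (EuclideanSpace.single i 1)) y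
          (EuclideanSpace.single j 1)) x (EuclideanSpace.single j 1) := by
    intro j
    rw [hX, map_sub]
    change (partialD j (laplace (ofTest hφ _)) : E3 → E3) x j - (partialD j (gradF _) : E3 → E3) x j = _
    rw [partialD_coord, partialD_coord]
    simp_rw [gradF_apply, laplace_ofTest]
    congr 1
    split_ifs with hj
    · subst hj
      simp
    · simp [hj]
  simp_rw [e]
  rw [Finset.sum_sub_distrib, Finset.sum_ite_eq' Finset.univ i]
  simp only [Finset.mem_univ, if_true]
  rw [← lapl_fderiv hφ]
  simp [lapl]

theorem inner_toVec_single {f : E3 → ℝ} (hf : MemLp f 2 (volume : Measure E3)) (i : Fin 3)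
    (A : Vec) : ⟪toVec fun x => f x • (EuclideanSpace.single i 1 : E3), A⟫ = ∫ x, f x * A x i := by
  rw [inner_toVec (MemLp.smul_vec hf _)]
  refine integral_congr_ae (Eventually.of_forall fun x => ?_)
  simp [inner_smul_left, EuclideanSpace.inner_single_left]

/-- Split Δφ eᵢ into its solenoidal part and the gradient ∇∂ᵢφ. The gradient is orthogonal to the
range of M, and against the solenoidal part M acts as the identity. -/
theorem integral_lapl_mul_M {k : E3 → ℝ} (hk : MemLp k 2 (volume : Measure E3)) {φ : E3 → ℝ}
    (hφ : IsTest φ) (i : Fin 3) :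
    ∫ x, lapl φ x * (M (vecOf hk (EuclideanSpace.single i 1)) : Vec) x i
      = ∫ x, k x * (lapl φ x - fderiv ℝ (fun y => fderiv ℝ φ y (EuclideanSpace.single i 1)) x
          (EuclideanSpace.single i 1)) := by
  set X := laplace (ofTest hφ (EuclideanSpace.single i 1))
      - gradF (hφ.fderiv_apply (EuclideanSpace.single i 1)) with hX
  have h1 : toVec (fun x => lapl φ x • (EuclideanSpace.single i 1 : E3))
      = toL2 X + toL2 (gradF (hφ.fderiv_apply (EuclideanSpace.single i 1))) := by
    rw [← map_add, hX, sub_add_cancel]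
    change _ = toVec _
    congr 1
    funext x
    rw [laplace_ofTest]
  rw [← inner_toVec_single hφ.isTest_lapl.memLp, h1, inner_add_left,
    mem_solenoidal_iff.1 (M _).2, add_zero]
  have h2 := inner_M_right ⟨_, laplace_sub_gradF_mem_solenoidal hφ i⟩
    (vecOf hk (EuclideanSpace.single i 1))
  rw [Submodule.coe_inner] at h2
  rw [h2, real_inner_comm, vecOf_apply, inner_toVec_single hk]
  refine integral_congr_ae ?_
  filter_upwards [coeFn_toVec (memLp X)] with x hx
  change k x * (toVec (X : E3 → E3) : Vec) x i = _
  rw [hx]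
  change k x * ((laplace (ofTest hφ _) : E3 → E3) x i - (gradF _ : E3 → E3) x i) = _
  rw [laplace_ofTest, gradF_apply]
  simp

/-- Summed over i, Δφ - ∂ᵢ²φ gives 2Δφ. Hence the trace Σᵢ (M(k eᵢ))ᵢ - 2k is a square integrable
very weakly harmonic function and vanishes. -/
theorem sum_inner_vecOf_M_vecOf {h k : E3 → ℝ} (hh : MemLp h 2 (volume : Measure E3))
    (hk : MemLp k 2 (volume : Measure E3)) :
    ∑ i, ⟪vecOf hh (EuclideanSpace.single i 1), (M (vecOf hk (EuclideanSpace.single i 1)) : Vec)⟫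
      = 2 * ∫ x, h x * k x := by
  have hm : ∀ i : Fin 3, MemLp (fun x => (M (vecOf hk (EuclideanSpace.single i 1)) : Vec) x i) 2
      (volume : Measure E3) := fun i => memLp_coord _ i
  set f : E3 → ℝ := fun x => ∑ i, (M (vecOf hk (EuclideanSpace.single i 1)) : Vec) x i - 2 * k x
    with hf
  have hf2 : MemLp f 2 (volume : Measure E3) :=
    (memLp_finsetSum _ fun i _ => hm i).sub (hk.const_mul 2)
  have h0 : ∀ᵐ x, f x = 0 := by
    refine ae_eq_zero_of_veryWeak hf2 le_rfl fun φ hφ => ?_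
    have hl := hφ.isTest_lapl.memLp
    have e : ∀ x, f x * (0 * φ x - lapl φ x)
        = 2 * (k x * lapl φ x) - ∑ i, lapl φ x * (M (vecOf hk (EuclideanSpace.single i 1)) : Vec) x i := by
      intro x
      rw [hf, ← Finset.mul_sum]
      ring
    simp_rw [e]
    rw [integral_sub ((integrable_mul_of_memLp hk hl).const_mul 2)
      (integrable_finsetSum _ fun i _ => integrable_mul_of_memLp hl (hm i)),
      integral_finsetSum _ fun i _ => integrable_mul_of_memLp hl (hm i), integral_const_mul]
    simp_rw [integral_lapl_mul_M hk hφ]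
    rw [← integral_finsetSum, ← integral_const_mul, ← integral_sub, integral_eq_zero_of_ae]
    · refine Eventually.of_forall fun x => ?_
      simp only [← Finset.mul_sum, Finset.sum_sub_distrib, Pi.zero_apply]
      rw [show ∑ i : Fin 3, fderiv ℝ (fun y => fderiv ℝ φ y (EuclideanSpace.single i 1)) x
          (EuclideanSpace.single i 1) = lapl φ x from rfl]
      simp
      ring
    · exact (integrable_mul_of_memLp hk hl).const_mul 2
    · exact integrable_finsetSum _ fun i _ => integrable_mul_of_memLp hk
        (hl.sub ((hφ.fderiv_apply _).fderiv_apply _).memLp)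
    · exact fun i _ => integrable_mul_of_memLp hk
        (hl.sub ((hφ.fderiv_apply _).fderiv_apply _).memLp)
  simp_rw [vecOf_apply hh, inner_toVec_single hh]
  rw [← integral_finsetSum _ fun i _ => integrable_mul_of_memLp hh (hm i), ← integral_const_mul]
  refine integral_congr_ae ?_
  filter_upwards [h0] with x hx
  rw [← Finset.mul_sum, sub_eq_zero.1 hx]
  ring

/-- A rotation invariant bilinear form on `ℝ³` is a multiple of the inner product. -/
theorem bilin_eq_trace_mul_inner (T : E3 →ₗ[ℝ] E3 →ₗ[ℝ] ℝ)
    (inv : ∀ (O : E3 ≃ₗᵢ[ℝ] E3) (Q Q' : E3), T (O Q) (O Q') = T Q Q') (Q Q' : E3) :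
    T Q Q' = (∑ i, T (EuclideanSpace.single i 1) (EuclideanSpace.single i 1)) / 3 * ⟪Q, Q'⟫ := by
  have hoff : ∀ i j : Fin 3, i ≠ j →
      T (EuclideanSpace.single i 1) (EuclideanSpace.single j 1) = 0 := by
    intro i j hij
    -- The reflection eᵢ ↦ -eᵢ kills the off-diagonal entries; below, coordinate swaps make the
    -- diagonal ones equal.
    have h1 := inv ((ℝ ∙ (EuclideanSpace.single i 1 : E3))ᗮ.reflection) (EuclideanSpace.single i 1)
      (EuclideanSpace.single j 1)
    rw [Submodule.reflection_orthogonalComplement_singleton_eq_neg,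
      Submodule.reflection_mem_subspace_eq_self, map_neg, LinearMap.neg_apply] at h1
    · linarith
    · rw [Submodule.mem_orthogonal_singleton_iff_inner_right]
      simp [EuclideanSpace.inner_single_left, hij]
  have hdiag : ∀ i j : Fin 3, T (EuclideanSpace.single i 1) (EuclideanSpace.single i 1)
      = T (EuclideanSpace.single j 1) (EuclideanSpace.single j 1) := by
    intro i j
    have h1 := inv (LinearIsometryEquiv.piLpCongrLeft 2 ℝ ℝ (Equiv.swap i j))
      (EuclideanSpace.single i 1) (EuclideanSpace.single i 1)
    rw [EuclideanSpace.piLpCongrLeft_single, Equiv.swap_apply_left] at h1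
    exact h1.symm
  have hd : ∀ i : Fin 3, ∑ j : Fin 3, T (EuclideanSpace.single j 1) (EuclideanSpace.single j 1)
      = 3 * T (EuclideanSpace.single i 1) (EuclideanSpace.single i 1) := by
    intro i
    rw [Finset.sum_congr rfl fun j _ => hdiag j i, Finset.sum_const, Finset.card_univ,
      Fintype.card_fin, nsmul_eq_mul]
    norm_num
  have hQ : ∀ Q : E3, Q = ∑ i, Q i • (EuclideanSpace.single i 1 : E3) := fun Q => by
    ext j
    simp [Pi.single_apply]
  have hexp : T Q Q' = ∑ i, ∑ j, Q i * (Q' j * T (EuclideanSpace.single i 1)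
      (EuclideanSpace.single j 1)) := by
    conv_lhs => rw [hQ Q, hQ Q']
    simp only [map_sum, map_smul, LinearMap.sum_apply, LinearMap.smul_apply, smul_eq_mul,
      Finset.mul_sum]
    rw [Finset.sum_comm]
    refine Finset.sum_congr rfl fun i _ => Finset.sum_congr rfl fun j _ => ?_
    ring
  have hsum : ∀ i, ∑ j, Q i * (Q' j * T (EuclideanSpace.single i 1) (EuclideanSpace.single j 1))
      = Q i * Q' i * ((∑ i, T (EuclideanSpace.single i 1) (EuclideanSpace.single i 1)) / 3) := by
    intro i
    rw [Finset.sum_eq_single i, hd i]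
    · ring
    · intro j _ hj
      rw [hoff i j hj.symm]
      ring
    · simp
  rw [hexp]
  simp_rw [hsum]
  rw [← Finset.sum_mul, PiLp.inner_apply]
  simp only [RCLike.inner_apply, conj_trivial, mul_comm]

/-- The constant is the trace 2 divided by the dimension 3. -/
theorem inner_vecOf_M_vecOf {h k : E3 → ℝ} (hr : IsRadial h) (kr : IsRadial k)
    (h2 : MemLp h 2 (volume : Measure E3)) (k2 : MemLp k 2 (volume : Measure E3)) (Q Q' : E3) :
    ⟪vecOf h2 Q, (M (vecOf k2 Q') : Vec)⟫ = 2 / 3 * (∫ x, h x * k x) * ⟪Q, Q'⟫ := by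
  set T : E3 →ₗ[ℝ] E3 →ₗ[ℝ] ℝ := LinearMap.mk₂ ℝ
    (fun Q Q' => ⟪vecOf h2 Q, (M (vecOf k2 Q') : Vec)⟫)
    (fun _ _ _ => by simp only [map_add, inner_add_left])
    (fun _ _ _ => by simp only [map_smul, inner_smul_left, conj_trivial, smul_eq_mul])
    (fun _ _ _ => by simp only [map_add, Submodule.coe_add, inner_add_right])
    (fun _ _ _ => by simp only [map_smul, Submodule.coe_smul, inner_smul_right, smul_eq_mul])
    with hT
  have h1 := bilin_eq_trace_mul_inner T (inner_vecOf_M_vecOf_rotate hr kr h2 k2) Q Q'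
  simp only [hT, LinearMap.mk₂_apply, sum_inner_vecOf_M_vecOf] at h1
  rw [h1]
  ring

/-! ### Polar coordinates -/

/-- The surface measure of the unit sphere. -/
abbrev sphereMeas : Measure (Metric.sphere (0 : E3) 1) := (volume : Measure E3).toSphere

theorem measurePreserving_polar : MeasurePreserving
    (fun z : Set.Ioi (0 : ℝ) × Metric.sphere (0 : E3) 1 =>
      (((homeomorphUnitSphereProd E3).symm z.swap : ({0}ᶜ : Set E3)) : E3))
    ((Measure.volumeIoiPow 2).prod sphereMeas) volume := by
  have h1 := ((volume : Measure E3).measurePreserving_homeomorphUnitSphereProd).symm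
    (homeomorphUnitSphereProd E3).toMeasurableEquiv
  rw [finrank_euclideanSpace, Fintype.card_fin] at h1
  have h2 : MeasurePreserving (Subtype.val : ({0}ᶜ : Set E3) → E3)
      ((volume : Measure E3).comap (↑)) volume := by
    refine ⟨measurable_subtype_coe, ?_⟩
    rw [map_comap_subtype_coe (measurableSet_singleton _).compl, restrict_compl_singleton]
  exact (h2.comp h1).comp Measure.measurePreserving_swap

theorem measurableEmbedding_polar : MeasurableEmbedding
    (fun z : Set.Ioi (0 : ℝ) × Metric.sphere (0 : E3) 1 =>
      (((homeomorphUnitSphereProd E3).symm z.swap : ({0}ᶜ : Set E3)) : E3)) :=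
  ((MeasurableEmbedding.subtype_coe (measurableSet_singleton _).compl).comp
    (homeomorphUnitSphereProd E3).symm.measurableEmbedding).comp
      (MeasurableEquiv.prodComm (α := Set.Ioi (0 : ℝ)) (β := Metric.sphere (0 : E3) 1)).measurableEmbedding

/-- The density r² is positive on the half-line, so the radial measure and Lebesgue measure have the
same null sets there. -/
theorem ae_of_ae_volumeIoiPow {p : ℝ → Prop}
    (h : ∀ᵐ r : Set.Ioi (0 : ℝ) ∂Measure.volumeIoiPow 2, p r) :
    ∀ᵐ r : ℝ ∂(volume : Measure ℝ).restrict (Set.Ioi 0), p r := by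
  rw [Measure.volumeIoiPow, ae_withDensity_iff (by fun_prop)] at h
  rw [← map_comap_subtype_coe measurableSet_Ioi,
    (MeasurableEmbedding.subtype_coe measurableSet_Ioi).ae_map_iff]
  filter_upwards [h] with r hr
  refine hr ?_
  rw [Ne, ENNReal.ofReal_eq_zero, not_le]
  exact pow_pos r.2 _

theorem ae_sphere_of_ae {p : E3 → Prop} (h : ∀ᵐ x, p x) :
    ∀ᵐ r : ℝ ∂(volume : Measure ℝ).restrict (Set.Ioi 0), ∀ᵐ w : Metric.sphere (0 : E3) 1 ∂sphereMeas, p (r • (w : E3)) := by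
  refine ae_of_ae_volumeIoiPow ?_
  exact Measure.ae_ae_of_ae_prod (measurePreserving_polar.quasiMeasurePreserving.ae h)

theorem integrable_polar {F : E3 → E3} (hF : Integrable F) :
    Integrable (fun z : Set.Ioi (0 : ℝ) × Metric.sphere (0 : E3) 1 => F ((z.1 : ℝ) • (z.2 : E3)))
      ((Measure.volumeIoiPow 2).prod sphereMeas) :=
  measurePreserving_polar.integrable_comp_of_integrable hF

theorem ae_integrable_sphere {F : E3 → E3} (hF : Integrable F) :
    ∀ᵐ r : ℝ ∂(volume : Measure ℝ).restrict (Set.Ioi 0),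
      Integrable (fun w : Metric.sphere (0 : E3) 1 => F (r • (w : E3))) sphereMeas :=
  ae_of_ae_volumeIoiPow (integrable_polar hF).prod_right_ae

theorem integrableOn_sphereMean {F : E3 → E3} (hF : Integrable F) :
    IntegrableOn (fun r : ℝ => r ^ 2 • sphereMean F r) (Set.Ioi 0) := by
  have h := (integrable_polar hF).integral_prod_left
  rw [integrableOn_iff_comap_subtypeVal measurableSet_Ioi]
  rw [Measure.volumeIoiPow, integrable_withDensity_iff_integrable_smul' (by fun_prop)
    (by simp)] at h
  refine (h.smul (1 / (4 * Real.pi))).congr (Eventually.of_forall fun r => ?_)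
  have hr : 0 ≤ (r : ℝ) ^ 2 := sq_nonneg _
  simp only [Function.comp, sphereMean, Pi.smul_apply, ENNReal.toReal_ofReal hr]
  rw [smul_comm]

theorem integral_eq_integral_sphereMean {F : E3 → E3} (hF : Integrable F) :
    ∫ x, F x = (4 * Real.pi) • ∫ r in Set.Ioi (0 : ℝ), r ^ 2 • sphereMean F r := by
  rw [← measurePreserving_polar.integral_comp measurableEmbedding_polar F]
  change ∫ z : Set.Ioi (0 : ℝ) × Metric.sphere (0 : E3) 1, F ((z.1 : ℝ) • (z.2 : E3)) ∂_ = _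
  rw [integral_prod _ (integrable_polar hF), Measure.volumeIoiPow]
  simp only [ENNReal.ofReal]
  rw [integral_withDensity_eq_integral_smul (by fun_prop), ← integral_subtype_comap measurableSet_Ioi,
    ← integral_smul]
  refine integral_congr_ae (Eventually.of_forall fun r => ?_)
  have hr : 0 ≤ (r : ℝ) ^ 2 := sq_nonneg _
  simp only [NNReal.smul_def, Real.coe_toNNReal _ hr, sphereMean]
  rw [smul_comm, smul_smul (4 * Real.pi), mul_one_div_cancel (by positivity), one_smul]

theorem sphereMean_ae_congr {F G : E3 → E3} (h : F =ᵐ[volume] G) :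
    ∀ᵐ r : ℝ ∂(volume : Measure ℝ).restrict (Set.Ioi 0), sphereMean F r = sphereMean G r := by
  filter_upwards [ae_sphere_of_ae h] with r hr
  rw [sphereMean, sphereMean, integral_congr_ae hr]

theorem norm_smul_sphere {r : ℝ} (hr : 0 ≤ r) (w : Metric.sphere (0 : E3) 1) :
    ‖r • (w : E3)‖ = r := by
  rw [norm_smul, norm_eq_of_mem_sphere, mul_one, Real.norm_of_nonneg hr]

theorem sphereMean_radial_smul {h : ℝ → ℝ} {F : E3 → E3} {r : ℝ} (hr : 0 ≤ r) :
    sphereMean (fun x => h ‖x‖ • F x) r = h r • sphereMean F r := by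
  simp only [sphereMean, norm_smul_sphere hr]
  rw [integral_smul, smul_comm]

theorem sphereMeas_real_univ : sphereMeas.real Set.univ = 4 * Real.pi := by
  rw [Measure.toSphere_real_apply_univ, finrank_euclideanSpace, Fintype.card_fin, measureReal_def,
    EuclideanSpace.volume_ball_fin_three]
  simp
  rw [ENNReal.toReal_ofReal (by positivity)]
  ring

theorem sphereMean_const (Q : E3) (r : ℝ) : sphereMean (fun _ => Q) r = Q := by
  rw [sphereMean, integral_const, sphereMeas_real_univ, smul_smul,
    one_div_mul_cancel (by positivity), one_smul]

/-- A field which is orthogonal to all radial fields has vanishing spherical means. -/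
theorem sphereMean_eq_zero {F : E3 → E3} (hF : ∀ R : ℝ, IntegrableOn F (Metric.ball 0 R))
    (h : ∀ R : ℝ, ∀ s : Set ℝ, MeasurableSet s →
      ∫ x, (s ∩ Set.Iio R).indicator (fun _ => (1 : ℝ)) ‖x‖ • F x = 0) :
    ∀ᵐ r : ℝ ∂(volume : Measure ℝ).restrict (Set.Ioi 0), sphereMean F r = 0 := by
  -- Cutting off at radius n makes the polar integrals converge.
  have key : ∀ n : ℕ, ∀ᵐ r : ℝ ∂(volume : Measure ℝ).restrict (Set.Ioi 0),
      (r < n → sphereMean F r = 0) := by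
    intro n
    have e : ∀ s : Set ℝ, (fun x => (s ∩ Set.Iio (n : ℝ)).indicator (fun _ => (1 : ℝ)) ‖x‖ • F x)
        = ((fun x : E3 => ‖x‖) ⁻¹' s).indicator ((Metric.ball 0 (n : ℝ)).indicator F) := by
      intro s
      funext x
      by_cases h1 : ‖x‖ ∈ s <;> by_cases h2 : ‖x‖ < n <;> simp [Set.indicator, h1, h2]
    have hi : ∀ s : Set ℝ, MeasurableSet s →
        Integrable (fun x => (s ∩ Set.Iio (n : ℝ)).indicator (fun _ => (1 : ℝ)) ‖x‖ • F x) := by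
      intro s hs
      rw [e]
      exact ((hF n).integrable_indicator Metric.isOpen_ball.measurableSet).indicator
        (measurable_norm hs)
    have h0 := Integrable.ae_eq_zero_of_forall_setIntegral_eq_zero
      (integrableOn_sphereMean (hi Set.univ MeasurableSet.univ)) ?_
    · filter_upwards [h0, ae_restrict_mem measurableSet_Ioi] with r hr hr0 hrn
      have hr0' : (0 : ℝ) < r := hr0
      rw [sphereMean_radial_smul hr0'.le] at hr
      simpa [hrn, hr0'.ne'] using hr
    -- Testing on the radial indicator of s gives ∫_s r² · (spherical mean) dr = 0 for every
    -- measurable s, which determines the mean almost everywhere.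
    · intro s hs _
      have h1 := integral_eq_integral_sphereMean (hi s hs)
      rw [h _ s hs, eq_comm, smul_eq_zero] at h1
      have h2 := h1.resolve_left (by positivity)
      rw [← integral_indicator hs, ← h2]
      refine setIntegral_congr_fun measurableSet_Ioi fun r hr => ?_
      have hr' : (0 : ℝ) ≤ r := le_of_lt hr
      change s.indicator (fun r : ℝ => r ^ 2 • sphereMean _ r) r = r ^ 2 • sphereMean _ r
      rw [sphereMean_radial_smul (h := (s ∩ Set.Iio (n : ℝ)).indicator fun _ => (1 : ℝ)) hr']
      by_cases h3 : r ∈ s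
      · rw [Set.indicator_of_mem h3,
          sphereMean_radial_smul (h := (Set.univ ∩ Set.Iio (n : ℝ)).indicator fun _ => (1 : ℝ)) hr']
        congr 2
        simp [Set.indicator, h3]
      · simp [h3]
  filter_upwards [ae_all_iff.2 key] with r hr
  obtain ⟨n, hn⟩ := exists_nat_gt r
  exact hr n hn

theorem continuous_sphere_comp {F : E3 → E3} (hF : Continuous F) (r : ℝ) :
    Integrable (fun w : Metric.sphere (0 : E3) 1 => F (r • (w : E3))) sphereMeas :=
  (by fun_prop : Continuous fun w : Metric.sphere (0 : E3) 1 =>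
    F (r • (w : E3))).integrable_of_hasCompactSupport (HasCompactSupport.of_compactSpace _)

theorem integral_Ioi_indicator_pow :
    ∫ r in Set.Ioi (0 : ℝ), r ^ 2 * ((Set.Iio (1 : ℝ)).indicator (fun _ => (1 : ℝ)) r * r ^ 2)
      = 1 / 5 := by
  have e : ∀ r : ℝ, r ^ 2 * ((Set.Iio (1 : ℝ)).indicator (fun _ => (1 : ℝ)) r * r ^ 2)
      = (Set.Iio (1 : ℝ)).indicator (fun r => r ^ 4) r := by
    intro r
    by_cases h : r < 1
    · simp [Set.indicator, h]; ring
    · simp [Set.indicator, h]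
  simp_rw [e]
  rw [setIntegral_indicator measurableSet_Iio, Set.Ioi_inter_Iio, ← integral_Ioc_eq_integral_Ioo,
    ← intervalIntegral.integral_of_le zero_le_one, integral_pow]
  norm_num

theorem integrable_indicator_ball {F : E3 → E3} (hF : Continuous F) :
    Integrable fun x => (Set.Iio (1 : ℝ)).indicator (fun _ => (1 : ℝ)) ‖x‖ • F x := by
  have h := (hF.continuousOn.integrableOn_compact (μ := volume) (isCompact_closedBall (0 : E3) 1)).mono_set
    Metric.ball_subset_closedBall
  refine (h.integrable_indicator Metric.isOpen_ball.measurableSet).congr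
    (Eventually.of_forall fun x => ?_)
  by_cases h1 : ‖x‖ < 1 <;> simp [Set.indicator, h1]

theorem inner_integral_sphere (Q Q' : E3) :
    ⟪∫ w : Metric.sphere (0 : E3) 1, ⟪(w : E3), Q⟫ • (w : E3) ∂sphereMeas, Q'⟫
      = ∫ w : Metric.sphere (0 : E3) 1, ⟪(w : E3), Q⟫ * ⟪(w : E3), Q'⟫ ∂sphereMeas := by
  have hi := continuous_sphere_comp (F := fun x => ⟪x, Q⟫ • x) (by fun_prop) 1
  simp only [one_smul] at hi
  rw [real_inner_comm, ← integral_inner hi]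
  simp only [inner_smul_right, real_inner_comm]

/-- The form on the sphere is recovered from an integral over the ball, where rotation invariance is
that of Lebesgue measure. The factor is ∫₀¹ r⁴ dr = 1/5. -/
theorem integral_ball_eq_sphere (Q Q' : E3) :
    ∫ x : E3, (Set.Iio (1 : ℝ)).indicator (fun _ => (1 : ℝ)) ‖x‖ * (⟪x, Q⟫ * ⟪x, Q'⟫)
      = 1 / 5 * ∫ w : Metric.sphere (0 : E3) 1, ⟪(w : E3), Q⟫ * ⟪(w : E3), Q'⟫ ∂sphereMeas := by
  have hc : Continuous fun x : E3 => ⟪x, Q⟫ • x := by fun_prop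
  have hi := integrable_indicator_ball hc
  have h1 := integral_eq_integral_sphereMean hi
  have h2 : ∫ r in Set.Ioi (0 : ℝ), r ^ 2 • sphereMean
      (fun x => (Set.Iio (1 : ℝ)).indicator (fun _ => (1 : ℝ)) ‖x‖ • (⟪x, Q⟫ • x)) r
      = (1 / 5 : ℝ) • sphereMean (fun x => ⟪x, Q⟫ • x) 1 := by
    rw [← integral_Ioi_indicator_pow, ← integral_smul_const]
    refine setIntegral_congr_fun measurableSet_Ioi fun r hr => ?_
    have hr' : (0 : ℝ) ≤ r := le_of_lt hr
    rw [sphereMean_radial_smul hr', mul_smul, mul_smul]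
    congr 2
    simp only [sphereMean, inner_smul_left, conj_trivial, one_smul]
    rw [smul_comm (r ^ 2), ← integral_smul (r ^ 2)]
    congr 2
    funext w
    rw [smul_smul, smul_smul]
    congr 1
    ring
  rw [h2] at h1
  have h3 := congrArg (fun v => ⟪v, Q'⟫) h1
  simp only [sphereMean, one_smul] at h3
  rw [real_inner_comm, ← integral_inner hi, smul_comm (1 / 5 : ℝ), smul_smul,
    mul_one_div_cancel (by positivity), one_smul, inner_smul_left, inner_integral_sphere,
    conj_trivial] at h3
  rw [← h3]
  refine integral_congr_ae (Eventually.of_forall fun x => ?_)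
  simp only [inner_smul_right, real_inner_comm]

/-- A rotation invariant form is determined by its trace, which is the area 4π because |w| = 1 on
the sphere. -/
theorem integral_inner_smul_sphere (Q : E3) :
    ∫ w : Metric.sphere (0 : E3) 1, ⟪(w : E3), Q⟫ • (w : E3) ∂sphereMeas
      = (4 * Real.pi / 3) • Q := by
  have hint : ∀ Q Q' : E3, Integrable
      (fun w : Metric.sphere (0 : E3) 1 => ⟪(w : E3), Q⟫ * ⟪(w : E3), Q'⟫) sphereMeas :=
    fun Q Q' => (by fun_prop : Continuous
      fun w : Metric.sphere (0 : E3) 1 => ⟪(w : E3), Q⟫ * ⟪(w : E3), Q'⟫).integrable_of_hasCompactSupport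
        (HasCompactSupport.of_compactSpace _)
  set T : E3 →ₗ[ℝ] E3 →ₗ[ℝ] ℝ := LinearMap.mk₂ ℝ
    (fun Q Q' => ∫ w : Metric.sphere (0 : E3) 1, ⟪(w : E3), Q⟫ * ⟪(w : E3), Q'⟫ ∂sphereMeas)
    (fun Q₁ Q₂ Q' => by
      rw [← integral_add (hint _ _) (hint _ _)]
      simp only [inner_add_right, add_mul])
    (fun a Q Q' => by
      rw [smul_eq_mul, ← integral_const_mul]
      simp only [inner_smul_right, mul_assoc])
    (fun Q Q₁ Q₂ => by
      rw [← integral_add (hint _ _) (hint _ _)]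
      simp only [inner_add_right, mul_add])
    (fun a Q Q' => by
      rw [smul_eq_mul, ← integral_const_mul]
      simp only [inner_smul_right, mul_left_comm]) with hT
  refine ext_inner_right ℝ fun Q' => ?_
  rw [inner_integral_sphere]
  change T Q Q' = _
  rw [bilin_eq_trace_mul_inner T, inner_smul_left]
  · congr 1
    have h1 : ∀ w : Metric.sphere (0 : E3) 1, ∑ i : Fin 3,
        ⟪(w : E3), EuclideanSpace.single i 1⟫ * ⟪(w : E3), EuclideanSpace.single i 1⟫ = 1 := by
      intro w
      have := EuclideanSpace.norm_sq_eq (w : E3)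
      rw [norm_eq_of_mem_sphere] at this
      simp only [EuclideanSpace.inner_single_right, conj_trivial, one_mul]
      simpa [← sq] using this.symm
    simp only [hT, LinearMap.mk₂_apply]
    rw [← integral_finsetSum _ fun i _ => hint _ _]
    simp_rw [h1]
    rw [integral_const, sphereMeas_real_univ]
    simp
  · intro O Q Q'
    have h5 := integral_ball_eq_sphere
    have h6 : ∫ x : E3, (Set.Iio (1 : ℝ)).indicator (fun _ => (1 : ℝ)) ‖x‖ * (⟪x, O Q⟫ * ⟪x, O Q'⟫)
        = ∫ x : E3, (Set.Iio (1 : ℝ)).indicator (fun _ => (1 : ℝ)) ‖x‖ * (⟪x, Q⟫ * ⟪x, Q'⟫) := by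
      rw [← O.measurePreserving.integral_comp O.toHomeomorph.measurableEmbedding]
      simp only [LinearIsometryEquiv.norm_map, LinearIsometryEquiv.inner_map_map]
    rw [h5, h5] at h6
    change ∫ w : Metric.sphere (0 : E3) 1, _ ∂sphereMeas = ∫ w : Metric.sphere (0 : E3) 1, _ ∂sphereMeas
    linarith

/-- The mean of w (w·Q) is Q/3, so the constant is (1 + 1/3) / (8πr) = 1 / (6πr). -/
theorem sphereMean_MG0 (Q : E3) {r : ℝ} (hr : 0 < r) :
    sphereMean (MG0 Q) r = (1 / (6 * Real.pi * r)) • Q := by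
  have h1 : ∀ w : Metric.sphere (0 : E3) 1, MG0 Q (r • (w : E3))
      = (1 / (8 * Real.pi * r)) • (Q + ⟪(w : E3), Q⟫ • (w : E3)) := by
    intro w
    rw [MG0, norm_smul_sphere hr.le, inner_smul_left, smul_smul, conj_trivial]
    congr 3
    field_simp
  have hi := continuous_sphere_comp (F := fun x => ⟪x, Q⟫ • x) (by fun_prop) 1
  simp only [one_smul] at hi
  simp only [sphereMean, h1]
  rw [integral_smul, integral_add (integrable_const _) hi, integral_const, sphereMeas_real_univ,
    integral_inner_smul_sphere, ← add_smul, smul_smul, smul_smul]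
  congr 1
  field_simp
  ring

theorem integrable_sphere_MG0 (Q : E3) {r : ℝ} (hr : 0 < r) :
    Integrable (fun w : Metric.sphere (0 : E3) 1 => MG0 Q (r • (w : E3))) sphereMeas := by
  have h1 : ∀ w : Metric.sphere (0 : E3) 1, MG0 Q (r • (w : E3))
      = (1 / (8 * Real.pi * r)) • (Q + ⟪(w : E3), Q⟫ • (w : E3)) := by
    intro w
    rw [MG0, norm_smul_sphere hr.le, inner_smul_left, smul_smul, conj_trivial]
    congr 3
    field_simp
  simp_rw [h1]
  have hi := continuous_sphere_comp (F := fun x => ⟪x, Q⟫ • x) (by fun_prop) 1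
  simp only [one_smul] at hi
  exact ((integrable_const Q).add hi).smul (1 / (8 * Real.pi * r))

theorem tendsto_sphereMean {F : E3 → E3} (hF : Continuous F) :
    Tendsto (sphereMean F) (𝓝[>] 0) (𝓝 (F 0)) := by
  rw [Metric.tendsto_nhds]
  intro ε hε
  obtain ⟨δ, hδ, h⟩ := Metric.continuousAt_iff.1 (hF.continuousAt (x := 0)) (ε / 2) (by positivity)
  filter_upwards [Ioo_mem_nhdsGT hδ] with r hr
  have h1 : sphereMean F r - F 0 = sphereMean (fun x => F x - F 0) r := by
    conv_lhs => rw [← sphereMean_const (F 0) r]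
    rw [sphereMean, sphereMean, sphereMean, ← smul_sub,
      ← integral_sub (continuous_sphere_comp hF r) (integrable_const _)]
  rw [dist_eq_norm, h1, sphereMean, norm_smul, Real.norm_of_nonneg (by positivity)]
  have h2 := norm_integral_le_of_norm_le_const (μ := sphereMeas) (C := ε / 2)
    (f := fun w : Metric.sphere (0 : E3) 1 => F (r • (w : E3)) - F 0)
    (Eventually.of_forall fun w => by
      rw [← dist_eq_norm]
      refine (h ?_).le
      rw [dist_zero_right, norm_smul_sphere hr.1.le]
      exact hr.2)
  rw [sphereMeas_real_univ] at h2
  calc _ ≤ 1 / (4 * Real.pi) * (ε / 2 * (4 * Real.pi)) := by gcongr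
    _ = ε / 2 := by field_simp
    _ < ε := by linarith

/-- The radial profile of the Green function. -/
theorem green_smul_sphere (z : ℝ) {r : ℝ} (hr : 0 ≤ r) (w : Metric.sphere (0 : E3) 1) :
    green z (r • (w : E3)) = Real.exp (-(√z * r)) / (4 * Real.pi * r) := by
  rw [green, norm_smul_sphere hr]

theorem isRadial_green (z : ℝ) : IsRadial (green z) := fun x y h => by rw [green, green, h]

theorem integrableOn_ball_of_memLp {F : E3 → E3} (hF : MemLp F 2 (volume : Measure E3)) (R : ℝ) :
    IntegrableOn F (Metric.ball 0 R) :=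
  (hF.locallyIntegrable (by norm_num)).integrableOn_isCompact (isCompact_closedBall 0 R)
    |>.mono_set Metric.ball_subset_closedBall

/-- M Q G_z and (2/3) G_z Q have the same integrals against all bounded radial cut-offs by
`inner_vecOf_M_vecOf`, hence the same spherical means for almost every radius. -/
theorem sphereMean_MG {z : ℝ} (hz : 0 < z) (Q : E3) :
    ∀ᵐ r : ℝ ∂(volume : Measure ℝ).restrict (Set.Ioi 0),
      Integrable (fun w : Metric.sphere (0 : E3) 1 => (MG z Q : Vec) (r • (w : E3))) sphereMeas ∧
      sphereMean (MG z Q : Vec) r = (2 / 3 * (Real.exp (-(√z * r)) / (4 * Real.pi * r))) • Q := by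
  have hg := memLp_green_scalar hz
  have hint : ∀ᵐ r : ℝ ∂(volume : Measure ℝ).restrict (Set.Ioi 0),
      Integrable (fun w : Metric.sphere (0 : E3) 1 => (MG z Q : Vec) (r • (w : E3))) sphereMeas := by
    have h1 : ∀ n : ℕ, ∀ᵐ r : ℝ ∂(volume : Measure ℝ).restrict (Set.Ioi 0), r < n →
        Integrable (fun w : Metric.sphere (0 : E3) 1 => (MG z Q : Vec) (r • (w : E3))) sphereMeas := by
      intro n
      have h2 := (integrableOn_ball_of_memLp (Lp.memLp (MG z Q : Vec)) n).integrable_indicator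
        Metric.isOpen_ball.measurableSet
      filter_upwards [ae_integrable_sphere h2, ae_restrict_mem measurableSet_Ioi] with r hr hr0 hrn
      refine hr.congr (Eventually.of_forall fun w => Set.indicator_of_mem ?_ _)
      rw [mem_ball_zero_iff, norm_smul_sphere (le_of_lt hr0)]
      exact hrn
    filter_upwards [ae_all_iff.2 h1] with r hr
    obtain ⟨n, hn⟩ := exists_nat_gt r
    exact hr n hn
  set F : E3 → E3 := fun x => (MG z Q : Vec) x - (2 / 3 * green z x) • Q with hF
  have hF2 : MemLp F 2 (volume : Measure E3) :=
    (Lp.memLp _).sub (MemLp.smul_vec (hg.const_mul (2 / 3)) Q)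
  have h0 : ∀ᵐ r : ℝ ∂(volume : Measure ℝ).restrict (Set.Ioi 0), sphereMean F r = 0 := by
    refine sphereMean_eq_zero (integrableOn_ball_of_memLp hF2) fun R s hs => ?_
    set h : E3 → ℝ := fun x => (s ∩ Set.Iio R).indicator (fun _ => (1 : ℝ)) ‖x‖ with hh
    have hm : MeasurableSet ((fun x : E3 => ‖x‖) ⁻¹' (s ∩ Set.Iio R)) :=
      measurable_norm (hs.inter measurableSet_Iio)
    have h2 : MemLp h 2 (volume : Measure E3) := by
      have he : h = ((fun x : E3 => ‖x‖) ⁻¹' (s ∩ Set.Iio R)).indicator fun _ => (1 : ℝ) := rfl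
      rw [he]
      refine memLp_indicator_const 2 hm 1 (Or.inr (ne_of_lt (lt_of_le_of_lt (measure_mono ?_)
        (measure_ball_lt_top (x := (0 : E3)) (r := R)))))
      intro x hx
      rw [mem_ball_zero_iff]
      exact hx.2
    have hr : IsRadial h := fun x y hxy => by simp only [hh, hxy]
    refine ext_inner_left ℝ fun Q' => ?_
    have h3 := inner_vecOf_M_vecOf hr (isRadial_green z) h2 hg Q' Q
    rw [vecOf_apply, inner_toVec_smul h2] at h3
    change ⟪Q', ∫ x, h x • F x⟫ = _
    simp only [hF, smul_sub]
    rw [integral_sub (integrable_smul_vec h2 _), inner_sub_right]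
    · have h4 : ∫ x, h x • (2 / 3 * green z x) • Q = (2 / 3 * ∫ x, h x * green z x) • Q := by
        rw [← integral_const_mul, ← integral_smul_const]
        refine integral_congr_ae (Eventually.of_forall fun x => ?_)
        simp only [smul_smul]
        congr 1
        ring
      rw [h4, inner_smul_right, inner_zero_right, sub_eq_zero]
      exact h3
    · have h5 := ((integrable_mul_of_memLp h2 hg).const_mul (2 / 3)).smul_const Q
      refine h5.congr (Eventually.of_forall fun x => ?_)
      simp only [smul_smul]
      congr 1
      ring
  filter_upwards [h0, hint, ae_restrict_mem measurableSet_Ioi] with r hr hr1 hr2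
  refine ⟨hr1, ?_⟩
  have hr0 : (0 : ℝ) ≤ r := le_of_lt hr2
  simp only [sphereMean, hF, green_smul_sphere z hr0] at hr
  rw [integral_sub hr1 (integrable_const _), integral_const, sphereMeas_real_univ, smul_sub,
    smul_smul (1 / (4 * Real.pi)), one_div_mul_cancel (by positivity), one_smul, sub_eq_zero] at hr
  exact hr

/-! ### The boundary condition at the origin -/

theorem tendsto_exp_sub_one_div (κ : ℝ) :
    Tendsto (fun r : ℝ => (Real.exp (-(κ * r)) - 1) / r) (𝓝[>] 0) (𝓝 (-κ)) := by
  have h : HasDerivAt (fun r : ℝ => Real.exp (-(κ * r))) (-κ) 0 := by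
    have h1 := ((hasDerivAt_id (0 : ℝ)).const_mul κ).neg.exp
    simpa using h1
  have h2 := h.tendsto_slope.mono_left (nhdsWithin_mono 0 fun r (hr : 0 < r) => hr.ne')
  refine h2.congr fun r => ?_
  simp [slope_def_field]

/-- Every interval (0, u) has positive measure. This makes the essential limit in `BoundaryCond`
unique. -/
instance neBot_nhdsGT_inf_ae : (𝓝[>] (0 : ℝ) ⊓ ae (volume : Measure ℝ)).NeBot := by
  rw [inf_neBot_iff]
  intro s hs t ht
  obtain ⟨u, hu, hus⟩ := mem_nhdsGT_iff_exists_Ioo_subset.1 hs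
  by_contra hne
  have h1 : Set.Ioo 0 u ⊆ tᶜ := fun x hx hxt => hne ⟨x, hus hx, hxt⟩
  have h2 : volume (Set.Ioo 0 u) = 0 := measure_mono_null h1 (mem_ae_iff.1 ht)
  rw [Real.volume_Ioo, ENNReal.ofReal_eq_zero] at h2
  have : (0 : ℝ) < u := hu
  linarith

/-- The boundary condition in terms of the value at the origin of the regular part. -/
theorem boundaryCond_iff {c e m lam : ℝ} (hc : c ≠ 0) (he : e ≠ 0) (hlam : 0 < lam) {A : L2s}
    {f : Vec} {Q : E3} (hA : (regPart c e lam A Q : Vec) = resolvent lam f) :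
    BoundaryCond c e m A Q ↔
      potential lam f 0 = ((4 * Real.pi * e / c) * Gam c e m lam) • Q := by
  set κ := 4 * Real.pi * e / c with hκ
  -- The singularities (2/3) e^{-√λ r} / (4πr) of M Q G_λ and 1 / (6πr) of M Q G_0 cancel up to a
  -- difference quotient at 0 of the exponential, which tends to -√λ.
  have hae : ∀ᵐ r : ℝ ∂(volume : Measure ℝ).restrict (Set.Ioi 0),
      sphereMean (fun x => (A : Vec) x - κ • MG0 Q x) r = sphereMean (potential lam f) r
        + (κ * (1 / (6 * Real.pi)) * ((Real.exp (-(√lam * r)) - 1) / r)) • Q := by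
    have h1 : (fun x => (A : Vec) x - κ • MG0 Q x) =ᵐ[volume]
        fun x => potential lam f x + (κ • (MG lam Q : Vec) x - κ • MG0 Q x) := by
      have h2 : (A : Vec) = resolvent lam f + κ • (MG lam Q : Vec) := by
        rw [← hA, regPart, Submodule.coe_sub, Submodule.coe_smul, sub_add_cancel]
      rw [h2]
      filter_upwards [Lp.coeFn_add (resolvent lam f) (κ • (MG lam Q : Vec)),
        Lp.coeFn_smul κ (MG lam Q : Vec), coeFn_resolvent hlam f] with x hx1 hx2 hx3
      rw [hx1, Pi.add_apply, hx2, hx3, Pi.smul_apply, add_sub_assoc]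
    filter_upwards [sphereMean_ae_congr h1, sphereMean_MG hlam Q, ae_restrict_mem measurableSet_Ioi]
      with r hr1 hr2 hr3
    have hr0 : (0 : ℝ) < r := hr3
    have i1 := continuous_sphere_comp (continuous_potential hlam f) r
    have i2 := hr2.1
    have i3 := integrable_sphere_MG0 Q hr0
    have i4 : Integrable (fun w : Metric.sphere (0 : E3) 1 => κ • (MG lam Q : Vec) (r • (w : E3)))
      sphereMeas := i2.smul κ
    have i5 : Integrable (fun w : Metric.sphere (0 : E3) 1 => κ • MG0 Q (r • (w : E3)))
      sphereMeas := i3.smul κ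
    have i6 : Integrable (fun w : Metric.sphere (0 : E3) 1 =>
      κ • (MG lam Q : Vec) (r • (w : E3)) - κ • MG0 Q (r • (w : E3))) sphereMeas := i4.sub i5
    rw [hr1, sphereMean, integral_add i1 i6, integral_sub i4 i5, integral_smul, integral_smul, smul_add, smul_sub,
      smul_comm _ κ, smul_comm _ κ]
    change sphereMean _ r + (κ • sphereMean _ r - κ • sphereMean _ r) = _
    rw [hr2.2, sphereMean_MG0 Q hr0, ← smul_sub, ← sub_smul, smul_smul]
    congr 2
    field_simp
    ring
  have hlim : Tendsto (fun r => sphereMean (potential lam f) r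
        + (κ * (1 / (6 * Real.pi)) * ((Real.exp (-(√lam * r)) - 1) / r)) • Q) (𝓝[>] 0)
      (𝓝 (potential lam f 0 + (κ * (1 / (6 * Real.pi)) * (-√lam)) • Q)) :=
    (tendsto_sphereMean (continuous_potential hlam f)).add
      (((tendsto_exp_sub_one_div _).const_mul _).smul_const Q)
  have hev : ∀ᶠ r in 𝓝[>] (0 : ℝ) ⊓ ae (volume : Measure ℝ),
      sphereMean (potential lam f) r
        + (κ * (1 / (6 * Real.pi)) * ((Real.exp (-(√lam * r)) - 1) / r)) • Q
      = sphereMean (fun x => (A : Vec) x - κ • MG0 Q x) r := by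
    rw [ae_restrict_iff' measurableSet_Ioi] at hae
    have h1 : ∀ᶠ r in 𝓝[>] (0 : ℝ) ⊓ ae (volume : Measure ℝ), r ∈ Set.Ioi (0 : ℝ) :=
      Filter.Eventually.filter_mono inf_le_left self_mem_nhdsWithin
    filter_upwards [h1, Filter.Eventually.filter_mono inf_le_right hae] with r hr1 hr2
    exact (hr2 hr1).symm
  have hT := (hlim.mono_left (inf_le_left (b := ae (volume : Measure ℝ)))).congr' hev
  -- The √λ term of Γ_m is exactly the one left over from the difference quotient.
  have hval : -(m * c / e) = κ * Gam c e m lam - κ * (1 / (6 * Real.pi)) * √lam := by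
    rw [hκ, Gam]
    field_simp
    ring
  unfold BoundaryCond
  constructor
  · intro h
    have h1 := tendsto_nhds_unique hT h
    rw [hval, sub_smul, eq_sub_iff_add_eq] at h1
    rw [← h1, add_assoc, ← add_smul]
    simp
  · intro h
    convert hT using 2
    rw [h, hval, ← add_smul]
    congr 1
    ring

/-! ### The charge distributions -/

/-- The solenoidal part of the field `h Q`. -/
def solOf {h : E3 → ℝ} (hh : MemLp h 2 (volume : Measure E3)) : E3 →L[ℝ] L2s :=
  LinearMap.toContinuousLinearMap ((M : Vec →ₗ[ℝ] L2s) ∘ₗ vecOf hh)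

theorem solOf_apply {h : E3 → ℝ} (hh : MemLp h 2 (volume : Measure E3)) (Q : E3) :
    solOf hh Q = M (vecOf hh Q) := rfl

theorem inner_solOf {h : E3 → ℝ} (hh : MemLp h 2 (volume : Measure E3)) (Q : E3) (A : L2s) :
    ⟪solOf hh Q, A⟫ = ⟪Q, pair h A⟫ := by
  rw [solOf_apply, inner_M, vecOf_apply, inner_toVec_smul hh, pair]

theorem adjoint_solOf {h : E3 → ℝ} (hh : MemLp h 2 (volume : Measure E3)) (A : L2s) :
    (solOf hh).adjoint A = pair h A :=
  ext_inner_left ℝ fun Q => by rw [ContinuousLinearMap.adjoint_inner_right, inner_solOf]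

theorem inner_solOf_solOf {h k : E3 → ℝ} (hr : IsRadial h) (kr : IsRadial k)
    (hh : MemLp h 2 (volume : Measure E3)) (hk : MemLp k 2 (volume : Measure E3)) (Q Q' : E3) :
    ⟪solOf hh Q, solOf hk Q'⟫ = 2 / 3 * (∫ x, h x * k x) * ⟪Q, Q'⟫ := by
  rw [solOf_apply hh, inner_M]
  exact inner_vecOf_M_vecOf hr kr hh hk Q Q'

theorem pair_solOf {h k : E3 → ℝ} (hr : IsRadial h) (kr : IsRadial k)
    (hh : MemLp h 2 (volume : Measure E3)) (hk : MemLp k 2 (volume : Measure E3)) (Q : E3) :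
    pair h (solOf hk Q) = (2 / 3 * ∫ x, h x * k x) • Q :=
  ext_inner_left ℝ fun Q' => by
    rw [← inner_solOf hh, inner_solOf_solOf hr kr, inner_smul_right]

/-- The potential `G_z * s` of the scalar function `s`. -/
def smear (z : ℝ) (s : E3 → ℝ) (x : E3) : ℝ := ∫ y, green z (x - y) * s y

variable {z : ℝ} {s : E3 → ℝ}

theorem potential_vecOf (hs : MemLp s 2 (volume : Measure E3)) (Q x : E3) :
    potential z (vecOf hs Q) x = smear z s x • Q := by
  rw [potential, smear, ← integral_smul_const]
  refine integral_congr_ae ?_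
  filter_upwards [coeFn_toVec (MemLp.smul_vec hs Q)] with y hy
  rw [vecOf_apply, hy, smul_smul]

theorem smear_eq_potential (hs : MemLp s 2 (volume : Measure E3)) (x : E3) :
    smear z s x = potential z (vecOf hs (EuclideanSpace.single 0 1)) x 0 := by
  rw [potential_vecOf]
  simp

theorem memLp_smear (hz : 0 < z) (hs : MemLp s 2 (volume : Measure E3)) :
    MemLp (smear z s) 2 (volume : Measure E3) := by
  refine (memLp_coord (resolvent z (vecOf hs (EuclideanSpace.single 0 1))) 0).ae_eq ?_
  filter_upwards [coeFn_resolvent hz (vecOf hs (EuclideanSpace.single 0 1))] with x hx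
  rw [hx, smear_eq_potential hs]

theorem resolvent_vecOf (hz : 0 < z) (hs : MemLp s 2 (volume : Measure E3)) (Q : E3) :
    resolvent z (vecOf hs Q) = vecOf (memLp_smear hz hs) Q := by
  rw [← toVec_coeFn (resolvent z (vecOf hs Q)), vecOf_apply (memLp_smear hz hs)]
  refine toVec_congr ?_
  filter_upwards [coeFn_resolvent hz (vecOf hs Q)] with x hx
  rw [hx, potential_vecOf]

theorem resolventS_solOf (hz : 0 < z) (hs : MemLp s 2 (volume : Measure E3)) (Q : E3) :
    resolventS hz (solOf hs Q) = solOf (memLp_smear hz hs) Q := by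
  rw [solOf_apply, ← M_resolvent, resolvent_vecOf hz hs, solOf_apply]

theorem isRadial_smear (z : ℝ) (hr : IsRadial s) : IsRadial (smear z s) := by
  intro x y hxy
  -- The reflection exchanging x and y, which have equal norms.
  set O := ((ℝ ∙ (x - y))ᗮ.reflection)
  have hO : O x = y := Submodule.reflection_sub hxy
  rw [smear, smear, ← hO]
  refine Eq.trans ?_ (O.measurePreserving.integral_comp O.toHomeomorph.measurableEmbedding
    fun w => green z (O x - w) * s w)
  refine integral_congr_ae (Eventually.of_forall fun w => ?_)
  simp only
  rw [← map_sub, isRadial_green z _ _ (O.norm_map (x - w)), hr _ _ (O.norm_map w)]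

theorem pair_resolventS (hz : 0 < z) (hs : MemLp s 2 (volume : Measure E3)) (A : L2s) :
    pair s (resolventS hz A) = pair (smear z s) A := by
  refine ext_inner_left ℝ fun Q => ?_
  rw [← inner_solOf hs, ← inner_solOf (memLp_smear hz hs), ← resolventS_solOf hz hs]
  change ⟪((solOf hs Q : L2s) : Vec), (resolventS hz A : Vec)⟫
    = ⟪(resolventS hz (solOf hs Q) : Vec), (A : Vec)⟫
  rw [coe_resolventS, coe_resolventS, resolvent_symm hz]

/-! ### The resolvents of the interacting operators -/

/-- The rank three perturbation `R + γ⁻¹ g g^*` of the free resolvent, where `g Q` is the solenoidal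
part of `h Q`. -/
def pertRes (hz : 0 < z) {h : E3 → ℝ} (hh : MemLp h 2 (volume : Measure E3)) (γ : ℝ) :
    L2s →L[ℝ] L2s :=
  resolventS hz + γ⁻¹ • ((solOf hh).comp (solOf hh).adjoint)

theorem pertRes_apply (hz : 0 < z) {h : E3 → ℝ} (hh : MemLp h 2 (volume : Measure E3)) (γ : ℝ)
    (f : L2s) : pertRes hz hh γ f = resolventS hz f + γ⁻¹ • solOf hh (pair h f) := by
  simp [pertRes, adjoint_solOf]

/-- Apply R to (-Δ + z)x - ν⁻¹ M(s⟨s, x⟩) = y and pair with s. Since ⟨s, M(uk)⟩ = (ν - γ)k for u =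
G_z * s, this gives ⟨s, x⟩ = νγ⁻¹⟨u, y⟩, and substitution yields the rank three formula. -/
theorem shift_Hreg_eq (hz : 0 < z) {c e m r ν : ℝ} {ρ : E3 → ℝ}
    (hs : MemLp (scaled ρ r) 2 (volume : Measure E3)) (hrad : IsRadial (scaled ρ r))
    (hν : ν ≠ 0) (hβ : 4 * Real.pi * e ^ 2 / (mass c e m ρ r * c ^ 2) = -ν⁻¹) {γ : ℝ} (hγ : γ ≠ 0)
    (hνγ : ν - 2 / 3 * ∫ x, scaled ρ r x * smear z (scaled ρ r) x = γ) :
    shift (Hreg c e m ρ r) z = invGraph (pertRes hz (memLp_smear hz hs) γ) := by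
  set s := scaled ρ r with hsdef
  set u := smear z s
  have hu : MemLp u 2 (volume : Measure E3) := memLp_smear hz hs
  ext ⟨x, y⟩
  have hM : ∀ k : E3, M (toVec fun x => s x • k) = solOf hs k := fun _ => rfl
  change (IsH2 x ∧ ((y - z • x : L2s) : Vec) = -lap x + _ • ((M (toVec fun w => s w • pair s x) : L2s) : Vec))
    ↔ x = pertRes hz _ γ y
  rw [hβ, hM, pertRes_apply]
  have hpu : ∀ k, pair s (solOf hu k) = (ν - γ) • k := fun k => by
    rw [pair_solOf hrad (isRadial_smear z hrad) hs hu, ← hνγ]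
    congr 1
    ring
  constructor
  · rintro ⟨hx, hy⟩
    have h1 : -lap x + z • (x : Vec) = ((y + ν⁻¹ • solOf hs (pair s x) : L2s) : Vec) := by
      simp only [Submodule.coe_sub, Submodule.coe_add, Submodule.coe_smul] at hy ⊢
      rw [sub_eq_iff_eq_add] at hy
      rw [hy]
      module
    have h2 := eq_resolvent hz hx h1
    rw [← coe_resolventS hz, ← Subtype.ext_iff, map_add, map_smul, resolventS_solOf hz hs] at h2
    have h3 := congrArg (fun A : L2s => pair s A) h2
    simp only [← adjoint_solOf hs] at h3
    rw [map_add, map_smul, adjoint_solOf, adjoint_solOf, adjoint_solOf, pair_resolventS hz hs, hpu,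
      smul_smul, ← sub_eq_iff_eq_add, ← one_smul ℝ (pair s x), smul_smul, ← sub_smul] at h3
    have h4 : pair s x = (ν * γ⁻¹) • pair u y := by
      rw [← h3, smul_smul]
      conv_lhs => rw [← one_smul ℝ (pair s x)]
      congr 1
      field_simp
      ring
    rw [h4, map_smul, smul_smul] at h2
    rw [h2]
    congr 2
    field_simp
  · intro h
    have h2 : x = resolventS hz (y + γ⁻¹ • solOf hs (pair u y)) := by
      rw [h, map_add, map_smul, resolventS_solOf hz hs]
    have h3 : pair s x = (ν * γ⁻¹) • pair u y := by
      rw [h, ← adjoint_solOf hs, map_add, map_smul, adjoint_solOf, adjoint_solOf, pair_resolventS hz hs,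
        hpu, smul_smul]
      trans (1 + γ⁻¹ * (ν - γ)) • pair u y
      · rw [add_smul, one_smul]
      congr 1
      field_simp
      ring
    have h4 := neg_lap_resolvent_add hz ((y + γ⁻¹ • solOf hs (pair u y) : L2s) : Vec)
    rw [← coe_resolventS hz, ← h2] at h4
    refine ⟨?_, ?_⟩
    · rw [h2, coe_resolventS]
      exact isH2_resolvent hz _
    · rw [h3, map_smul]
      simp only [Submodule.coe_sub, Submodule.coe_add, Submodule.coe_smul] at h4 ⊢
      rw [smul_smul, show -ν⁻¹ * (ν * γ⁻¹) = -γ⁻¹ by field_simp]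
      generalize ((solOf hs (pair u y) : L2s) : Vec) = w at h4
      rw [sub_eq_iff_eq_add, ← sub_eq_iff_eq_add.2 h4]
      module

theorem potential_zero (A : L2s) : potential z A 0 = pair (green z) A := by
  rw [potential, pair]
  refine integral_congr_ae (Eventually.of_forall fun y => ?_)
  simp only [zero_sub, isRadial_green z _ _ (norm_neg y)]

/-- If y = (H_m + z)x, the regular part of x is Ry, whose value at 0 is ⟨G_z, y⟩. The boundary
condition equates it with (4πe/c) Γ_m(z) Q, which determines the charge from y. -/
theorem shift_Hlim_eq (hz : 0 < z) {c e m : ℝ} (hc : c ≠ 0) (he : e ≠ 0)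
    (hγ : Gam c e m z ≠ 0) :
    shift (Hlim c e m z) z = invGraph (pertRes hz (memLp_green_scalar hz) (Gam c e m z)) := by
  set κ := 4 * Real.pi * e / c with hκ
  have hκ0 : κ ≠ 0 := by rw [hκ]; have := Real.pi_ne_zero; positivity
  ext ⟨x, y⟩
  change (∃ Q : E3, IsH2 (regPart c e z x Q) ∧ BoundaryCond c e m x Q ∧
    ((y - z • x : L2s) : Vec) + z • (x : Vec) =
      - lap (regPart c e z x Q) + z • (regPart c e z x Q : Vec)) ↔ x = pertRes hz _ _ y
  have hs : ((y - z • x : L2s) : Vec) + z • (x : Vec) = y := by simp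
  rw [hs, pertRes_apply]
  have hMG : ∀ Q, MG z Q = solOf (memLp_green_scalar hz) Q := fun _ => rfl
  constructor
  · rintro ⟨Q, h1, h2, h3⟩
    have h4 := eq_resolvent hz h1 h3.symm
    rw [boundaryCond_iff hc he hz h4, potential_zero] at h2
    rw [← coe_resolventS hz, ← Subtype.ext_iff, regPart, sub_eq_iff_eq_add, hMG] at h4
    rw [h4, h2, map_smul, smul_smul]
    congr 2
    field_simp
  · intro h
    set Q := (κ⁻¹ * (Gam c e m z)⁻¹) • pair (green z) y with hQ
    have h4 : (regPart c e z x Q : Vec) = resolvent z y := by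
      rw [← coe_resolventS hz, ← Subtype.ext_iff, regPart, sub_eq_iff_eq_add, hMG, h, hQ, map_smul,
        smul_smul]
      congr 2
      rw [mul_inv_cancel_left₀ hκ0]
    refine ⟨Q, ?_, ?_, ?_⟩
    · rw [h4]
      exact isH2_resolvent hz _
    · rw [boundaryCond_iff hc he hz h4, potential_zero, hQ, smul_smul]
      conv_lhs => rw [← one_smul ℝ (pair (green z) y)]
      congr 1
      change 1 = κ * Gam c e m z * (κ⁻¹ * (Gam c e m z)⁻¹)
      field_simp
    · rw [h4, neg_lap_resolvent_add hz]

/-! ### Concentrated densities -/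

variable {ρ : E3 → ℝ} {z : ℝ}

/-- No sign of r is required, so families indexed by all real r can be formed; at r = 0 the scaled
density is 0. -/
theorem IsDensity.memLp_scaled (hρ : IsDensity ρ) (r : ℝ) :
    MemLp (scaled ρ r) 2 (volume : Measure E3) := by
  rcases eq_or_ne r 0 with rfl | hr
  · have h0 : PointMaxwell.scaled ρ 0 = fun _ => 0 := by
      funext x
      simp [PointMaxwell.scaled]
    rw [h0]
    exact MemLp.zero'
  have h1 : Integrable fun x => ρ x ^ 2 := hρ.memLp.integrable_sq
  have h2 := (h1.comp_smul (inv_ne_zero hr)).const_mul (((r ^ 3)⁻¹) ^ 2)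
  have hm : Measurable (PointMaxwell.scaled ρ r) := by
    have := hρ.measurable
    unfold PointMaxwell.scaled
    fun_prop
  rw [memLp_two_iff_integrable_sq hm.aestronglyMeasurable]
  refine h2.congr (Eventually.of_forall fun x => ?_)
  simp only [PointMaxwell.scaled, mul_pow]

theorem IsDensity.scaled {ρ : E3 → ℝ} (hρ : IsDensity ρ) {r : ℝ} (hr : 0 < r) :
    IsDensity (scaled ρ r) where
  measurable := by
    have := hρ.measurable
    unfold PointMaxwell.scaled
    fun_prop
  nonneg x := mul_nonneg (by positivity) (hρ.nonneg _)
  integral_eq_one := by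
    unfold PointMaxwell.scaled
    rw [integral_const_mul, Measure.integral_comp_smul, finrank_euclideanSpace, Fintype.card_fin,
      hρ.integral_eq_one, abs_of_pos (by positivity), smul_eq_mul, mul_one]
    field_simp
  memLp := hρ.memLp_scaled r
  symmetric x y h := by
    simp only [PointMaxwell.scaled]
    rw [hρ.symmetric (r⁻¹ • x) (r⁻¹ • y) (by rw [norm_smul, norm_smul, h])]
  bounded_support := by
    obtain ⟨R, hR⟩ := (Metric.isBounded_iff_subset_closedBall 0).1 hρ.bounded_support
    refine (Metric.isBounded_iff_subset_closedBall 0).2 ⟨r * R, fun x hx => ?_⟩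
    have h1 : ρ (r⁻¹ • x) ≠ 0 := fun h => hx (by simp [PointMaxwell.scaled, h])
    have h2 := hR h1
    rw [mem_closedBall_zero_iff, norm_smul, norm_inv, Real.norm_of_nonneg hr.le,
      inv_mul_le_iff₀ hr] at h2
    exact mem_closedBall_zero_iff.2 h2

theorem integral_scaled_sq (ρ : E3 → ℝ) {r : ℝ} (hr : 0 < r) :
    ∫ x, scaled ρ r x ^ 2 = (r ^ 3)⁻¹ * ∫ x, ρ x ^ 2 := by
  have h : ∀ x, scaled ρ r x ^ 2 = ((r ^ 3)⁻¹) ^ 2 * (fun x => ρ x ^ 2) (r⁻¹ • x) := fun x => by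
    simp only [scaled, mul_pow]
  simp_rw [h]
  rw [integral_const_mul, Measure.integral_comp_smul volume (fun x => ρ x ^ 2), finrank_euclideanSpace,
    Fintype.card_fin, abs_of_pos (by positivity), smul_eq_mul]
  field_simp

/-- The density `s` vanishes outside the ball of radius `δ`. -/
def SuppIn (s : E3 → ℝ) (δ : ℝ) : Prop := ∀ x, s x ≠ 0 → ‖x‖ ≤ δ

theorem IsDensity.exists_suppIn (hρ : IsDensity ρ) :
    ∃ R : ℝ, 0 < R ∧ ∀ r, 0 < r → SuppIn (PointMaxwell.scaled ρ r) (r * R) := by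
  obtain ⟨R, hR⟩ := (Metric.isBounded_iff_subset_closedBall 0).1 hρ.bounded_support
  refine ⟨max R 1, by positivity, fun r hr x hx => ?_⟩
  have h1 : ρ (r⁻¹ • x) ≠ 0 := fun h => hx (by simp [PointMaxwell.scaled, h])
  have h2 := hR h1
  rw [mem_closedBall_zero_iff, norm_smul, norm_inv, Real.norm_of_nonneg hr.le,
    inv_mul_le_iff₀ hr] at h2
  exact h2.trans (by gcongr; exact le_max_left _ _)

variable {s : E3 → ℝ} {δ : ℝ}

theorem IsDensity.integrable (hs : IsDensity s) : Integrable s :=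
  Integrable.of_integral_ne_zero (by rw [hs.integral_eq_one]; exact one_ne_zero)

theorem IsDensity.integrable_smul (hs : IsDensity s) (hδ : SuppIn s δ) {F : E3 → E3}
    (hF : Continuous F) : Integrable fun x => s x • F x := by
  obtain ⟨C, hC⟩ := (isCompact_closedBall (0 : E3) δ).exists_bound_of_continuousOn hF.continuousOn
  refine (hs.integrable.norm.const_mul C).mono'
    (hs.measurable.aestronglyMeasurable.smul hF.aestronglyMeasurable) (Eventually.of_forall fun x => ?_)
  rw [norm_smul, mul_comm]
  by_cases h : s x = 0
  · simp [h]
  · gcongr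
    exact hC x (mem_closedBall_zero_iff.2 (hδ x h))

/-- The mean of a function which is within `ε` of `a` on the support. -/
theorem IsDensity.norm_mean_sub_le (hs : IsDensity s) {F : E3 → E3}
    (hF : Integrable fun x => s x • F x) {a : E3} {ε : ℝ} (h : ∀ᵐ x, s x ≠ 0 → ‖F x - a‖ ≤ ε) :
    ‖(∫ x, s x • F x) - a‖ ≤ ε := by
  have h1 : (∫ x, s x • F x) - a = ∫ x, s x • (F x - a) := by
    simp_rw [smul_sub]
    rw [integral_sub hF (hs.integrable.smul_const a), integral_smul_const, hs.integral_eq_one, one_smul]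
  have h2 : ∫ x, s x * ε = ε := by rw [integral_mul_const, hs.integral_eq_one, one_mul]
  rw [h1, ← h2]
  refine norm_integral_le_of_norm_le (hs.integrable.mul_const ε) ?_
  filter_upwards [h] with x hx
  rw [norm_smul, Real.norm_of_nonneg (hs.nonneg x)]
  by_cases h0 : s x = 0
  · simp [h0]
  · exact mul_le_mul_of_nonneg_left (hx h0) (hs.nonneg x)

theorem IsDensity.le_mean (hs : IsDensity s) {f : E3 → ℝ}
    (hf : Integrable fun x => s x * f x) {a : ℝ} (h : ∀ᵐ x, s x ≠ 0 → a ≤ f x) :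
    a ≤ ∫ x, s x * f x := by
  have h2 : ∫ x, s x * a = a := by rw [integral_mul_const, hs.integral_eq_one, one_mul]
  rw [← h2]
  refine integral_mono_ae (hs.integrable.mul_const a) hf ?_
  filter_upwards [h] with x hx
  by_cases h0 : s x = 0
  · simp [h0]
  · exact mul_le_mul_of_nonneg_left (hx h0) (hs.nonneg x)

theorem IsDensity.mean_le (hs : IsDensity s) {f : E3 → ℝ}
    (hf : Integrable fun x => s x * f x) {a : ℝ} (h : ∀ᵐ x, s x ≠ 0 → f x ≤ a) :
    ∫ x, s x * f x ≤ a := by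
  have h2 : ∫ x, s x * a = a := by rw [integral_mul_const, hs.integral_eq_one, one_mul]
  conv_rhs => rw [← h2]
  refine integral_mono_ae hf (hs.integrable.mul_const a) ?_
  filter_upwards [h] with x hx
  by_cases h0 : s x = 0
  · simp [h0]
  · exact mul_le_mul_of_nonneg_left (hx h0) (hs.nonneg x)

theorem tendsto_mean_scaled (hρ : IsDensity ρ) {F : E3 → E3} (hF : Continuous F) :
    Tendsto (fun r => ∫ x, scaled ρ r x • F x) (𝓝[>] 0) (𝓝 (F 0)) := by
  obtain ⟨R, hR, hsupp⟩ := hρ.exists_suppIn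
  rw [Metric.tendsto_nhds]
  intro ε hε
  obtain ⟨δ, hδ, h⟩ := Metric.continuousAt_iff.1 (hF.continuousAt (x := 0)) (ε / 2) (by positivity)
  filter_upwards [Ioo_mem_nhdsGT (div_pos hδ hR)] with r hr
  rw [dist_eq_norm]
  refine lt_of_le_of_lt ((hρ.scaled hr.1).norm_mean_sub_le (ε := ε / 2)
    ((hρ.scaled hr.1).integrable_smul (hsupp r hr.1) hF)
    (Eventually.of_forall fun x hx => ?_)) (by linarith)
  rw [← dist_eq_norm]
  refine (h ?_).le
  rw [dist_zero_right]
  exact (hsupp r hr.1 x hx).trans_lt ((lt_div_iff₀ hR).1 hr.2)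

/-- Young's inequality for a probability density, by duality: with u = G_z * s, ‖u‖² is an average
over s of the continuous function G_z * u, which is bounded by ‖G_z‖₂‖u‖₂. -/
theorem smear_norm_le (hz : 0 < z) (hs : IsDensity s) (hδ : SuppIn s δ) :
    ∫ x, smear z s x ^ 2 ≤ ∫ x, green z x ^ 2 := by
  set u := memLp_smear hz hs.memLp
  set Q : E3 := EuclideanSpace.single 0 1
  have hQ : ‖Q‖ = 1 := by simp [Q]
  have hn : ‖vecOf u Q‖ ^ 2 = ∫ x, smear z s x ^ 2 := by
    rw [vecOf_apply, norm_toVec_smul_sq u, hQ]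
    ring
  have h1 : ‖vecOf u Q‖ ^ 2 ≤ greenNorm z * ‖vecOf u Q‖ := by
    rw [← real_inner_self_eq_norm_sq, ← resolvent_vecOf hz hs.memLp, resolvent_symm hz,
      vecOf_apply, inner_toVec_smul hs.memLp]
    have h2 : ∫ x, s x • (resolvent z (resolvent z (toVec fun x => s x • Q)) : Vec) x
        = ∫ x, s x • potential z (resolvent z (toVec fun x => s x • Q)) x := by
      refine integral_congr_ae ?_
      filter_upwards [coeFn_resolvent hz (resolvent z (toVec fun x => s x • Q))] with x hx
      rw [hx]
    rw [h2]
    refine (real_inner_le_norm _ _).trans ?_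
    rw [hQ, one_mul]
    have h3 := hs.norm_mean_sub_le (a := 0)
      (hs.integrable_smul hδ (continuous_potential hz (resolvent z (toVec fun x => s x • Q))))
      (Eventually.of_forall fun x _ => by rw [sub_zero]; exact norm_potential_le hz _ x)
    rwa [sub_zero] at h3
  have h4 : ‖vecOf u Q‖ ≤ greenNorm z := by
    rcases eq_or_lt_of_le (norm_nonneg (vecOf u Q)) with h0 | h0
    · rw [← h0]; unfold greenNorm; positivity
    · exact le_of_mul_le_mul_right (by rw [← sq]; exact h1) h0
  rw [← hn]
  calc _ ≤ greenNorm z ^ 2 := by gcongr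
    _ = _ := Real.sq_sqrt (integral_nonneg fun y => sq_nonneg _)

/-- Let g_r and g be the smeared and the singular field. The norm of g_r is at most that of g, and
⟨g_r, g⟩ = Q·⟨ρ_r, Rg⟩ → Q·(Rg)(0) = ⟨g, g⟩ by continuity of Rg. Hence ‖g_r - g‖² ≤ 2(⟨g, g⟩ - ⟨g_r,
g⟩) → 0. -/
theorem tendsto_norm_solOf_sub (hz : 0 < z) (hρ : IsDensity ρ)
    (Q : E3) :
    Tendsto (fun r => ‖solOf (memLp_smear hz (hρ.memLp_scaled r)) Q - solOf (memLp_green_scalar hz) Q‖) (𝓝[>] 0) (𝓝 0) := by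
  set g := solOf (memLp_green_scalar hz) Q with hg
  have h1 : Tendsto (fun r => ⟪solOf (memLp_smear hz (hρ.memLp_scaled r)) Q, g⟫) (𝓝[>] 0) (𝓝 ⟪g, g⟫) := by
    have h2 := tendsto_mean_scaled hρ (continuous_potential hz (g : Vec))
    rw [potential_zero] at h2
    have h3 := (tendsto_const_nhds (x := Q)).inner (𝕜 := ℝ) h2
    rw [← inner_solOf (memLp_green_scalar hz)] at h3
    refine h3.congr' ?_
    filter_upwards [self_mem_nhdsWithin] with r hr
    rw [inner_solOf (memLp_smear hz (hρ.memLp_scaled r)), ← pair_resolventS hz (hρ.scaled hr).memLp, pair]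
    congr 1
    refine integral_congr_ae ?_
    filter_upwards [coeFn_resolvent hz (g : Vec)] with x hx
    rw [coe_resolventS, hx]
  have h4 : Tendsto (fun r => √(2 * (⟪g, g⟫ - ⟪solOf (memLp_smear hz (hρ.memLp_scaled r)) Q, g⟫))) (𝓝[>] 0) (𝓝 0) := by
    have h5 := ((tendsto_const_nhds (x := ⟪g, g⟫)).sub h1).const_mul 2
    rw [sub_self, mul_zero] at h5
    have := (Real.continuous_sqrt.tendsto 0).comp h5
    rwa [Real.sqrt_zero] at this
  refine squeeze_zero' (Eventually.of_forall fun _ => norm_nonneg _) ?_ h4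
  filter_upwards [self_mem_nhdsWithin] with r hr
  obtain ⟨R, hR, hsupp⟩ := hρ.exists_suppIn
  have hd := hρ.scaled hr
  refine Real.le_sqrt_of_sq_le ?_
  have hru := isRadial_smear z hd.symmetric
  have h6 : ‖solOf (memLp_smear hz (hρ.memLp_scaled r)) Q‖ ^ 2 ≤ ⟪g, g⟫ := by
    rw [← real_inner_self_eq_norm_sq, hg, inner_solOf_solOf hru hru,
      inner_solOf_solOf (isRadial_green z) (isRadial_green z)]
    have h7 := smear_norm_le hz hd (hsupp r hr)
    simp_rw [← sq]
    gcongr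
    exact real_inner_self_nonneg
  rw [norm_sub_sq_real, real_inner_self_eq_norm_sq] at *
  linarith

/-! ### The renormalization of the mass -/

theorem measurable_green (z : ℝ) : Measurable (green z) := by
  unfold green
  fun_prop

theorem green_zero (x : E3) : green 0 x = 1 / (4 * Real.pi * ‖x‖) := by
  simp [green]

theorem green_zero_sub_green (z : ℝ) (x : E3) :
    green 0 x - green z x = (1 - Real.exp (-(√z * ‖x‖))) / (4 * Real.pi * ‖x‖) := by
  rw [green_zero, green, ← sub_div]

theorem green_zero_sub_nonneg (z : ℝ) (x : E3) : 0 ≤ green 0 x - green z x := by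
  rw [green_zero_sub_green]
  have : Real.exp (-(√z * ‖x‖)) ≤ 1 := Real.exp_le_one_iff.2 (neg_nonpos.2 (by positivity))
  exact div_nonneg (by linarith) (by positivity)

theorem green_zero_sub_le (z : ℝ) (x : E3) : green 0 x - green z x ≤ √z / (4 * Real.pi) := by
  rw [green_zero_sub_green]
  rcases eq_or_lt_of_le (norm_nonneg x) with h0 | h0
  · rw [← h0]
    simp
    positivity
  · have h1 := Real.add_one_le_exp (-(√z * ‖x‖))
    rw [div_le_div_iff₀ (by positivity) (by positivity)]
    nlinarith [Real.pi_pos]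

/-- Follows from (1 - y + y²/2)(1 + y + y²/2) = 1 + y⁴/4 ≥ 1. -/
theorem exp_neg_le {y : ℝ} (hy : 0 ≤ y) : Real.exp (-y) ≤ 1 - y + y ^ 2 / 2 := by
  have h1 := Real.quadratic_le_exp_of_nonneg hy
  have h2 : Real.exp (-y) * Real.exp y = 1 := by rw [← Real.exp_add]; simp
  have h3 : 0 < Real.exp y := Real.exp_pos y
  have h4 : 0 < 1 - y + y ^ 2 / 2 := by nlinarith [sq_nonneg (y - 1)]
  have h5 : 1 ≤ (1 - y + y ^ 2 / 2) * Real.exp y := by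
    calc (1 : ℝ) ≤ (1 - y + y ^ 2 / 2) * (1 + y + y ^ 2 / 2) := by nlinarith [sq_nonneg (y ^ 2)]
      _ ≤ _ := by gcongr
  exact le_of_mul_le_mul_right (h2.le.trans h5) h3

theorem le_green_zero_sub (z : ℝ) {x : E3} (hx : x ≠ 0) :
    √z / (4 * Real.pi) - √z ^ 2 / (8 * Real.pi) * ‖x‖ ≤ green 0 x - green z x := by
  rw [green_zero_sub_green]
  have h0 : 0 < ‖x‖ := norm_pos_iff.2 hx
  have h1 := exp_neg_le (y := √z * ‖x‖) (by positivity)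
  rw [le_div_iff₀ (by positivity)]
  have h2 : (√z / (4 * Real.pi) - √z ^ 2 / (8 * Real.pi) * ‖x‖) * (4 * Real.pi * ‖x‖)
      = √z * ‖x‖ - (√z * ‖x‖) ^ 2 / 2 := by
    field_simp
    ring
  linarith

theorem green_ge (z : ℝ) {x : E3} (hx : x ≠ 0) {d : ℝ} (hd : ‖x‖ ≤ d) :
    Real.exp (-(√z * d)) / (4 * Real.pi * d) ≤ green z x := by
  have h0 : 0 < ‖x‖ := norm_pos_iff.2 hx
  rw [green]
  gcongr

theorem IsDensity.integrable_green_mul (hz : 0 < z) (hs : IsDensity s) (x : E3) :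
    Integrable fun y => s y * green z (x - y) :=
  integrable_mul_of_memLp hs.memLp (memLp_green_sub hz x)

theorem IsDensity.integrable_diff_mul (z : ℝ) (hs : IsDensity s) (x : E3) :
    Integrable fun y => s y * (green 0 (x - y) - green z (x - y)) := by
  have hm : Measurable fun y => green 0 (x - y) - green z (x - y) := by
    have h1 := measurable_green 0
    have h2 := measurable_green z
    fun_prop
  refine (hs.integrable.mul_const (√z / (4 * Real.pi))).mono'
    (hs.measurable.mul hm).aestronglyMeasurable (Eventually.of_forall fun y => ?_)
  rw [norm_mul, Real.norm_of_nonneg (hs.nonneg y), Real.norm_of_nonneg (green_zero_sub_nonneg z _)]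
  exact mul_le_mul_of_nonneg_left (green_zero_sub_le z _) (hs.nonneg y)

theorem smear_zero_sub (hz : 0 < z) (hs : IsDensity s) (x : E3) :
    smear 0 s x - smear z s x = ∫ y, s y * (green 0 (x - y) - green z (x - y)) := by
  have h1 := hs.integrable_green_mul hz x
  have h2 := hs.integrable_diff_mul z x
  have h3 : Integrable fun y => s y * green 0 (x - y) := by
    refine (h1.add h2).congr (Eventually.of_forall fun y => ?_)
    simp only [Pi.add_apply]
    ring
  simp only [smear, mul_sub, mul_comm _ (s _)]
  rw [integral_sub h3 h1]

theorem ae_sub_ne_zero (x : E3) : ∀ᵐ y : E3, x - y ≠ 0 := by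
  have h : ∀ᵐ y : E3, y ≠ x := by
    rw [ae_iff]
    simp
  filter_upwards [h] with y hy
  exact sub_ne_zero.2 (Ne.symm hy)

theorem measurable_smear (z : ℝ) (hs : IsDensity s) : Measurable (smear z s) := by
  have h1 := measurable_green z
  have h2 := hs.measurable
  have h3 : StronglyMeasurable (Function.uncurry fun x y : E3 => green z (x - y) * s y) :=
    (by fun_prop : Measurable (Function.uncurry fun x y : E3 => green z (x - y) * s y)).stronglyMeasurable
  exact h3.integral_prod_right.measurable

/-- The difference is the average of G_0 - G_z over pairs of points of the support, at distance at
most 2δ, and G_0 - G_z = √z/4π + O(|x|) near the origin. -/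
theorem selfEnergy_sub_mem (hz : 0 < z) (hs : IsDensity s) (hδ : SuppIn s δ) :
    √z / (4 * Real.pi) - √z ^ 2 / (8 * Real.pi) * (2 * δ)
        ≤ selfEnergy s - ∫ x, s x * smear z s x ∧
      selfEnergy s - ∫ x, s x * smear z s x ≤ √z / (4 * Real.pi) := by
  have hle : ∀ x, smear 0 s x - smear z s x ≤ √z / (4 * Real.pi) := fun x => by
    rw [smear_zero_sub hz hs]
    exact hs.mean_le (hs.integrable_diff_mul z x) (Eventually.of_forall fun y _ => green_zero_sub_le z _)
  have hge0 : ∀ x, 0 ≤ smear 0 s x - smear z s x := fun x => by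
    rw [smear_zero_sub hz hs]
    exact hs.le_mean (hs.integrable_diff_mul z x)
      (Eventually.of_forall fun y _ => green_zero_sub_nonneg z _)
  have hge : ∀ x, s x ≠ 0 → √z / (4 * Real.pi) - √z ^ 2 / (8 * Real.pi) * (2 * δ)
      ≤ smear 0 s x - smear z s x := fun x hx => by
    rw [smear_zero_sub hz hs]
    refine hs.le_mean (hs.integrable_diff_mul z x) ?_
    filter_upwards [ae_sub_ne_zero x] with y hy hsy
    refine le_trans ?_ (le_green_zero_sub z hy)
    have h1 : ‖x - y‖ ≤ 2 * δ := (norm_sub_le x y).trans (by linarith [hδ x hx, hδ y hsy])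
    gcongr
  have hi1 : Integrable fun x => s x * (smear 0 s x - smear z s x) := by
    refine (hs.integrable.mul_const (√z / (4 * Real.pi))).mono'
      (hs.measurable.mul ((measurable_smear 0 hs).sub (measurable_smear z hs))).aestronglyMeasurable
      (Eventually.of_forall fun y => ?_)
    rw [norm_mul, Real.norm_of_nonneg (hs.nonneg y), Real.norm_of_nonneg (hge0 y)]
    exact mul_le_mul_of_nonneg_left (hle _) (hs.nonneg y)
  have hi2 : Integrable fun x => s x * smear z s x :=
    integrable_mul_of_memLp hs.memLp (memLp_smear hz hs.memLp)
  have hE : selfEnergy s - ∫ x, s x * smear z s x = ∫ x, s x * (smear 0 s x - smear z s x) := by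
    have h1 : selfEnergy s = ∫ x, s x * smear 0 s x := by
      rw [selfEnergy, ← integral_const_mul]
      refine integral_congr_ae (Eventually.of_forall fun x => ?_)
      simp only [smear]
      rw [← integral_const_mul, ← integral_const_mul]
      refine integral_congr_ae (Eventually.of_forall fun y => ?_)
      simp only [green_zero]
      field_simp
    rw [h1, sub_eq_iff_eq_add, ← integral_add hi1 hi2]
    simp_rw [← mul_add, sub_add_cancel]
  rw [hE]
  exact ⟨hs.le_mean hi1 (Eventually.of_forall hge), hs.mean_le hi1 (Eventually.of_forall fun x _ => hle x)⟩

/-- Points of the support are at distance at most 2δ and G_z decreases with the distance. The bound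
makes the smeared self-interaction diverge like 1/δ. -/
theorem le_integral_mul_smear (hz : 0 < z) (hs : IsDensity s) (hδ : SuppIn s δ) :
    Real.exp (-(√z * (2 * δ))) / (4 * Real.pi * (2 * δ)) ≤ ∫ x, s x * smear z s x := by
  refine hs.le_mean (integrable_mul_of_memLp hs.memLp (memLp_smear hz hs.memLp))
    (Eventually.of_forall fun x hx => ?_)
  simp only [smear, mul_comm _ (s _)]
  refine hs.le_mean (hs.integrable_green_mul hz x) ?_
  filter_upwards [ae_sub_ne_zero x] with y hy hsy
  exact green_ge z hy ((norm_sub_le x y).trans (by linarith [hδ x hx, hδ y hsy]))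

theorem le_integral_mul_green (hz : 0 < z) (hs : IsDensity s) (hδ : SuppIn s δ) :
    Real.exp (-(√z * δ)) / (4 * Real.pi * δ) ≤ ∫ x, s x * green z x := by
  refine hs.le_mean (integrable_mul_of_memLp hs.memLp (memLp_green_scalar hz)) ?_
  filter_upwards [ae_sub_ne_zero 0] with x hx hsx
  exact green_ge z (by simpa using hx) (hδ x hsx)

/-- The number `-m_r c² / 4πe²`. -/
def invCoupling (c e m : ℝ) (ρ : E3 → ℝ) (r : ℝ) : ℝ :=
  -(mass c e m ρ r * c ^ 2 / (4 * Real.pi * e ^ 2))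

/-- The coefficient of the charge in the quadratic form of the regularized operator. -/
def regGam (c e m z : ℝ) (ρ : E3 → ℝ) (r : ℝ) : ℝ :=
  invCoupling c e m ρ r - 2 / 3 * ∫ x, scaled ρ r x * smear z (scaled ρ r) x

theorem coupling_eq (c e m : ℝ) (ρ : E3 → ℝ) (r : ℝ) :
    4 * Real.pi * e ^ 2 / (mass c e m ρ r * c ^ 2) = -(invCoupling c e m ρ r)⁻¹ := by
  rw [invCoupling, inv_neg, inv_div, neg_neg]

/-- The prefactor in m_r is fitted: (8πe²/3c²) · c²/(4πe²) = 2/3. Thus γ_r is -mc²/4πe² plus 2/3 of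
E(ρ_r) - ∫ρ_r (G_z * ρ_r), which has the finite limit √z/4π. -/
theorem tendsto_regGam (hz : 0 < z) {c e : ℝ} (hc : c ≠ 0) (he : e ≠ 0) (m : ℝ) (hρ : IsDensity ρ) :
    Tendsto (regGam c e m z ρ) (𝓝[>] 0) (𝓝 (Gam c e m z)) := by
  obtain ⟨R, hR, hsupp⟩ := hρ.exists_suppIn
  have h1 : Tendsto (fun r => selfEnergy (scaled ρ r) - ∫ x, scaled ρ r x * smear z (scaled ρ r) x)
      (𝓝[>] 0) (𝓝 (√z / (4 * Real.pi))) := by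
    have h2 : Tendsto (fun r : ℝ => √z / (4 * Real.pi) - √z ^ 2 / (8 * Real.pi) * (2 * (r * R)))
        (𝓝[>] 0) (𝓝 (√z / (4 * Real.pi))) := by
      have : Continuous fun r : ℝ => √z / (4 * Real.pi) - √z ^ 2 / (8 * Real.pi) * (2 * (r * R)) := by
        fun_prop
      have h3 := (this.tendsto 0).mono_left (nhdsWithin_le_nhds (s := Set.Ioi 0))
      simpa using h3
    refine tendsto_of_tendsto_of_tendsto_of_le_of_le' h2 tendsto_const_nhds ?_ ?_
    · filter_upwards [self_mem_nhdsWithin] with r hr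
      exact (selfEnergy_sub_mem hz (hρ.scaled hr) (hsupp r hr)).1
    · filter_upwards [self_mem_nhdsWithin] with r hr
      exact (selfEnergy_sub_mem hz (hρ.scaled hr) (hsupp r hr)).2
  have h4 := (h1.const_mul (2 / 3)).const_add (-(m * c ^ 2) / (4 * Real.pi * e ^ 2))
  have h5 : -(m * c ^ 2) / (4 * Real.pi * e ^ 2) + 2 / 3 * (√z / (4 * Real.pi)) = Gam c e m z := by
    rw [Gam]
    ring
  rw [h5] at h4
  refine h4.congr fun r => ?_
  rw [regGam, invCoupling, mass]
  field_simp
  ring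

theorem tendsto_integral_mul_smear (hz : 0 < z) (hρ : IsDensity ρ) :
    Tendsto (fun r => ∫ x, scaled ρ r x * smear z (scaled ρ r) x) (𝓝[>] 0) atTop := by
  obtain ⟨R, hR, hsupp⟩ := hρ.exists_suppIn
  have h1 : Tendsto (fun r : ℝ => Real.exp (-(√z * (2 * (r * R)))) / (4 * Real.pi * (2 * R)) * r⁻¹)
      (𝓝[>] 0) atTop := by
    have h2 : Tendsto (fun r : ℝ => Real.exp (-(√z * (2 * (r * R)))) / (4 * Real.pi * (2 * R)))
        (𝓝[>] 0) (𝓝 (1 / (4 * Real.pi * (2 * R)))) := by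
      have : Continuous fun r : ℝ => Real.exp (-(√z * (2 * (r * R)))) / (4 * Real.pi * (2 * R)) := by
        fun_prop
      have h3 := (this.tendsto 0).mono_left (nhdsWithin_le_nhds (s := Set.Ioi 0))
      simpa using h3
    exact h2.pos_mul_atTop (by positivity) tendsto_inv_nhdsGT_zero
  refine tendsto_atTop_mono' _ ?_ h1
  filter_upwards [self_mem_nhdsWithin] with r hr
  refine le_trans (le_of_eq ?_) (le_integral_mul_smear hz (hρ.scaled hr) (hsupp r hr))
  have hr0 : r ≠ 0 := ne_of_gt hr
  field_simp

/-- A convergent term plus the divergent self-interaction. For the mass this means m_r → -∞. -/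
theorem tendsto_invCoupling (hz : 0 < z) {c e : ℝ} (hc : c ≠ 0) (he : e ≠ 0) (m : ℝ)
    (hρ : IsDensity ρ) : Tendsto (invCoupling c e m ρ) (𝓝[>] 0) atTop := by
  have h := (tendsto_regGam hz hc he m hρ).add_atTop
    ((tendsto_integral_mul_smear hz hρ).const_mul_atTop (show (0 : ℝ) < 2 / 3 by norm_num))
  refine h.congr fun r => ?_
  rw [regGam]
  ring

/-- The singular fields are not in `H¹`. -/
theorem eq_zero_of_isH1_MG (hz : 0 < z) (hρ : IsDensity ρ) {Q : E3} (h : IsH1 (MG z Q : Vec)) :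
    Q = 0 := by
  by_contra hQ
  obtain ⟨R, hR, hsupp⟩ := hρ.exists_suppIn
  set a : Vec := (MG z Q : Vec) with ha
  set q : ℝ := z * ‖a‖ ^ 2 + ∑ i, ‖weakDeriv i a‖ ^ 2 with hq
  -- Cauchy–Schwarz for the energy form, ⟨f, a⟩² ≤ q ⟨f, Rf⟩, from the discriminant of the energy of
  -- Rf - ta as a quadratic in t.
  have hform : ∀ f : Vec, ⟪f, a⟫ ^ 2 ≤ q * ⟪f, resolvent z f⟫ := by
    intro f
    have hu := isH1_resolvent hz f
    have hfu := inner_eq_form_resolvent hz f hu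
    have hfa := inner_eq_form_resolvent hz f h
    have hexp : ∀ t : ℝ, 0 ≤ q * (t * t) + (-2 * ⟪f, a⟫) * t + ⟪f, resolvent z f⟫ := by
      intro t
      have h1 : 0 ≤ z * ‖resolvent z f - t • a‖ ^ 2
          + ∑ i, ‖weakDeriv i (resolvent z f) - t • weakDeriv i a‖ ^ 2 :=
        add_nonneg (mul_nonneg hz.le (sq_nonneg _)) (Finset.sum_nonneg fun _ _ => sq_nonneg _)
      simp only [norm_sub_sq_real, norm_smul, inner_smul_right, mul_pow, Finset.sum_add_distrib,
        Finset.sum_sub_distrib, ← Finset.mul_sum, Real.norm_eq_abs, sq_abs] at h1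
      simp only [real_inner_self_eq_norm_sq] at hfu
      rw [hfu, hfa, hq]
      linarith
    have hd := discrim_le_zero hexp
    rw [discrim] at hd
    linarith
  -- Take f = ρ_r Q. Then ⟨f, a⟩ grows at least like 1/r, while ⟨f, Rf⟩ ≤ ‖ρ_r‖₂‖G_z‖₂|Q|² =
  -- O(r^{-3/2}). Fourth powers avoid roots and leave r⁴ · r⁻³ = r on the right, so letting r ↓ 0
  -- contradicts Q ≠ 0.
  have hb : ∀ r, 0 < r → (2 / 3 * (Real.exp (-(√z * (r * R))) / (4 * Real.pi * R)) * ‖Q‖ ^ 2) ^ 4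
      ≤ (q * ‖Q‖ ^ 2) ^ 2 * (∫ x, ρ x ^ 2) * (∫ x, green z x ^ 2) * r := by
    intro r hr
    have hs := hρ.scaled hr
    have h1 := hform (vecOf hs.memLp Q)
    have h2 : ⟪vecOf hs.memLp Q, a⟫ = 2 / 3 * (∫ x, scaled ρ r x * green z x) * ⟪Q, Q⟫ :=
      inner_vecOf_M_vecOf hs.symmetric (isRadial_green z) hs.memLp (memLp_green_scalar hz) Q Q
    have h3 : ⟪vecOf hs.memLp Q, resolvent z (vecOf hs.memLp Q)⟫
        = (∫ x, scaled ρ r x * smear z (scaled ρ r) x) * ‖Q‖ ^ 2 := by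
      rw [resolvent_vecOf hz hs.memLp, vecOf_apply, vecOf_apply, inner_toVec_toVec
        (MemLp.smul_vec hs.memLp Q) (MemLp.smul_vec (memLp_smear hz hs.memLp) Q),
        ← integral_mul_const]
      refine integral_congr_ae (Eventually.of_forall fun x => ?_)
      simp only [real_inner_smul_left, real_inner_smul_right, real_inner_self_eq_norm_sq]
      ring
    rw [h2, h3, real_inner_self_eq_norm_sq] at h1
    have h4 := le_integral_mul_green hz hs (hsupp r hr)
    have h5 : (∫ x, scaled ρ r x * smear z (scaled ρ r) x) ^ 2
        ≤ ((r ^ 3)⁻¹ * ∫ x, ρ x ^ 2) * ∫ x, green z x ^ 2 := by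
      refine (integral_mul_sq_le hs.memLp (memLp_smear hz hs.memLp)).trans ?_
      rw [integral_scaled_sq ρ hr]
      have h6 := smear_norm_le hz hs (hsupp r hr)
      have h7 : 0 ≤ ∫ x, ρ x ^ 2 := integral_nonneg fun x => sq_nonneg _
      gcongr
    set I := ∫ x, scaled ρ r x * green z x
    set J := ∫ x, scaled ρ r x * smear z (scaled ρ r) x
    have h8 : Real.exp (-(√z * (r * R))) / (4 * Real.pi * R) ≤ r * I := by
      calc _ = r * (Real.exp (-(√z * (r * R))) / (4 * Real.pi * (r * R))) := by field_simp
        _ ≤ _ := by gcongr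
    have hq0 : 0 ≤ q :=
      add_nonneg (mul_nonneg hz.le (sq_nonneg _)) (Finset.sum_nonneg fun _ _ => sq_nonneg _)
    calc _ ≤ (2 / 3 * (r * I) * ‖Q‖ ^ 2) ^ 4 := by gcongr
      _ = r ^ 4 * ((2 / 3 * I * ‖Q‖ ^ 2) ^ 2) ^ 2 := by ring
      _ ≤ r ^ 4 * (q * (J * ‖Q‖ ^ 2)) ^ 2 := by gcongr
      _ = r ^ 4 * (q * ‖Q‖ ^ 2) ^ 2 * J ^ 2 := by ring
      _ ≤ r ^ 4 * (q * ‖Q‖ ^ 2) ^ 2 * (((r ^ 3)⁻¹ * ∫ x, ρ x ^ 2) * ∫ x, green z x ^ 2) := by gcongr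
      _ = _ := by field_simp
  have hl : Tendsto (fun r : ℝ => (2 / 3 * (Real.exp (-(√z * (r * R))) / (4 * Real.pi * R))
      * ‖Q‖ ^ 2) ^ 4) (𝓝[>] 0) (𝓝 ((2 / 3 * (1 / (4 * Real.pi * R)) * ‖Q‖ ^ 2) ^ 4)) := by
    have : Continuous fun r : ℝ => (2 / 3 * (Real.exp (-(√z * (r * R))) / (4 * Real.pi * R))
      * ‖Q‖ ^ 2) ^ 4 := by fun_prop
    have h3 := (this.tendsto 0).mono_left (nhdsWithin_le_nhds (s := Set.Ioi 0))
    simpa using h3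
  have hr : Tendsto (fun r : ℝ => (q * ‖Q‖ ^ 2) ^ 2 * (∫ x, ρ x ^ 2) * (∫ x, green z x ^ 2) * r)
      (𝓝[>] 0) (𝓝 0) := by
    have : Continuous fun r : ℝ =>
      (q * ‖Q‖ ^ 2) ^ 2 * (∫ x, ρ x ^ 2) * (∫ x, green z x ^ 2) * r := by fun_prop
    have h3 := (this.tendsto 0).mono_left (nhdsWithin_le_nhds (s := Set.Ioi 0))
    simpa using h3
  have hle := le_of_tendsto_of_tendsto hl hr (by
    filter_upwards [self_mem_nhdsWithin] with r hr
    exact hb r hr)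
  have hQ0 : 0 < ‖Q‖ := norm_pos_iff.2 hQ
  have : 0 < (2 / 3 * (1 / (4 * Real.pi * R)) * ‖Q‖ ^ 2) ^ 4 := by
    have := Real.pi_pos
    positivity
  linarith

/-! ### The energy space -/

variable {z : ℝ}

theorem inner_resolventS_self (hz : 0 < z) (f : L2s) :
    ⟪resolventS hz f, f⟫ = z * ‖resolvent z f‖ ^ 2 + ∑ i, ‖weakDeriv i (resolvent z f)‖ ^ 2 := by
  rw [real_inner_comm]
  change ⟪(f : Vec), resolvent z f⟫ = _
  rw [inner_eq_form_resolvent hz f (isH1_resolvent hz f)]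
  simp only [real_inner_self_eq_norm_sq]

theorem resolventS_inner_nonneg (hz : 0 < z) (f : L2s) : 0 ≤ ⟪resolventS hz f, f⟫ := by
  rw [inner_resolventS_self]
  exact add_nonneg (mul_nonneg hz.le (sq_nonneg _)) (Finset.sum_nonneg fun _ _ => sq_nonneg _)

/-- The form ⟨Rf, f⟩ contains z‖Rf‖², and Rf = 0 forces f = (-Δ + z)Rf = 0. -/
theorem eq_zero_of_inner_resolventS (hz : 0 < z) {f : L2s} (h : ⟪resolventS hz f, f⟫ ≤ 0) :
    f = 0 := by
  rw [inner_resolventS_self] at h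
  have h1 : 0 ≤ ∑ i, ‖weakDeriv i (resolvent z f)‖ ^ 2 := Finset.sum_nonneg fun _ _ => sq_nonneg _
  have h2 : ‖resolvent z f‖ ^ 2 = 0 := by nlinarith [sq_nonneg ‖resolvent z f‖]
  have h3 : resolvent z (f : Vec) = 0 := by simpa using h2
  have h4 := neg_lap_resolvent_add hz (f : Vec)
  have h5 : lap (0 : Vec) = 0 := by
    have h6 := lap_smul (isH2_resolvent hz (f : Vec)) 0
    rwa [zero_smul, zero_smul] at h6
  rw [h3, h5, neg_zero, smul_zero, add_zero] at h4
  exact Subtype.ext h4.symm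

theorem inner_smul_left_solenoidal (a : ℝ) (f g : L2s) : ⟪a • f, g⟫ = a * ⟪f, g⟫ :=
  real_inner_smul_left (f : Vec) (g : Vec) a

theorem inner_pertRes_self (hz : 0 < z) {h : E3 → ℝ} (hh : MemLp h 2 (volume : Measure E3)) (γ : ℝ)
    (f : L2s) : ⟪pertRes hz hh γ f, f⟫ = ⟪resolventS hz f, f⟫ + γ⁻¹ * ‖pair h f‖ ^ 2 := by
  rw [pertRes_apply, inner_add_left, inner_smul_left_solenoidal, inner_solOf, real_inner_self_eq_norm_sq]

theorem isPos_pertRes (hz : 0 < z) {h : E3 → ℝ} (hh : MemLp h 2 (volume : Measure E3)) {γ : ℝ}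
    (hγ : 0 < γ) : IsPos (pertRes hz hh γ) where
  symm x y := by
    have h1 : ⟪resolventS hz x, y⟫ = ⟪x, resolventS hz y⟫ := resolvent_symm hz (x : Vec) y
    rw [pertRes_apply, pertRes_apply, inner_add_left, inner_add_right, inner_smul_left_solenoidal,
      real_inner_comm (γ⁻¹ • _) x, inner_smul_left_solenoidal, inner_solOf, inner_solOf, h1,
      real_inner_comm (pair h x)]
  nonneg f := by
    rw [inner_pertRes_self]
    exact add_nonneg (resolventS_inner_nonneg hz f) (by positivity)

theorem pertRes_injective (hz : 0 < z) {h : E3 → ℝ} (hh : MemLp h 2 (volume : Measure E3)) {γ : ℝ}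
    (hγ : 0 < γ) (f : L2s) (hf : pertRes hz hh γ f = 0) : f = 0 := by
  have h1 := inner_pertRes_self hz hh γ f
  rw [hf, inner_zero_left] at h1
  have h2 : 0 ≤ γ⁻¹ * ‖pair h f‖ ^ 2 := by positivity
  exact eq_zero_of_inner_resolventS hz (by linarith)

/-- The ambient space of the energy space. -/
abbrev Jet : Type := WithLp 2 (Vec × PiLp 2 fun _ : Fin 3 => Vec)

/-- The space `H¹_*` with the norm `(z ‖u‖² + ‖∇u‖²)^{1/2}`, as the space of the `(√z u, ∇u)`. -/
def energySubmodule (z : ℝ) : Submodule ℝ Jet where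
  carrier := {w | w.fst ∈ solenoidal ∧ ∀ i, IsWeakDeriv i w.fst (√z • w.snd i)}
  add_mem' hv hw := ⟨solenoidal.add_mem hv.1 hw.1, fun i => by
    have h := (hv.2 i).add (hw.2 i)
    rw [← smul_add] at h
    exact h⟩
  zero_mem' := ⟨solenoidal.zero_mem, fun i => by
    have h := isWeakDeriv_zero i
    rw [← smul_zero (√z)] at h
    simpa using h⟩
  smul_mem' a w hw := ⟨solenoidal.smul_mem a hw.1, fun i => by
    have h := (hw.2 i).smul a
    rw [smul_comm] at h
    exact h⟩

theorem isClosed_energySubmodule (z : ℝ) : IsClosed (energySubmodule z : Set Jet) := by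
  have h : (energySubmodule z : Set Jet) = {w : Jet | w.fst ∈ solenoidal} ∩
      ⋂ i, {w : Jet | IsWeakDeriv i w.fst (√z • w.snd i)} := by
    ext w
    simp only [Set.mem_inter_iff, Set.mem_iInter]
    rfl
  have h1 : Continuous fun w : Jet => w.fst :=
    (WithLp.fstL 2 ℝ Vec (PiLp 2 fun _ : Fin 3 => Vec)).continuous
  rw [h]
  refine (isClosed_solenoidal.preimage h1).inter
    (isClosed_iInter fun i => isClosed_isWeakDeriv i h1 ?_)
  exact ((PiLp.proj 2 (𝕜 := ℝ) (fun _ : Fin 3 => Vec) i).continuous.comp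
    (WithLp.sndL 2 ℝ Vec (PiLp 2 fun _ : Fin 3 => Vec)).continuous).const_smul (√z)

/-- The Hilbert space `H¹_*`. -/
def EnergySpace (z : ℝ) : Type := energySubmodule z

instance : NormedAddCommGroup (EnergySpace z) :=
  inferInstanceAs (NormedAddCommGroup (energySubmodule z))

instance : InnerProductSpace ℝ (EnergySpace z) :=
  inferInstanceAs (InnerProductSpace ℝ (energySubmodule z))

instance : CompleteSpace (EnergySpace z) :=
  (isClosed_energySubmodule z).completeSpace_coe

/-- The embedding of `H¹_*` in `L²_*`. -/
def embed (z : ℝ) : EnergySpace z →L[ℝ] L2s :=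
  (((√z)⁻¹ • (WithLp.fstL 2 ℝ Vec (PiLp 2 fun _ : Fin 3 => Vec)).comp
    (energySubmodule z).subtypeL).codRestrict solenoidal fun w => solenoidal.smul_mem _ w.2.1 : energySubmodule z →L[ℝ] L2s)

theorem coe_embed (w : EnergySpace z) : (embed z w : Vec) = (√z)⁻¹ • w.1.fst := rfl

/-- The element of the energy space given by a field in `H¹_*`. -/
def lift (z : ℝ) (u : L2s) (hu : IsH1 (u : Vec)) : EnergySpace z :=
  ⟨WithLp.toLp 2 (√z • (u : Vec), WithLp.toLp 2 fun i => weakDeriv i (u : Vec)),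
    solenoidal.smul_mem _ u.2, fun i => (hu.isWeakDeriv i).smul (√z)⟩

theorem embed_lift (hz : 0 < z) (u : L2s) (hu : IsH1 (u : Vec)) : embed z (lift z u hu) = u := by
  have h : √z ≠ 0 := (Real.sqrt_pos.2 hz).ne'
  refine Subtype.ext ?_
  rw [coe_embed]
  change (√z)⁻¹ • √z • (u : Vec) = u
  rw [smul_smul, inv_mul_cancel₀ h, one_smul]

theorem isWeakDeriv_embed (hz : 0 < z) (w : EnergySpace z) (i : Fin 3) :
    IsWeakDeriv i (embed z w : Vec)
      (w.1.snd i) := by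
  have h : √z ≠ 0 := (Real.sqrt_pos.2 hz).ne'
  have h1 := (w.2.2 i).smul (√z)⁻¹
  rwa [smul_smul, inv_mul_cancel₀ h, one_smul] at h1

theorem isH1_embed (hz : 0 < z) (w : EnergySpace z) : IsH1 (embed z w : Vec) :=
  fun i => ⟨_, isWeakDeriv_embed hz w i⟩

theorem embed_injective (hz : 0 < z) (w : EnergySpace z) (hw : embed z w = 0) : w = 0 := by
  have h : (√z)⁻¹ ≠ 0 := (inv_pos.2 (Real.sqrt_pos.2 hz)).ne'
  have h1 : w.1.fst = 0 := by
    have h0 := coe_embed w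
    rw [hw, eq_comm, Submodule.coe_zero, smul_eq_zero] at h0
    exact h0.resolve_left h
  have h2 : ∀ i, w.1.snd i = 0 := fun i => by
    have h3 := isWeakDeriv_embed hz w i
    rw [hw] at h3
    exact h3.unique (isWeakDeriv_zero i)
  refine Subtype.ext ((WithLp.ofLp_injective 2) (Prod.ext h1 ?_))
  exact (WithLp.ofLp_injective 2) (funext h2)

theorem inner_lift (hz : 0 < z) (u : L2s) (hu : IsH1 (u : Vec)) (w : EnergySpace z) :
    ⟪lift z u hu, w⟫ = z * ⟪(u : Vec), (embed z w : Vec)⟫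
      + ∑ i, ⟪weakDeriv i (u : Vec), weakDeriv i (embed z w : Vec)⟫ := by
  have h : √z ≠ 0 := (Real.sqrt_pos.2 hz).ne'
  change ⟪(lift z u hu).1, w.1⟫ = _
  rw [WithLp.prod_inner_apply, PiLp.inner_apply]
  congr 1
  · change ⟪√z • (u : Vec), _⟫ = z * ⟪(u : Vec), (embed z w : Vec)⟫
    rw [coe_embed, real_inner_smul_left, real_inner_smul_right, ← mul_assoc]
    congr 1
    rw [eq_mul_inv_iff_mul_eq₀ h, Real.mul_self_sqrt hz.le]
  · refine Finset.sum_congr rfl fun i _ => ?_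
    rw [(isWeakDeriv_embed hz w i).weakDeriv_eq]
    rfl

theorem norm_lift_sq (hz : 0 < z) (u : L2s) (hu : IsH1 (u : Vec)) :
    ‖lift z u hu‖ ^ 2 = gradSq u + z * ‖u‖ ^ 2 := by
  rw [← real_inner_self_eq_norm_sq, inner_lift hz, embed_lift hz, gradSq, add_comm]
  simp only [real_inner_self_eq_norm_sq]
  rfl

theorem isH1_resolventS (hz : 0 < z) (f : L2s) : IsH1 (resolventS hz f : Vec) :=
  isH1_resolvent hz (f : Vec)

/-- The variational equation of the resolvent read in the energy space. With i the embedding it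
yields R = i i*. -/
theorem adjoint_embed (hz : 0 < z) (f : L2s) : (embed z).adjoint f
    = lift z (resolventS hz f) (isH1_resolventS hz f) := by
  refine ext_inner_right ℝ fun w => ?_
  rw [ContinuousLinearMap.adjoint_inner_left, inner_lift hz]
  change ⟪(f : Vec), (embed z w : Vec)⟫ = _
  rw [inner_eq_form_resolvent hz _ (isH1_embed hz w), coe_resolventS]

theorem embed_adjoint_embed (hz : 0 < z) (f : L2s) :
    embed z ((embed z).adjoint f) = resolventS hz f := by
  rw [adjoint_embed hz, embed_lift hz]

/-! ### The forms -/

section RegularizedForm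

variable {s : E3 → ℝ} (hs : MemLp s 2 (volume : Measure E3))

/-- With P = i* ∘ (M s), the inverse operator is i(1 + γ⁻¹PP*)i*. Because P*P = ν - γ and γ⁻¹ - ν⁻¹
= γ⁻¹ν⁻¹(ν - γ), the inverse of the middle factor is 1 - ν⁻¹PP*, the form of H_r + z on H¹_*. -/
theorem exists_sqrt_preimage_regular (hz : 0 < z) (hrad : IsRadial s) {ν γ : ℝ} (hν : ν ≠ 0)
    (hγ : γ ≠ 0) (hνγ : ν - 2 / 3 * ∫ x, s x * smear z s x = γ) {K : L2s →L[ℝ] L2s}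
    (hK : IsPos K) (hKK : K * K = pertRes hz (memLp_smear hz hs) γ) {u : L2s}
    (hu : IsH1 (u : Vec)) :
    ∃ x, K x = u ∧ ‖x‖ ^ 2 = gradSq u + z * ‖u‖ ^ 2 - ν⁻¹ * ‖pair s u‖ ^ 2 := by
  set P : E3 →L[ℝ] EnergySpace z := (embed z).adjoint.comp (solOf hs) with hP
  have hPa : ∀ w, P.adjoint w = pair s (embed z w) := fun w => by
    rw [hP, ContinuousLinearMap.adjoint_comp, ContinuousLinearMap.adjoint_adjoint,
      ContinuousLinearMap.comp_apply, adjoint_solOf]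
  have hPP : ∀ Q, P.adjoint (P Q) = (ν - γ) • Q := fun Q => by
    rw [hPa, hP, ContinuousLinearMap.comp_apply, embed_adjoint_embed hz, resolventS_solOf hz hs,
      pair_solOf hrad (isRadial_smear z hrad) hs, ← hνγ]
    congr 1
    ring
  have hBC : ∀ w, (1 + γ⁻¹ • P.comp P.adjoint : EnergySpace z →L[ℝ] EnergySpace z)
      ((1 - ν⁻¹ • P.comp P.adjoint : EnergySpace z →L[ℝ] EnergySpace z) w) = w := by
    intro w
    change (w - ν⁻¹ • P (P.adjoint w)) + γ⁻¹ • P (P.adjoint (w - ν⁻¹ • P (P.adjoint w))) = w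
    rw [map_sub, map_smul, hPP, smul_smul, map_sub, map_smul, smul_sub, smul_smul]
    have h1 : γ⁻¹ * (ν⁻¹ * (ν - γ)) = γ⁻¹ - ν⁻¹ := by field_simp
    rw [h1]
    module
  have hKf : ∀ f, K (K f) = embed z ((1 + γ⁻¹ • P.comp P.adjoint :
      EnergySpace z →L[ℝ] EnergySpace z) ((embed z).adjoint f)) := by
    intro f
    have h1 : K (K f) = pertRes hz (memLp_smear hz hs) γ f := by rw [← hKK]; rfl
    rw [h1, pertRes_apply]
    change _ = embed z ((embed z).adjoint f + γ⁻¹ • P (P.adjoint ((embed z).adjoint f)))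
    rw [map_add, map_smul, embed_adjoint_embed hz, hPa, embed_adjoint_embed hz,
      pair_resolventS hz hs, hP, ContinuousLinearMap.comp_apply, embed_adjoint_embed hz,
      resolventS_solOf hz hs]
  obtain ⟨x, hx1, hx2⟩ := exists_sqrt_preimage (embed z) (embed_injective hz) hBC hK hKf
    (lift z u hu)
  refine ⟨x, hx1.trans (embed_lift hz u hu), ?_⟩
  rw [hx2]
  change ⟪lift z u hu - ν⁻¹ • P (P.adjoint (lift z u hu)), lift z u hu⟫ = _
  rw [inner_sub_left, real_inner_self_eq_norm_sq, norm_lift_sq hz, real_inner_smul_left,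
    ← ContinuousLinearMap.adjoint_inner_right, hPa, embed_lift hz, real_inner_self_eq_norm_sq]

end RegularizedForm

/-- Use j(v, k) = i v + γ^{-1/2} g k on the direct sum: j j* = i i* + γ⁻¹ g g*, so
`exists_sqrt_preimage` applies with B = C = 1. The independence of the two ranges is injectivity of
j. -/
theorem exists_sqrt_preimage_prod {H 𝓗 F : Type*} [NormedAddCommGroup H] [InnerProductSpace ℝ H]
    [CompleteSpace H] [NormedAddCommGroup 𝓗] [InnerProductSpace ℝ 𝓗] [CompleteSpace 𝓗]
    [NormedAddCommGroup F] [InnerProductSpace ℝ F] [CompleteSpace F] (i : 𝓗 →L[ℝ] H)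
    (g : F →L[ℝ] H) (hi : ∀ v k, i v + g k = 0 → v = 0 ∧ k = 0) {γ : ℝ} (hγ : 0 < γ)
    {K : H →L[ℝ] H} (hK : IsPos K)
    (hKK : ∀ f, K (K f) = i (i.adjoint f) + γ⁻¹ • g (g.adjoint f)) (v : 𝓗) (k : F) :
    ∃ x, K x = i v + g k ∧ ‖x‖ ^ 2 = ‖v‖ ^ 2 + γ * ‖k‖ ^ 2 := by
  have hsγ : √γ ≠ 0 := (Real.sqrt_pos.2 hγ).ne'
  set j : WithLp 2 (𝓗 × F) →L[ℝ] H :=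
    i.comp (WithLp.fstL 2 ℝ 𝓗 F) + (√γ)⁻¹ • g.comp (WithLp.sndL 2 ℝ 𝓗 F) with hj
  have hj1 : ∀ w, j w = i w.fst + (√γ)⁻¹ • g w.snd := fun w => rfl
  have hja : ∀ f, j.adjoint f = WithLp.toLp 2 (i.adjoint f, (√γ)⁻¹ • g.adjoint f) := fun f => by
    refine ext_inner_right ℝ fun w => ?_
    rw [ContinuousLinearMap.adjoint_inner_left, hj1, WithLp.prod_inner_apply, inner_add_right,
      real_inner_smul_right, real_inner_smul_left, ContinuousLinearMap.adjoint_inner_left,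
      ContinuousLinearMap.adjoint_inner_left]
    rfl
  obtain ⟨x, hx1, hx2⟩ := exists_sqrt_preimage j (fun w hw => by
      rw [hj1, ← map_smul] at hw
      obtain ⟨h1, h2⟩ := hi _ _ hw
      exact (WithLp.ofLp_injective 2) (Prod.ext h1
        ((smul_eq_zero.1 h2).resolve_left (inv_ne_zero hsγ))))
    (B := 1) (C := 1) (fun _ => rfl) hK (fun f => by
      rw [hKK]
      change _ = j (j.adjoint f)
      rw [hja, hj1]
      change _ = i (i.adjoint f) + (√γ)⁻¹ • g ((√γ)⁻¹ • g.adjoint f)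
      rw [map_smul, smul_smul, ← mul_inv, Real.mul_self_sqrt hγ.le])
    (WithLp.toLp 2 (v, √γ • k))
  refine ⟨x, ?_, ?_⟩
  · rw [hx1, hj1]
    change i v + (√γ)⁻¹ • g (√γ • k) = _
    rw [map_smul, smul_smul, inv_mul_cancel₀ hsγ, one_smul]
  · rw [hx2]
    change ⟪(WithLp.toLp 2 (v, √γ • k) : WithLp 2 (𝓗 × F)), _⟫ = _
    rw [real_inner_self_eq_norm_sq, WithLp.prod_norm_sq_eq_of_L2]
    change ‖v‖ ^ 2 + ‖√γ • k‖ ^ 2 = _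
    rw [norm_smul, mul_pow, Real.norm_eq_abs, sq_abs, Real.sq_sqrt hγ.le]

/-- The singular fields lie outside H¹, so the splitting of a form domain element into regular part
and charge is unique, as the direct sum requires. -/
theorem exists_sqrt_preimage_limit (hz : 0 < z)
    (hMG : ∀ Q, IsH1 (MG z Q : Vec) → Q = 0) {γ : ℝ} (hγ : 0 < γ) {K : L2s →L[ℝ] L2s}
    (hK : IsPos K) (hKK : K * K = pertRes hz (memLp_green_scalar hz) γ) {v : L2s}
    (hv : IsH1 (v : Vec)) (k : E3) :
    ∃ x, K x = v + MG z k ∧ ‖x‖ ^ 2 = gradSq v + z * ‖v‖ ^ 2 + γ * ‖k‖ ^ 2 := by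
  obtain ⟨x, hx1, hx2⟩ := exists_sqrt_preimage_prod (embed z) (solOf (memLp_green_scalar hz))
    (fun w k hw => by
      have h1 : k = 0 := by
        refine hMG k ?_
        have h2 : MG z k = (-1 : ℝ) • embed z w := by
          rw [neg_one_smul, eq_neg_iff_add_eq_zero, add_comm]
          exact hw
        rw [h2]
        exact (isH1_embed hz w).smul (-1)
      rw [h1, map_zero, add_zero] at hw
      exact ⟨embed_injective hz w hw, h1⟩)
    hγ hK (fun f => by
      have h1 : K (K f) = pertRes hz (memLp_green_scalar hz) γ f := by rw [← hKK]; rfl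
      rw [h1, pertRes_apply, embed_adjoint_embed hz, adjoint_solOf])
    (lift z v hv) k
  refine ⟨x, ?_, ?_⟩
  · rw [hx1, embed_lift hz]
    rfl
  · rw [hx2, norm_lift_sq hz]

/-! ### Convergence of the resolvents -/

variable {z : ℝ} {ρ : E3 → ℝ}

section Abstract

variable {H F ι : Type*} [NormedAddCommGroup H] [InnerProductSpace ℝ H]
  [NormedAddCommGroup F] [InnerProductSpace ℝ F] [CompleteSpace F] {l : Filter ι}

theorem tendsto_adjoint_apply [CompleteSpace H] {g : ι → F →L[ℝ] H} {g₀ : F →L[ℝ] H}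
    (h : Tendsto (fun r => ‖g r - g₀‖) l (𝓝 0)) (f : H) :
    Tendsto (fun r => (g r).adjoint f) l (𝓝 (g₀.adjoint f)) := by
  have h1 := (ContinuousLinearMap.adjoint (𝕜 := ℝ) (E := F) (F := H)).continuous.tendsto g₀ |>.comp
    (tendsto_iff_norm_sub_tendsto_zero.2 h)
  have h2 : Continuous fun T : H →L[ℝ] F => T f := by fun_prop
  exact (h2.tendsto _).comp h1

theorem tendsto_norm_perturbation [CompleteSpace H] {g : ι → F →L[ℝ] H} {g₀ : F →L[ℝ] H} (R : H →L[ℝ] H)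
    {γ : ι → ℝ} {γ₀ : ℝ} (hγ₀ : γ₀ ≠ 0) (hγ : Tendsto γ l (𝓝 γ₀))
    (h : Tendsto (fun r => ‖g r - g₀‖) l (𝓝 0)) :
    Tendsto (fun r => ‖(R + (γ r)⁻¹ • (g r).comp (g r).adjoint)
      - (R + γ₀⁻¹ • g₀.comp g₀.adjoint)‖) l (𝓝 0) := by
  have h1 := tendsto_iff_norm_sub_tendsto_zero.2 h
  have h2 := (ContinuousLinearMap.adjoint (𝕜 := ℝ) (E := F) (F := H)).continuous.tendsto g₀ |>.comp h1
  have hc : Continuous fun T : (F →L[ℝ] H) × (H →L[ℝ] F) => T.1.comp T.2 := by fun_prop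
  have h3 : Tendsto (fun r => (g r).comp (g r).adjoint) l (𝓝 (g₀.comp g₀.adjoint)) :=
    (hc.tendsto (g₀, g₀.adjoint)).comp (h1.prodMk_nhds h2)
  exact tendsto_iff_norm_sub_tendsto_zero.1 (tendsto_const_nhds.add ((hγ.inv₀ hγ₀).smul h3))

theorem norm_le_sum_norm_single (T : E3 →L[ℝ] H) :
    ‖T‖ ≤ ∑ i, ‖T (EuclideanSpace.single i 1)‖ := by
  refine T.opNorm_le_bound (Finset.sum_nonneg fun _ _ => norm_nonneg _) fun Q => ?_
  have hQ : Q = ∑ i, Q i • (EuclideanSpace.single i 1 : E3) := by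
    ext j
    simp [Pi.single_apply]
  conv_lhs => rw [hQ]
  rw [map_sum, Finset.sum_mul]
  refine (norm_sum_le _ _).trans (Finset.sum_le_sum fun i _ => ?_)
  rw [map_smul, norm_smul, mul_comm]
  gcongr
  exact PiLp.norm_apply_le Q i

theorem tendsto_norm_of_single {g : ι → E3 →L[ℝ] H} {g₀ : E3 →L[ℝ] H}
    (h : ∀ Q, Tendsto (fun r => ‖g r Q - g₀ Q‖) l (𝓝 0)) :
    Tendsto (fun r => ‖g r - g₀‖) l (𝓝 0) := by
  have h1 := tendsto_finsetSum Finset.univ fun (i : Fin 3) _ => h (EuclideanSpace.single i 1)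
  rw [Finset.sum_const_zero] at h1
  exact squeeze_zero (fun _ => norm_nonneg _) (fun r => norm_le_sum_norm_single (g r - g₀)) h1

theorem IsPos.denseRange [CompleteSpace H] {K : H →L[ℝ] H} (hK : IsPos K) (h : ∀ x, K x = 0 → x = 0) :
    DenseRange K := by
  have h1 : (LinearMap.range (K : H →ₗ[ℝ] H)).topologicalClosure = ⊤ := by
    rw [Submodule.topologicalClosure_eq_top_iff, Submodule.eq_bot_iff]
    intro y hy
    refine h y (ext_inner_right ℝ fun x => ?_)
    rw [hK.symm, inner_zero_left, real_inner_comm]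
    exact hy (K x) ⟨x, rfl⟩
  have h2 := Submodule.dense_iff_topologicalClosure_eq_top.2 h1
  exact h2

/-- By `IsPos.norm_sub_sq_le` the roots converge in norm, and evaluation is jointly continuous. -/
theorem IsPos.tendsto_apply {K : ι → H →L[ℝ] H} {L : H →L[ℝ] H} (hK : ∀ᶠ r in l, IsPos (K r))
    (hL : IsPos L) (h : Tendsto (fun r => ‖K r * K r - L * L‖) l (𝓝 0)) {x : ι → H} {y : H}
    (hx : Tendsto x l (𝓝 y)) : Tendsto (fun r => K r (x r)) l (𝓝 (L y)) := by
  have h1 := (Real.continuous_sqrt.tendsto 0).comp h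
  rw [Real.sqrt_zero] at h1
  have h2 : Tendsto K l (𝓝 L) := by
    rw [tendsto_iff_norm_sub_tendsto_zero]
    refine squeeze_zero' (Eventually.of_forall fun _ => norm_nonneg _) ?_ h1
    filter_upwards [hK] with r hr
    exact Real.le_sqrt_of_sq_le (hr.norm_sub_sq_le hL)
  have hc : Continuous fun T : (H →L[ℝ] H) × H => T.1 T.2 := by fun_prop
  exact (hc.tendsto (L, y)).comp (h2.prodMk_nhds hx)

end Abstract

theorem tendsto_norm_solOf (hz : 0 < z) (hρ : IsDensity ρ) :
    Tendsto (fun r => ‖solOf (memLp_smear hz (hρ.memLp_scaled r)) - solOf (memLp_green_scalar hz)‖)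
      (𝓝[>] 0) (𝓝 0) :=
  tendsto_norm_of_single (tendsto_norm_solOf_sub hz hρ)

theorem tendsto_pertRes (hz : 0 < z) (hρ : IsDensity ρ) {γ : ℝ → ℝ} {γ₀ : ℝ} (hγ₀ : γ₀ ≠ 0)
    (hγ : Tendsto γ (𝓝[>] 0) (𝓝 γ₀)) :
    Tendsto (fun r => ‖pertRes hz (memLp_smear hz (hρ.memLp_scaled r)) (γ r)
      - pertRes hz (memLp_green_scalar hz) γ₀‖) (𝓝[>] 0) (𝓝 0) :=
  tendsto_norm_perturbation (resolventS hz) hγ₀ hγ (tendsto_norm_solOf hz hρ)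

theorem tendsto_pair_smear (hz : 0 < z) (hρ : IsDensity ρ) (f : L2s) :
    Tendsto (fun r => pair (smear z (scaled ρ r)) f) (𝓝[>] 0) (𝓝 (pair (green z) f)) := by
  have h := tendsto_adjoint_apply (tendsto_norm_solOf hz hρ) f
  rw [adjoint_solOf] at h
  exact h.congr fun r => adjoint_solOf (memLp_smear hz (hρ.memLp_scaled r)) f

/-! ### The charge of the regularized system -/

section Charge

variable {s : E3 → ℝ} {ν γ : ℝ} {K : L2s →L[ℝ] L2s}

/-- Makes the charge of K(Kf) explicit: after division by ν it is γ⁻¹⟨G_z * s, f⟩, free of the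
divergent ν. -/
theorem pair_pertRes (hz : 0 < z) (hs : MemLp s 2 (volume : Measure E3)) (hrad : IsRadial s)
    (hγ : γ ≠ 0) (hνγ : ν - 2 / 3 * ∫ x, s x * smear z s x = γ) (f : L2s) :
    pair s (pertRes hz (memLp_smear hz hs) γ f) = (ν * γ⁻¹) • pair (smear z s) f := by
  have hu := memLp_smear hz hs
  rw [pertRes_apply, ← adjoint_solOf hs, map_add, map_smul, adjoint_solOf, adjoint_solOf,
    pair_resolventS hz hs, pair_solOf hrad (isRadial_smear z hrad) hs, smul_smul]
  trans (1 + γ⁻¹ * (ν - γ)) • pair (smear z s) f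
  · rw [add_smul, one_smul, ← hνγ, sub_sub_cancel]
  · congr 1
    field_simp
    ring

/-- The bound involves ν only through the scaled charge. For p = ⟨s, Kx⟩ one has |p|² = ⟨K M(sp),
x⟩, and ‖K M(sp)‖² = νγ⁻¹(ν - γ)|p|² ≤ γ⁻¹ν²|p|². -/
theorem norm_pair_sqrt_le (hz : 0 < z) (hs : MemLp s 2 (volume : Measure E3)) (hrad : IsRadial s)
    (hν : 0 < ν) (hγ : 0 < γ) (hνγ : ν - 2 / 3 * ∫ x, s x * smear z s x = γ) (hK : IsPos K)
    (hKK : K * K = pertRes hz (memLp_smear hz hs) γ) (x : L2s) :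
    ‖ν⁻¹ • pair s (K x)‖ ^ 2 ≤ γ⁻¹ * ‖x‖ ^ 2 := by
  set p := pair s (K x) with hp
  have h1 : ‖p‖ ^ 2 ≤ ‖K (solOf hs p)‖ * ‖x‖ := by
    rw [← real_inner_self_eq_norm_sq]
    conv_lhs => rw [hp]
    rw [← hp, ← inner_solOf hs, ← hK.symm]
    exact real_inner_le_norm _ _
  have h2 : ‖K (solOf hs p)‖ ^ 2 = (ν * γ⁻¹) * (ν - γ) * ‖p‖ ^ 2 := by
    have h3 : K (K (solOf hs p)) = pertRes hz (memLp_smear hz hs) γ (solOf hs p) := by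
      rw [← hKK]
      rfl
    rw [← real_inner_self_eq_norm_sq, hK.symm, h3, inner_solOf, pair_pertRes hz hs hrad hγ.ne' hνγ,
      ← pair_resolventS hz hs, resolventS_solOf hz hs,
      pair_solOf hrad (isRadial_smear z hrad) hs, smul_smul, real_inner_smul_right,
      real_inner_self_eq_norm_sq, ← hνγ, sub_sub_cancel]
  have h4 : ‖K (solOf hs p)‖ ^ 2 ≤ γ⁻¹ * ν ^ 2 * ‖p‖ ^ 2 := by
    rw [h2]
    have : ν * γ⁻¹ * (ν - γ) = γ⁻¹ * ν ^ 2 - ν := by field_simp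
    rw [this]
    nlinarith [sq_nonneg ‖p‖]
  have h5 : (‖p‖ ^ 2) ^ 2 ≤ γ⁻¹ * ν ^ 2 * ‖x‖ ^ 2 * ‖p‖ ^ 2 := by
    calc (‖p‖ ^ 2) ^ 2 ≤ (‖K (solOf hs p)‖ * ‖x‖) ^ 2 := by gcongr
      _ = ‖K (solOf hs p)‖ ^ 2 * ‖x‖ ^ 2 := by ring
      _ ≤ γ⁻¹ * ν ^ 2 * ‖p‖ ^ 2 * ‖x‖ ^ 2 := by gcongr
      _ = _ := by ring
  have h6 : ‖p‖ ^ 2 ≤ γ⁻¹ * ν ^ 2 * ‖x‖ ^ 2 := by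
    rcases eq_or_lt_of_le (sq_nonneg ‖p‖) with h0 | h0
    · rw [← h0]
      positivity
    · rw [sq (‖p‖ ^ 2)] at h5
      exact le_of_mul_le_mul_right h5 h0
  rw [norm_smul, mul_pow, norm_inv, Real.norm_of_nonneg hν.le, inv_pow,
    inv_mul_le_iff₀ (by positivity)]
  linarith

end Charge

/-- Γ_m(λ) = (√λ - 3mc²/2e²) / 6π, and λ₀ is the square of the number subtracted. -/
theorem Gam_pos {c e m lam : ℝ} (he : e ≠ 0) (hlam : lam0 c e m < lam) :
    0 < Gam c e m lam := by
  have he2 : 0 < e ^ 2 := by positivity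
  have h1 : 3 * m * c ^ 2 / (2 * e ^ 2) < √lam := by
    refine Real.lt_sqrt_of_sq_lt ?_
    exact hlam
  have h2 : Gam c e m lam = (√lam - 3 * m * c ^ 2 / (2 * e ^ 2)) / (6 * Real.pi) := by
    rw [Gam]
    field_simp
    ring
  rw [h2]
  exact div_pos (by linarith) (by positivity)

theorem gradSq_nonneg (A : Vec) : 0 ≤ gradSq A := Finset.sum_nonneg fun _ _ => sq_nonneg _

/-- With m_r = -4πe²ν_r/c², the term e²|⟨ρ_r, A⟩|²/(2m_r c²) is -ν_r⁻¹|⟨ρ_r, A⟩|²/8π and joins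
‖∇A‖²/8π to the form of H_r. The mixed term contains only the scaled charge ν_r⁻¹⟨ρ_r, A⟩. -/
theorem regHamiltonian_eq {c e m r : ℝ} (hc : c ≠ 0) (he : e ≠ 0) (V : E3 → ℝ) (A E : L2s)
    (q p : E3) (hν : invCoupling c e m ρ r ≠ 0) :
    regHamiltonian c e m ρ V r A E q p = 2 * Real.pi * c ^ 2 * ‖E‖ ^ 2
      + 1 / (8 * Real.pi) * (gradSq A - (invCoupling c e m ρ r)⁻¹ * ‖pair (scaled ρ r) A‖ ^ 2)
      - c ^ 2 / (8 * Real.pi * e ^ 2) * (invCoupling c e m ρ r)⁻¹ * ‖p‖ ^ 2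
      + ⟪p, (c / (4 * Real.pi * e)) • (invCoupling c e m ρ r)⁻¹ • pair (scaled ρ r) A⟫ + V q := by
  have hmass : mass c e m ρ r = -(4 * Real.pi * e ^ 2 / c ^ 2 * invCoupling c e m ρ r) := by
    rw [invCoupling]
    field_simp
  rw [regHamiltonian, hmass, norm_sub_sq_real, real_inner_smul_right, real_inner_smul_right,
    real_inner_smul_right, norm_smul, mul_pow, Real.norm_eq_abs, sq_abs]
  field_simp
  ring

theorem MG_smul (z a : ℝ) (hz : 0 < z) (Q : E3) : MG z (a • Q) = a • MG z Q :=
  map_smul (solOf (memLp_green_scalar hz)) a Q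

/-! ### Convergence of the energy -/

section Limit

variable {z γ : ℝ} {K : L2s →L[ℝ] L2s}

/-- The counterpart for the limit of the uniform charge bound: x - Kf has charge k - γ⁻¹⟨G_z, f⟩,
and by `exists_sqrt_preimage_limit` its squared norm is at least γ times that of the charge. -/
theorem norm_charge_sub_le (hz : 0 < z) (hMG : ∀ Q, IsH1 (MG z Q : Vec) → Q = 0) (hγ : 0 < γ)
    (hK : IsPos K) (hKK : K * K = pertRes hz (memLp_green_scalar hz) γ) {v : L2s}
    (hv : IsH1 (v : Vec)) {k : E3} {x : L2s} (hx : K x = v + MG z k) (f : L2s) :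
    ‖k - γ⁻¹ • pair (green z) f‖ ^ 2 ≤ γ⁻¹ * ‖x - K f‖ ^ 2 := by
  have hKK' : ∀ f, K (K f) = pertRes hz (memLp_green_scalar hz) γ f := fun f => by rw [← hKK]; rfl
  have hv' : IsH1 ((v - resolventS hz f : L2s) : Vec) := hv.sub (isH1_resolventS hz f)
  obtain ⟨y, hy1, hy2⟩ := exists_sqrt_preimage_limit hz hMG hγ hK hKK hv' (k - γ⁻¹ • pair (green z) f)
  have h1 : K (x - K f) = K y := by
    have h2 : MG z (k - γ⁻¹ • pair (green z) f)
        = MG z k - γ⁻¹ • solOf (memLp_green_scalar hz) (pair (green z) f) := by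
      rw [← map_smul]
      exact map_sub (solOf (memLp_green_scalar hz)) _ _
    rw [map_sub, hx, hKK', hy1, pertRes_apply, h2]
    abel
  have h3 : x - K f = y := by
    have h4 : x - K f - y = 0 := by
      refine pertRes_injective hz (memLp_green_scalar hz) hγ _ ?_
      rw [← hKK', map_sub, h1, sub_self, map_zero]
    exact sub_eq_zero.1 h4
  rw [h3, hy2]
  have h5 := gradSq_nonneg ((v - resolventS hz f : L2s) : Vec)
  have h6 : 0 ≤ z * ‖v - resolventS hz f‖ ^ 2 := by positivity
  rw [mul_add, ← mul_assoc γ⁻¹ γ, inv_mul_cancel₀ hγ.ne', one_mul]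
  have h7 : 0 ≤ γ⁻¹ * (gradSq ((v - resolventS hz f : L2s) : Vec) + z * ‖v - resolventS hz f‖ ^ 2) := by
    positivity
  linarith

/-- Compare with x = Kf, where both charges are explicit and converge. The two uniform charge bounds
control the error of replacing X r by K_r f and x by Kf. -/
theorem tendsto_charge (hz : 0 < z) {ρ : E3 → ℝ} (hρ : IsDensity ρ) (hγ : 0 < γ)
    (hK : IsPos K) (hKK : K * K = pertRes hz (memLp_green_scalar hz) γ) {ν γr : ℝ → ℝ}
    {Kr : ℝ → L2s →L[ℝ] L2s} (hνpos : ∀ᶠ r in 𝓝[>] 0, 0 < ν r)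
    (hγr : Tendsto γr (𝓝[>] 0) (𝓝 γ))
    (hνγ : ∀ r, ν r - 2 / 3 * ∫ x, scaled ρ r x * smear z (scaled ρ r) x = γr r)
    (hKr : ∀ᶠ r in 𝓝[>] 0, IsPos (Kr r) ∧
      Kr r * Kr r = pertRes hz (memLp_smear hz (hρ.memLp_scaled r)) (γr r))
    {X : ℝ → L2s} {x : L2s} (hX : Tendsto X (𝓝[>] 0) (𝓝 x)) {v : L2s} (hv : IsH1 (v : Vec)) {k : E3}
    (hx : K x = v + MG z k) :
    Tendsto (fun r => (ν r)⁻¹ • pair (scaled ρ r) (Kr r (X r))) (𝓝[>] 0) (𝓝 k) ∧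
      Tendsto (fun r => Kr r (X r)) (𝓝[>] 0) (𝓝 (K x)) := by
  have hMG : ∀ Q, IsH1 (MG z Q : Vec) → Q = 0 := fun Q => eq_zero_of_isH1_MG hz hρ
  have hKlim : ∀ {X : ℝ → L2s} {x : L2s}, Tendsto X (𝓝[>] 0) (𝓝 x) →
      Tendsto (fun r => Kr r (X r)) (𝓝[>] 0) (𝓝 (K x)) := fun hX => by
    refine IsPos.tendsto_apply (hKr.mono fun r h => h.1) hK ?_ hX
    rw [hKK]
    refine (tendsto_pertRes hz hρ hγ.ne' hγr).congr' ?_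
    filter_upwards [hKr] with r hr
    rw [hr.2]
  refine ⟨?_, hKlim hX⟩
  have hinj : ∀ y, K y = 0 → y = 0 := fun y hy =>
    pertRes_injective hz (memLp_green_scalar hz) hγ y (by
      rw [← hKK]
      change K (K y) = 0
      rw [hy, map_zero])
  -- Since γ_r > γ/2 eventually, b serves as the constant in the charge bounds of both the
  -- regularized and the limit operator.
  set b : ℝ := √(2 / γ) with hb
  have hb0 : 0 < b := Real.sqrt_pos.2 (by positivity)
  have hle : ∀ {t : ℝ} {a : E3} {y : L2s}, 0 < t → t⁻¹ ≤ 2 / γ → ‖a‖ ^ 2 ≤ t⁻¹ * ‖y‖ ^ 2 →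
      ‖a‖ ≤ b * ‖y‖ := by
    intro t a y _ ht h
    refine (pow_le_pow_iff_left₀ (norm_nonneg _) (by positivity) two_ne_zero).1 ?_
    rw [mul_pow, hb, Real.sq_sqrt (by positivity)]
    exact h.trans (by gcongr)
  rw [Metric.tendsto_nhds]
  intro ε hε
  -- With this choice each of the three errors is at most ε/4.
  obtain ⟨f, hf⟩ := (IsPos.denseRange hK hinj).exists_dist_lt x (show 0 < ε / (4 * b) by positivity)
  rw [dist_eq_norm, lt_div_iff₀ (by positivity)] at hf
  have h1 : ∀ᶠ r in 𝓝[>] 0, b * ‖X r - Kr r f‖ < ε / 4 := by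
    have h2 := ((hX.sub (hKlim (tendsto_const_nhds (x := f)))).norm).const_mul b
    exact h2.eventually_lt_const (by linarith)
  have h3 : ∀ᶠ r in 𝓝[>] 0,
      ‖(γr r)⁻¹ • pair (smear z (scaled ρ r)) f - γ⁻¹ • pair (green z) f‖ < ε / 4 := by
    have h4 := (hγr.inv₀ hγ.ne').smul (tendsto_pair_smear hz hρ f)
    exact (tendsto_iff_norm_sub_tendsto_zero.1 h4).eventually_lt_const (by linarith)
  have h5 : ∀ᶠ r in 𝓝[>] 0, γ / 2 < γr r := hγr.eventually_const_lt (by linarith)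
  have h6 : ‖k - γ⁻¹ • pair (green z) f‖ ≤ b * ‖x - K f‖ :=
    hle hγ (by rw [← one_div]; gcongr; norm_num) (norm_charge_sub_le hz hMG hγ hK hKK hv hx f)
  filter_upwards [h1, h3, h5, hνpos, hKr, self_mem_nhdsWithin] with r hr1 hr3 hr5 hr7 hr8 hr9
  have hγr0 : 0 < γr r := by linarith
  have hrad := (hρ.scaled hr9).symmetric
  have h9 : ‖(ν r)⁻¹ • pair (scaled ρ r) (Kr r (X r - Kr r f))‖ ≤ b * ‖X r - Kr r f‖ := by
    refine hle hγr0 ?_ (norm_pair_sqrt_le hz (hρ.memLp_scaled r) hrad hr7 hγr0 (hνγ r) hr8.1 hr8.2 _)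
    rw [inv_le_comm₀ hγr0 (by positivity), inv_div]
    exact hr5.le
  have h10 : (ν r)⁻¹ • pair (scaled ρ r) (Kr r (X r - Kr r f))
      = (ν r)⁻¹ • pair (scaled ρ r) (Kr r (X r)) - (γr r)⁻¹ • pair (smear z (scaled ρ r)) f := by
    have h11 : Kr r (Kr r f) = pertRes hz (memLp_smear hz (hρ.memLp_scaled r)) (γr r) f := by
      rw [← hr8.2]
      rfl
    have h12 : pair (scaled ρ r) (Kr r (X r - Kr r f))
        = pair (scaled ρ r) (Kr r (X r)) - pair (scaled ρ r) (Kr r (Kr r f)) := by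
      rw [map_sub, ← adjoint_solOf (hρ.memLp_scaled r), map_sub, adjoint_solOf, adjoint_solOf]
    rw [h12, h11, pair_pertRes hz (hρ.memLp_scaled r) hrad hγr0.ne' (hνγ r), smul_sub, smul_smul,
      inv_mul_cancel_left₀ hr7.ne']
  rw [h10] at h9
  rw [dist_eq_norm]
  have h13 : (ν r)⁻¹ • pair (scaled ρ r) (Kr r (X r)) - k
      = ((ν r)⁻¹ • pair (scaled ρ r) (Kr r (X r)) - (γr r)⁻¹ • pair (smear z (scaled ρ r)) f)
        + ((γr r)⁻¹ • pair (smear z (scaled ρ r)) f - γ⁻¹ • pair (green z) f)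
        - (k - γ⁻¹ • pair (green z) f) := by abel
  rw [h13]
  have h14 := norm_sub_le (((ν r)⁻¹ • pair (scaled ρ r) (Kr r (X r))
      - (γr r)⁻¹ • pair (smear z (scaled ρ r)) f)
        + ((γr r)⁻¹ • pair (smear z (scaled ρ r)) f - γ⁻¹ • pair (green z) f))
        (k - γ⁻¹ • pair (green z) f)
  have h15 := norm_add_le ((ν r)⁻¹ • pair (scaled ρ r) (Kr r (X r))
      - (γr r)⁻¹ • pair (smear z (scaled ρ r)) f)
      ((γr r)⁻¹ • pair (smear z (scaled ρ r)) f - γ⁻¹ • pair (green z) f)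
  nlinarith

end Limit

/-! ### The limit of the Hamiltonian -/

theorem tendsto_regHamiltonian {c e m : ℝ} (hc : 0 < c) (he : e ≠ 0) {ρ : E3 → ℝ}
    (hρ : IsDensity ρ) (V : E3 → ℝ) {z : ℝ} (hlam : lam0 c e m < z) (E : L2s) (q p : E3)
    {Ar : ℝ → L2s} (hAr : ∀ r : ℝ, 0 < r → IsH1 (Ar r : Vec)) {A : L2s}
    (hA : A ∈ formDomain c e z) (hconv : EnergyConv c e m ρ z Ar A) :
    Tendsto (fun r : ℝ => regHamiltonian c e m ρ V r (Ar r) E q p) (𝓝[>] 0)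
      (𝓝 (limHamiltonian c e m z V A E q p)) := by
  have hz : 0 < z := lt_of_le_of_lt (sq_nonneg _) hlam
  have hγ := Gam_pos he hlam
  set γ := Gam c e m z with hγdef
  set κ := 4 * Real.pi * e / c with hκ
  have hκ0 : κ ≠ 0 := div_ne_zero (mul_ne_zero (by positivity) he) hc.ne'
  have hγr := tendsto_regGam hz hc.ne' he m hρ
  have hνt := tendsto_invCoupling hz hc.ne' he m hρ
  have hνpos := hνt.eventually_gt_atTop 0
  have hγpos := hγr.eventually_const_lt hγ
  have hMG : ∀ Q, IsH1 (MG z Q : Vec) → Q = 0 := fun Q => eq_zero_of_isH1_MG hz hρ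
  obtain ⟨K, hK, hKK, hKs⟩ := exists_sqrtApply_eq (isPos_pertRes hz (memLp_green_scalar hz) hγ)
    (pertRes_injective hz (memLp_green_scalar hz) hγ)
  -- γ_r is positive only for small r; for the other r the value of Kr is immaterial and 0 is taken.
  have hex : ∀ r, ∃ Kr : L2s →L[ℝ] L2s, 0 < regGam c e m z ρ r → IsPos Kr ∧
      Kr * Kr = pertRes hz (memLp_smear hz (hρ.memLp_scaled r)) (regGam c e m z ρ r) ∧
      ∀ x, sqrtApply (invGraph (pertRes hz (memLp_smear hz (hρ.memLp_scaled r))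
        (regGam c e m z ρ r))) (Kr x) = x := by
    intro r
    by_cases h : 0 < regGam c e m z ρ r
    · obtain ⟨L, h1, h2, h3⟩ := exists_sqrtApply_eq
        (isPos_pertRes hz (memLp_smear hz (hρ.memLp_scaled r)) h)
        (pertRes_injective hz (memLp_smear hz (hρ.memLp_scaled r)) h)
      exact ⟨L, fun _ => ⟨h1, h2, h3⟩⟩
    · exact ⟨0, fun h' => absurd h' h⟩
  choose Kr hKr using hex
  set Q := charge c e z A with hQ
  have hv : IsH1 (regPart c e z A Q : Vec) := by
    have h : ∃ Q : E3, IsH1 (regPart c e z A Q : Vec) := hA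
    have hch : Q = h.choose := by rw [hQ, charge, dif_pos h]
    rw [hch]
    exact h.choose_spec
  -- The factor 4πe/c is absorbed into the charge vector, so the abstract charge k is κQ.
  have hAQ : A = regPart c e z A Q + MG z (κ • Q) := by
    rw [MG_smul z κ hz, regPart, sub_add_cancel]
  obtain ⟨x, hx1, hx2⟩ := exists_sqrt_preimage_limit hz hMG hγ hK hKK hv (κ • Q)
  set X : ℝ → L2s := fun r => sqrtApply (shift (Hreg c e m ρ r) z) (Ar r) with hXdef
  have hxA : sqrtApply (shift (Hlim c e m z) z) A = x := by
    rw [shift_Hlim_eq hz hc.ne' he hγ.ne', hAQ, ← hx1]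
    exact hKs x
  have hX : Tendsto X (𝓝[>] 0) (𝓝 x) := by
    rw [tendsto_iff_norm_sub_tendsto_zero, ← hxA]
    exact hconv
  -- For small r the preimage of A_r under K_r is X r, so the form value is attached to the vector
  -- whose convergence is assumed.
  have hgood : ∀ᶠ r in 𝓝[>] 0, Kr r (X r) = Ar r ∧ ‖X r‖ ^ 2 = gradSq (Ar r) + z * ‖Ar r‖ ^ 2
      - (invCoupling c e m ρ r)⁻¹ * ‖pair (scaled ρ r) (Ar r)‖ ^ 2 := by
    filter_upwards [hνpos, hγpos, self_mem_nhdsWithin] with r hr1 hr2 hr3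
    obtain ⟨h1, h2, h3⟩ := hKr r hr2
    have hrad := (hρ.scaled hr3).symmetric
    obtain ⟨y, hy1, hy2⟩ := exists_sqrt_preimage_regular (hρ.memLp_scaled r) hz hrad hr1.ne' hr2.ne'
      rfl h1 h2 (hAr r hr3)
    have h4 : X r = y := by
      rw [hXdef]
      simp only
      rw [shift_Hreg_eq hz (hρ.memLp_scaled r) hrad hr1.ne' (coupling_eq c e m ρ r) hr2.ne' rfl, ← hy1]
      exact h3 y
    rw [h4]
    exact ⟨hy1, hy2⟩
  obtain ⟨hk, hAlim⟩ := tendsto_charge hz hρ hγ hK hKK hνpos hγr (fun r => rfl)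
    (hγpos.mono fun r hr => ⟨(hKr r hr).1, (hKr r hr).2.1⟩) hX hv hx1
  rw [hx1, ← hAQ] at hAlim
  -- The Hamiltonian is written through X r and the scaled charge alone, all of which converge; the
  -- |p|² term has the factor ν_r⁻¹ → 0.
  have hlim : Tendsto (fun r => 2 * Real.pi * c ^ 2 * ‖E‖ ^ 2
      + 1 / (8 * Real.pi) * (‖X r‖ ^ 2 - z * ‖Kr r (X r)‖ ^ 2)
      - c ^ 2 / (8 * Real.pi * e ^ 2) * (invCoupling c e m ρ r)⁻¹ * ‖p‖ ^ 2
      + ⟪p, (c / (4 * Real.pi * e)) • (invCoupling c e m ρ r)⁻¹ •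
        pair (scaled ρ r) (Kr r (X r))⟫ + V q) (𝓝[>] 0)
      (𝓝 (2 * Real.pi * c ^ 2 * ‖E‖ ^ 2 + 1 / (8 * Real.pi) * (‖x‖ ^ 2 - z * ‖A‖ ^ 2)
        - c ^ 2 / (8 * Real.pi * e ^ 2) * 0 * ‖p‖ ^ 2
        + ⟪p, (c / (4 * Real.pi * e)) • κ • Q⟫ + V q)) := by
    refine ((((tendsto_const_nhds.add (Tendsto.const_mul _ ((hX.norm.pow 2).sub
      ((hAlim.norm.pow 2).const_mul z)))).sub ?_).add ?_).add tendsto_const_nhds)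
    · exact ((tendsto_inv_atTop_zero.comp hνt).const_mul _).mul_const _
    · exact tendsto_const_nhds.inner (hk.const_smul _)
  have hval : 2 * Real.pi * c ^ 2 * ‖E‖ ^ 2 + 1 / (8 * Real.pi) * (‖x‖ ^ 2 - z * ‖A‖ ^ 2)
        - c ^ 2 / (8 * Real.pi * e ^ 2) * 0 * ‖p‖ ^ 2
        + ⟪p, (c / (4 * Real.pi * e)) • κ • Q⟫ + V q = limHamiltonian c e m z V A E q p := by
    have h1 : c / (4 * Real.pi * e) * κ = 1 := by
      rw [hκ]
      field_simp
    rw [smul_smul, h1, one_smul, hx2, limHamiltonian, Fm, norm_smul, mul_pow, Real.norm_eq_abs,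
      sq_abs]
    ring
  rw [hval] at hlim
  refine hlim.congr' ?_
  filter_upwards [hgood, hνpos] with r hr1 hr2
  rw [regHamiltonian_eq hc.ne' he V (Ar r) E q p hr2.ne', hr1.1, hr1.2]
  ring

end PointMaxwell

end

theorem theorem3p5 (c e m : ℝ) (hc : 0 < c) (he : e ≠ 0) (hm : 0 < m)
    (ρ : PointMaxwell.E3 → ℝ) (hρ : PointMaxwell.IsDensity ρ)
    (V : PointMaxwell.E3 → ℝ)
    (lam : ℝ) (hlam : PointMaxwell.lam0 c e m < lam)
    (E : PointMaxwell.L2s) (q p : PointMaxwell.E3)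
    (Ar : ℝ → PointMaxwell.L2s) (hAr : ∀ r : ℝ, 0 < r → PointMaxwell.IsH1 (Ar r))
    (A : PointMaxwell.L2s) (hA : A ∈ PointMaxwell.formDomain c e lam)
    (hconv : PointMaxwell.EnergyConv c e m ρ lam Ar A) :
    Filter.Tendsto
      (fun r : ℝ => PointMaxwell.regHamiltonian c e m ρ V r (Ar r) E q p)
      (nhdsWithin 0 (Set.Ioi 0))
      (nhds (PointMaxwell.limHamiltonian c e m lam V A E q p)) :=
  PointMaxwell.tendsto_regHamiltonian hc he hρ V hlam E q p hAr hA hconv
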